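/- Notation. $\mathbb H$ is the upper half-plane with the hyperbolic metric $y^{-2}(dx^2+dy^2)$, on which $PSL(2,\mathbb R)=SL(2,\mathbb R)/\{\pm 1\}$ acts by fractional linear transformations. A Fuchsian group is a discrete subgroup of $PSL(2,\mathbb R)$. For a real number $a\ge 0$ put $\mathrm{tr}(a)=2\cosh(a/2)$. For $\ell_1,\ell_2,\ell_3\ge 0$, a Y-piece $Y(\ell_1,\ell_2,\ell_3)$ is a hyperbolic surface whose interior is homeomorphic to a sphere with three points removed and whose three ends are as follows: for each $i$ with $\ell_i>0$ the corresponding end is bounded by a simple closed boundary geodesic of length $\ell_i$, and for each $i$ with $\ell_i=0$ the corresponding end is a cusp; the boundary geodesics are pairwise disjoint and form the whole boundary. A quotient surface $\Gamma\backslash\mathbb H$ contains a Y-piece $Y(\ell_1,\ell_2,\ell_3)$ if some closed subset of $\Gamma\backslash\mathbb H$, free of cone points and equal to the closure of its interior, is such a surface for the hyperbolic structure of $\Gamma\backslash\mathbb H$. Proposition. Let $u$ and $v$ be non-negative real numbers, let $\varepsilon\in\{1,-1\}$, and let $T_u,T_v\in PSL(2,\mathbb R)$ be represented by real matrices of determinant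 $1$, $$T_u=\begin{bmatrix}a_1&b_1\\ c&d\end{bmatrix},\qquad T_v=\begin{bmatrix}a_2&b_2\\ c&d\end{bmatrix},$$ with the same second row and $c\neq 0$, such that $a_1+d=\varepsilon\,\mathrm{tr}(u)$ and $a_2+d=-\varepsilon\,\mathrm{tr}(v)$. Then $\Gamma=\langle T_u,T_v\rangle$ is a Fuchsian group, and the surface $\Gamma\backslash\mathbb H$ contains a Y-piece $Y(u,v,0)$. -/

import Mathlib

open UpperHalfPlane Filter Topology
open scoped MatrixGroups

namespace YPieces

/-- The element of `PSL(2, ℝ) = SL(2, ℝ) / {±1}` represented by a matrix of determinant one. -/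
def toPSL (A : SL(2, ℝ)) : PSL(2, ℝ) := QuotientGroup.mk A

/-- The action of `PSL(2, ℝ)` on the hyperbolic plane by fractional linear transformations. -/
noncomputable instance instMulActionPSL : MulAction PSL(2, ℝ) ℍ :=
  MulAction.compHom ℍ (Matrix.ProjectiveSpecialLinearGroup.toPGL (n := Fin 2) (R := ℝ))

theorem coe_toPSL_smul (A : SL(2, ℝ)) (z : ℍ) :
    ((toPSL A • z : ℍ) : ℂ) = ((A 0 0 : ℂ) * z + A 0 1) / ((A 1 0 : ℂ) * z + A 1 1) := by
  have h : toPSL A • z = A • z := rfl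
  rw [h, UpperHalfPlane.coe_specialLinearGroup_apply]
  rfl

/-- A Fuchsian group is a discrete subgroup of `PSL(2, ℝ)` (for the quotient topology of the
topology of `SL(2, ℝ)`). -/
def IsFuchsian (Γ : Subgroup PSL(2, ℝ)) : Prop := DiscreteTopology Γ

/-- `tr a = 2 cosh (a / 2)` for a length `a`. -/
noncomputable def lengthTrace (a : ℝ) : ℝ := 2 * Real.cosh (a / 2)

/-- The quotient `Γ \ ℍ`, with the quotient topology. -/
abbrev Surface (Γ : Subgroup PSL(2, ℝ)) : Type := MulAction.orbitRel.Quotient Γ ℍ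

/-- The projection `ℍ → Γ \ ℍ`. The hyperbolic structure of `Γ \ ℍ` is the one for which this map
is a local isometry away from the points of `ℍ` with nontrivial stabilizer. -/
noncomputable def proj (Γ : Subgroup PSL(2, ℝ)) (z : ℍ) : Surface Γ := Quotient.mk _ z

/-- `β` is a simple closed geodesic of length `ℓ` in `Γ \ ℍ`: the image of a complete geodesic line
of `ℍ`, parametrized by arc length, two parameters giving the same point of `Γ \ ℍ` exactly when
they differ by an integer multiple of `ℓ`. -/
def IsSimpleClosedGeodesic (Γ : Subgroup PSL(2, ℝ)) (ℓ : ℝ) (β : Set (Surface Γ)) : Prop :=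
  0 < ℓ ∧ ∃ γ : ℝ → ℍ, Isometry γ ∧
    (∀ s t : ℝ, proj Γ (γ s) = proj Γ (γ t) ↔ ∃ n : ℤ, s - t = n * ℓ) ∧
    β = Set.range (fun t => proj Γ (γ t))

/-- The matrix of the parabolic transformation `z ↦ z + 1`. -/
def translationMatrix : SL(2, ℝ) := ⟨!![1, 1; 0, 1], by simp [Matrix.det_fin_two]⟩

/-- The parabolic element `z ↦ z + 1`. -/
def unitTranslation : PSL(2, ℝ) := toPSL translationMatrix

/-- The filter `F` on `Γ \ ℍ` is the neighbourhood filter of a cusp: for some `g` the point `g ∞`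
is fixed by the parabolic element `g (z ↦ z + 1) g⁻¹` of `Γ`, and the images of the horoballs
`g {Im z > t}` form a basis of `F`. -/
def IsCuspFilter (Γ : Subgroup PSL(2, ℝ)) (F : Filter (Surface Γ)) : Prop :=
  ∃ g : PSL(2, ℝ), g * unitTranslation * g⁻¹ ∈ Γ ∧
    F = map (fun z : ℍ => proj Γ (g • z)) atImInfty

/-- `Y` is a Y-piece `Y(ℓ 0, ℓ 1, ℓ 2)` contained in the surface `Γ \ ℍ`, with the hyperbolic
structure of `Γ \ ℍ`: a closed subset without cone points that is the closure of its interior, the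
interior being homeomorphic to the sphere (here the Riemann sphere) with three points `p 0`, `p 1`,
`p 2` removed. For `ℓ i > 0` the puncture `p i` is bounded by the simple closed geodesic `β i` of
length `ℓ i`; for `ℓ i = 0` it is a cusp, and `β i` is empty. The `β i` are pairwise disjoint and
make up the whole boundary of `Y`. -/
structure IsYPiece (Γ : Subgroup PSL(2, ℝ)) (ℓ : Fin 3 → ℝ) (Y : Set (Surface Γ)) : Prop where
  no_cone_point : ∀ z : ℍ, proj Γ z ∈ Y → MulAction.stabilizer Γ z = ⊥
  closure_interior : closure (interior Y) = Y
  exists_boundary : ∃ (p : Fin 3 → OnePoint ℂ) (β : Fin 3 → Set (Surface Γ))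
    (φ : interior Y ≃ₜ {x : OnePoint ℂ // x ∉ Set.range p}),
    Function.Injective p ∧
    frontier Y = ⋃ i, β i ∧
    Pairwise (fun i j => Disjoint (β i) (β j)) ∧
    ∀ i : Fin 3,
      let F : Filter (Surface Γ) :=
        map (fun y : interior Y => (y : Surface Γ))
          (comap (fun y : interior Y => ((φ y : _) : OnePoint ℂ)) (𝓝 (p i)))
      (0 < ℓ i ∧ IsSimpleClosedGeodesic Γ (ℓ i) (β i) ∧ F = 𝓝ˢ (β i) ⊓ 𝓟 (interior Y)) ∨
      (ℓ i = 0 ∧ β i = ∅ ∧ IsCuspFilter Γ F)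

end YPieces

namespace YPieces

set_option linter.unusedSectionVars false

/-! ### Three reflections of the hyperbolic plane -/

/-! Write U = tr(u) and V = tr(v), so that U, V ≥ 2. The affine map z ↦ cz + d conjugates a matrix
with lower row (c, d), c > 0, and trace m into z ↦ m - 1/z, while z ↦ -1/z exchanges m and -m up to
inverting the transformation. It therefore suffices to study the group generated by z ↦ U - 1/z and
z ↦ -V - 1/z. Each generator is the inversion in the unit circle followed by the reflection in Re z
= U/2 or Re z = -V/2, so the group is the even part of a group generated by three reflections whose
axes are pairwise disjoint in ℍ.

Ping-pong (`word_mem_cap`) and a descent on heights (`exists_word_triangle`) show that the region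
between the three axes is a strict fundamental domain of the reflection group
(`word_eq_of_mem_triangle`). Discreteness and absence of fixed points follow, and the quotient
surface is the double of that region along its sides. Functions on the region extend to the double
by an involution that fixes their values on the sides (`exists_surface_function`).

In the Klein coordinates X = Re z / (1 + |z|²), Y = 1 / (1 + |z|²) the plane is a disc and the
region is cut out by the lines Y = 1/2, 2X = UY and -2X = VY. For U > 2 the common perpendicular of
the unit circle and Re z = U/2 is UX = 1; for V > 2 the other one is VX = -1. The Y-piece is the set
-1 ≤ VX, UX ≤ 1 of the surface. The modulus (1 + VX)/(1 - UX), with an argument running from 0 on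
the vertical sides to π on the circle, carries one half of its interior to the closed upper half
plane without 0 and 1; doubling gives the plane without 0 and 1.

The punctures ∞, 0, 1 correspond to UX → 1, VX → -1 and Y → 0. The last is the cusp at infinity. If
u > 0, the line UX = 1 closes up to a geodesic of length u, because the two reflections preserving
it compose to a translation by u (`isSimpleClosedGeodesic_axis`), and compactness of a collar
identifies the end with its neighbourhoods. If u = 0, the line misses the disc and the end is a cusp
at a parabolic fixed point (`isCuspFilter_side`). The end of v is symmetric. -/

/-- The reflection in the vertical line `Re z = m / 2`. -/
noncomputable def refl (m : ℝ) (z : ℍ) : ℍ := ⟨⟨m - z.re, z.im⟩, z.im_pos⟩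

/-- The reflection in the unit circle. -/
noncomputable def inversion (z : ℍ) : ℍ :=
  ⟨⟨z.re / (z.re ^ 2 + z.im ^ 2), z.im / (z.re ^ 2 + z.im ^ 2)⟩, by
    have := z.im_pos
    change 0 < z.im / (z.re ^ 2 + z.im ^ 2)
    positivity⟩

@[simp] theorem refl_re (m : ℝ) (z : ℍ) : (refl m z).re = m - z.re := rfl
@[simp] theorem refl_im (m : ℝ) (z : ℍ) : (refl m z).im = z.im := rfl
@[simp] theorem inversion_re (z : ℍ) : (inversion z).re = z.re / (z.re ^ 2 + z.im ^ 2) := rfl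
@[simp] theorem inversion_im (z : ℍ) : (inversion z).im = z.im / (z.re ^ 2 + z.im ^ 2) := rfl

theorem normSq_pos' (z : ℍ) : 0 < z.re ^ 2 + z.im ^ 2 := by
  have := z.im_pos
  positivity

theorem inversion_normSq (z : ℍ) :
    (inversion z).re ^ 2 + (inversion z).im ^ 2 = 1 / (z.re ^ 2 + z.im ^ 2) := by
  have := normSq_pos' z
  simp only [inversion_re, inversion_im]
  field_simp

theorem refl_refl (m : ℝ) (z : ℍ) : refl m (refl m z) = z := by
  apply UpperHalfPlane.ext_re_im <;> simp

theorem inversion_inversion (z : ℍ) : inversion (inversion z) = z := by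
  have := normSq_pos' z
  have h := inversion_normSq z
  apply UpperHalfPlane.ext_re_im
  · rw [inversion_re, h, inversion_re]; field_simp
  · rw [inversion_im, h, inversion_im]; field_simp

theorem continuous_refl (m : ℝ) : Continuous (refl m) := by
  rw [UpperHalfPlane.isEmbedding_coe.continuous_iff]
  have h : (UpperHalfPlane.coe ∘ refl m) =
      fun z : ℍ => ((m - z.re : ℝ) : ℂ) + (z.im : ℝ) * Complex.I := by
    ext z
    exact (re_add_im (refl m z)).symm
  rw [h]
  have := UpperHalfPlane.continuous_re
  have := UpperHalfPlane.continuous_im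
  fun_prop

theorem continuous_inversion : Continuous inversion := by
  rw [UpperHalfPlane.isEmbedding_coe.continuous_iff]
  have h : (UpperHalfPlane.coe ∘ inversion) =
      fun z : ℍ => ((z.re / (z.re ^ 2 + z.im ^ 2) : ℝ) : ℂ) +
        (z.im / (z.re ^ 2 + z.im ^ 2) : ℝ) * Complex.I := by
    ext z
    exact (re_add_im (inversion z)).symm
  rw [h]
  have h1 := UpperHalfPlane.continuous_re
  have h2 := UpperHalfPlane.continuous_im
  have h3 : Continuous fun z : ℍ => z.re / (z.re ^ 2 + z.im ^ 2) :=
    h1.div (by fun_prop) fun z => (normSq_pos' z).ne'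
  have h4 : Continuous fun z : ℍ => z.im / (z.re ^ 2 + z.im ^ 2) :=
    h2.div (by fun_prop) fun z => (normSq_pos' z).ne'
  fun_prop

/-- The reflections in the three sides of the triangle `triangle U V`. -/
noncomputable def side (U V : ℝ) : Fin 3 → ℍ → ℍ := ![inversion, refl U, refl (-V)]

@[simp] theorem side_zero (U V : ℝ) : side U V 0 = inversion := rfl
@[simp] theorem side_one (U V : ℝ) : side U V 1 = refl U := rfl
@[simp] theorem side_two (U V : ℝ) : side U V 2 = refl (-V) := rfl

@[simp] theorem side_side (U V : ℝ) (i : Fin 3) (z : ℍ) : side U V i (side U V i z) = z := by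
  fin_cases i
  exacts [inversion_inversion z, refl_refl U z, refl_refl (-V) z]

theorem continuous_side (U V : ℝ) (i : Fin 3) : Continuous (side U V i) := by
  fin_cases i
  exacts [continuous_inversion, continuous_refl U, continuous_refl (-V)]

/-- The composition of the reflections whose indices are listed in `L`. -/
noncomputable def word (U V : ℝ) (L : List (Fin 3)) (z : ℍ) : ℍ :=
  L.foldr (fun i w => side U V i w) z

@[simp] theorem word_nil (U V : ℝ) (z : ℍ) : word U V [] z = z := rfl
@[simp] theorem word_cons (U V : ℝ) (i : Fin 3) (L : List (Fin 3)) (z : ℍ) :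
    word U V (i :: L) z = side U V i (word U V L z) := rfl

theorem word_append (U V : ℝ) (L M : List (Fin 3)) (z : ℍ) :
    word U V (L ++ M) z = word U V L (word U V M z) := by
  simp [word]

theorem word_reverse_word (U V : ℝ) (L : List (Fin 3)) (z : ℍ) :
    word U V L.reverse (word U V L z) = z := by
  induction L generalizing z with
  | nil => rfl
  | cons i L ih => simp [word_append, ih]

theorem word_word_reverse (U V : ℝ) (L : List (Fin 3)) (z : ℍ) :
    word U V L (word U V L.reverse z) = z := by
  simpa using word_reverse_word U V L.reverse z

theorem continuous_word (U V : ℝ) (L : List (Fin 3)) : Continuous (word U V L) := by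
  induction L with
  | nil => exact continuous_id
  | cons i L ih => exact (continuous_side U V i).comp ih

/-! ### The triangle is a strict fundamental domain -/

/-- The hyperbolic triangle bounded by `Re z = -V / 2`, `Re z = U / 2` and the unit circle. -/
def triangle (U V : ℝ) : Set ℍ :=
  {z | -(V / 2) ≤ z.re ∧ z.re ≤ U / 2 ∧ 1 ≤ z.re ^ 2 + z.im ^ 2}

/-- The closed half planes cut off by the sides of `triangle U V`. -/
def cap (U V : ℝ) : Fin 3 → Set ℍ :=
  ![{z | z.re ^ 2 + z.im ^ 2 ≤ 1}, {z | U / 2 ≤ z.re}, {z | z.re ≤ -(V / 2)}]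

@[simp] theorem mem_cap_zero {U V : ℝ} {z : ℍ} : z ∈ cap U V 0 ↔ z.re ^ 2 + z.im ^ 2 ≤ 1 := Iff.rfl
@[simp] theorem mem_cap_one {U V : ℝ} {z : ℍ} : z ∈ cap U V 1 ↔ U / 2 ≤ z.re := Iff.rfl
@[simp] theorem mem_cap_two {U V : ℝ} {z : ℍ} : z ∈ cap U V 2 ↔ z.re ≤ -(V / 2) := Iff.rfl

theorem isClosed_cap (U V : ℝ) (i : Fin 3) : IsClosed (cap U V i) := by
  have h1 := UpperHalfPlane.continuous_re
  have h2 := UpperHalfPlane.continuous_im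
  fin_cases i
  · exact isClosed_le (f := fun z : ℍ => z.re ^ 2 + z.im ^ 2) (g := fun _ => 1)
      (by fun_prop) (by fun_prop)
  · exact isClosed_le (f := fun _ => U / 2) (g := fun z : ℍ => z.re) (by fun_prop) (by fun_prop)
  · exact isClosed_le (f := fun z : ℍ => z.re) (g := fun _ => -(V / 2)) (by fun_prop) (by fun_prop)

/-- Outside the interior of the cap `i`, the reflection in the side `i` takes values in the cap. -/
theorem side_mem_cap {U V : ℝ} {i : Fin 3} {z : ℍ} (h : z ∉ cap U V i ∨ z ∈ triangle U V) :
    side U V i z ∈ cap U V i := by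
  have key : (i = 0 → 1 ≤ z.re ^ 2 + z.im ^ 2) ∧ (i = 1 → z.re ≤ U / 2) ∧
      (i = 2 → -(V / 2) ≤ z.re) := by
    rcases h with h | h
    · refine ⟨?_, ?_, ?_⟩ <;> rintro rfl <;> simp at h <;> linarith
    · exact ⟨fun _ => h.2.2, fun _ => h.2.1, fun _ => h.1⟩
  fin_cases i
  · have h1 := key.1 rfl
    have h2 := inversion_normSq z
    simp only [Fin.zero_eta, side_zero, mem_cap_zero]
    rw [h2, div_le_one (by linarith)]
    exact h1
  · have := key.2.1 rfl
    simp; linarith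
  · have := key.2.2 rfl
    simp; linarith

/-- Away from the cap `i`, or on the triangle, only the points of the side `i` are fixed. -/
theorem side_eq_self {U V : ℝ} {i : Fin 3} {z : ℍ} (h1 : z ∈ cap U V i) (h2 : z ∈ triangle U V) :
    side U V i z = z := by
  obtain ⟨h3, h4, h5⟩ := h2
  fin_cases i
  · have h : z.re ^ 2 + z.im ^ 2 = 1 := le_antisymm h1 h5
    apply UpperHalfPlane.ext_re_im <;> simp [h]
  · have h : U / 2 ≤ z.re := h1
    exact UpperHalfPlane.ext_re_im (by simp; linarith) rfl
  · have h : z.re ≤ -(V / 2) := h1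
    exact UpperHalfPlane.ext_re_im (by simp; linarith) rfl

theorem mem_cap_of_side_eq_self {U V : ℝ} {i : Fin 3} {z : ℍ} (h : side U V i z = z) :
    z ∈ cap U V i := by
  fin_cases i
  · have h1 := inversion_normSq z
    simp only [Fin.zero_eta, side_zero] at h
    rw [h] at h1
    have h2 := normSq_pos' z
    rw [eq_div_iff h2.ne'] at h1
    simp only [Fin.zero_eta, mem_cap_zero]
    nlinarith
  · have h1 := congrArg UpperHalfPlane.re h
    simp at h1 ⊢; linarith
  · have h1 := congrArg UpperHalfPlane.re h
    simp at h1 ⊢; linarith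

section
variable {U V : ℝ} (hU : 2 ≤ U) (hV : 2 ≤ V)
include hU hV

/-- Since U, V ≥ 2, the vertical lines do not enter the open unit disc. In the limiting case of
equality they touch the circle only at a real point, which positivity of the imaginary part
excludes. -/
theorem disjoint_cap {i j : Fin 3} (hij : i ≠ j) : Disjoint (cap U V i) (cap U V j) := by
  have h01 : Disjoint (cap U V 0) (cap U V 1) := Set.disjoint_left.2 fun z h1 h2 => by
    have := z.im_pos
    simp only [mem_cap_zero, mem_cap_one] at h1 h2
    nlinarith
  have h02 : Disjoint (cap U V 0) (cap U V 2) := Set.disjoint_left.2 fun z h1 h2 => by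
    have := z.im_pos
    simp only [mem_cap_zero, mem_cap_two] at h1 h2
    nlinarith
  have h12 : Disjoint (cap U V 1) (cap U V 2) := Set.disjoint_left.2 fun z h1 h2 => by
    simp only [mem_cap_one, mem_cap_two] at h1 h2
    linarith
  fin_cases i <;> fin_cases j <;>
    first | exact absurd rfl hij | assumption | exact Disjoint.symm (by assumption)

/-- Ping-pong for reduced words. -/
theorem word_mem_cap {L : List (Fin 3)} {i : Fin 3} (hL : (i :: L).IsChain (· ≠ ·)) {z : ℍ}
    (hz : z ∈ triangle U V) : word U V (i :: L) z ∈ cap U V i := by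
  induction L generalizing i with
  | nil => exact side_mem_cap (Or.inr hz)
  | cons j L ih =>
    rw [List.isChain_cons_cons] at hL
    exact side_mem_cap (Or.inl fun h =>
      Set.disjoint_left.1 (disjoint_cap hU hV hL.1) h (ih hL.2))

end

/-- Each reflection is an involution, so adjacent equal letters cancel in pairs, which preserves the
parity of the length. -/
theorem exists_reduced (U V : ℝ) (L : List (Fin 3)) : ∃ M : List (Fin 3), M.IsChain (· ≠ ·) ∧
    (Even M.length ↔ Even L.length) ∧ word U V M = word U V L := by
  induction L with
  | nil => exact ⟨[], by simp, Iff.rfl, rfl⟩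
  | cons i L ih =>
    obtain ⟨M, h1, h2, h3⟩ := ih
    rcases M with _ | ⟨j, M⟩
    · refine ⟨[i], by simp, ?_, ?_⟩
      · simp [Nat.even_add_one, ← h2]
      · funext z; simp [← h3]
    · by_cases hij : i = j
      · subst hij
        refine ⟨M, h1.tail, ?_, ?_⟩
        · simp only [List.length_cons, Nat.even_add_one] at h2 ⊢; tauto
        · funext z; rw [word_cons, ← h3, word_cons, side_side]
      · refine ⟨i :: j :: M, List.isChain_cons_cons.2 ⟨hij, h1⟩, ?_, ?_⟩
        · simp only [List.length_cons, Nat.even_add_one] at h2 ⊢; tauto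
        · funext z; rw [word_cons, h3, word_cons]

section
variable {U V : ℝ} (hU : 2 ≤ U) (hV : 2 ≤ V)
include hU hV

/-- Points of the triangle equivalent under the reflection group are equal, and a word stabilizing
a point of the triangle acts either trivially or as the reflection in a side. -/
theorem word_eq_of_mem_triangle {L : List (Fin 3)} {z : ℍ} (hz : z ∈ triangle U V)
    (hLz : word U V L z ∈ triangle U V) : word U V L z = z ∧
      ((Even L.length ∧ ∀ w, word U V L w = w) ∨ (¬ Even L.length ∧ ∃ i, side U V i z = z)) := by
  obtain ⟨M, h1, h2, h3⟩ := exists_reduced U V L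
  rw [← h3] at hLz ⊢
  rw [← h2]
  rcases M with _ | ⟨i, M⟩
  · exact ⟨rfl, Or.inl ⟨by simp, fun w => rfl⟩⟩
  -- The image lies in the cap of the first letter and in the triangle, hence on that side, and
  -- dropping the letter does not move it. A second letter would put the same point in a disjoint
  -- cap.
  · have h4 := side_eq_self (word_mem_cap hU hV h1 hz) hLz
    rw [word_cons, side_side] at h4
    rcases M with _ | ⟨j, M⟩
    · exact ⟨h4.symm, Or.inr ⟨by simp, i, h4.symm⟩⟩
    · rw [List.isChain_cons_cons] at h1
      have h5 := word_mem_cap hU hV h1.2 hz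
      have h6 := word_mem_cap hU hV (List.isChain_cons_cons.2 h1) hz
      rw [word_cons, ← h4] at h6
      exact absurd h6 (Set.disjoint_right.1 (disjoint_cap hU hV h1.1) h5)

end

/-- Induction principle for the group generated by two reflections of the real line. -/
theorem dihedral_induction {a b : ℝ} (hab : a < b) {P : ℝ → Prop} (ha : ∀ x, P x → P (a - x))
    (hb : ∀ x, P x → P (b - x)) (h : ∀ x, a / 2 ≤ x → x ≤ b / 2 → P x) (x : ℝ) : P x := by
  have h1 : ∀ x, P x → P (x + (b - a)) := fun x hx => by
    convert hb _ (ha x hx) using 1; ring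
  have h2 : ∀ x, P x → P (x - (b - a)) := fun x hx => by
    convert ha _ (hb x hx) using 1; ring
  have h3 : ∀ n : ℕ, ∀ x, P x → P (x + n * (b - a)) ∧ P (x - n * (b - a)) := by
    intro n
    induction n with
    | zero => intro x hx; simpa using hx
    | succ n ih =>
      intro x hx
      constructor
      · convert h1 _ (ih x hx).1 using 1; push_cast; ring
      · convert h2 _ (ih x hx).2 using 1; push_cast; ring
  have h4 : ∀ n : ℤ, ∀ x, P x → P (x + n * (b - a)) := by
    intro n x hx
    obtain ⟨k, rfl | rfl⟩ := n.eq_nat_or_neg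
    · exact (h3 k x hx).1
    · convert (h3 k x hx).2 using 1; push_cast; ring
  -- A full period b - a consists of the interval [a/2, b/2] and its mirror image under x ↦ b - x.
  have h5 : ∀ x, a / 2 ≤ x → x ≤ a / 2 + (b - a) → P x := by
    intro x hx1 hx2
    rcases le_total x (b / 2) with hx | hx
    · exact h x hx1 hx
    · convert hb _ (h (b - x) (by linarith) (by linarith)) using 1; ring
  have h6 := h5 (toIcoMod (sub_pos.2 hab) (a / 2) x)
    (left_le_toIcoMod _ _ _) (toIcoMod_lt_right _ _ _).le
  have h7 := h4 (toIcoDiv (sub_pos.2 hab) (a / 2) x) _ h6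
  rwa [← zsmul_eq_mul, toIcoMod_add_toIcoDiv_zsmul] at h7

/-- Every point is mapped into the strip by a word in the reflections in its sides. -/
theorem exists_word_strip {U V : ℝ} (hUV : 0 < U + V) (z : ℍ) : ∃ (L : List (Fin 3)) (w : ℍ),
    z = word U V L w ∧ w.im = z.im ∧ -(V / 2) ≤ w.re ∧ w.re ≤ U / 2 := by
  have key := dihedral_induction (a := -V) (b := U) (by linarith)
    (P := fun x => ∀ z : ℍ, z.re = x → ∃ (L : List (Fin 3)) (w : ℍ),
      z = word U V L w ∧ w.im = z.im ∧ -(V / 2) ≤ w.re ∧ w.re ≤ U / 2) ?_ ?_ ?_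
  · exact key z.re z rfl
  · intro x hx z hz
    obtain ⟨L, w, h1, h2, h3⟩ := hx (refl (-V) z) (by simp [hz])
    exact ⟨2 :: L, w, by rw [word_cons, ← h1, side_two, refl_refl], by simpa using h2, h3⟩
  · intro x hx z hz
    obtain ⟨L, w, h1, h2, h3⟩ := hx (refl U z) (by simp [hz])
    exact ⟨1 :: L, w, by rw [word_cons, ← h1, side_one, refl_refl], by simpa using h2, h3⟩
  · rintro x h1 h2 z rfl
    exact ⟨[], z, rfl, rfl, by linarith, h2⟩

/-- The translates of the triangle cover the hyperbolic plane. -/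
theorem exists_word_triangle {U V : ℝ} (hU : 2 ≤ U) (hV : 2 ≤ V) (z : ℍ) :
    ∃ (L : List (Fin 3)) (w : ℍ), z = word U V L w ∧ w ∈ triangle U V := by
  -- The number y bounds all heights met from below, and each unsuccessful inversion multiplies the
  -- height by at least 1 + y²; n bounds the inversions still needed before the height exceeds 1.
  have key : ∀ y : ℝ, 0 < y → ∀ n : ℕ, ∀ z : ℍ, y ≤ z.im → 1 < z.im * (1 + y ^ 2) ^ n →
      ∃ (L : List (Fin 3)) (w : ℍ), z = word U V L w ∧ w ∈ triangle U V := by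
    intro y hy n
    induction n with
    | zero =>
      intro z hz1 hz2
      obtain ⟨L, w, h1, h2, h3, h4⟩ := exists_word_strip (U := U) (V := V) (by linarith) z
      exact ⟨L, w, h1, h3, h4, by nlinarith⟩
    | succ n ih =>
      intro z hz1 hz2
      obtain ⟨L, w, h1, h2, h3, h4⟩ := exists_word_strip (U := U) (V := V) (by linarith) z
      rcases le_or_gt 1 (w.re ^ 2 + w.im ^ 2) with h5 | h5
      · exact ⟨L, w, h1, h3, h4, h5⟩
      · have h6 := inversion_normSq w
        have hw := normSq_pos' w
        have hwim := w.im_pos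
        have h7 : (inversion w).im * (w.re ^ 2 + w.im ^ 2) = w.im := by
          rw [inversion_im]; field_simp
        have h7' : w.im ≤ (inversion w).im := by
          nlinarith [(inversion w).im_pos]
        by_cases h8 : inversion w ∈ triangle U V
        · exact ⟨L ++ [0], inversion w, by
            rw [word_append, word_cons, word_nil, side_zero, inversion_inversion, h1], h8⟩
        -- The strip contains every point with |Re| < 1, so an inverted point outside the triangle
        -- has |Re| ≥ 1. Its squared modulus, which is the growth factor of the height, is then at
        -- least 1 + y².
        · have h9 : 1 ≤ (inversion w).re ^ 2 := by
            by_contra h9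
            push Not at h9
            have := abs_lt.1 ((sq_lt_one_iff_abs_lt_one _).1 h9)
            exact h8 ⟨by linarith, by linarith, by
              rw [h6, le_div_iff₀ hw]; linarith⟩
          have h10 : 1 + y ^ 2 ≤ 1 / (w.re ^ 2 + w.im ^ 2) := by
            rw [← h6]; nlinarith
          have h11 : w.im * (1 + y ^ 2) ≤ (inversion w).im := by
            rw [inversion_im, div_eq_mul_one_div]
            gcongr
          obtain ⟨M, w', h12, h13⟩ := ih (inversion w) (by linarith) (by
            calc 1 < z.im * (1 + y ^ 2) ^ (n + 1) := hz2
              _ = w.im * (1 + y ^ 2) * (1 + y ^ 2) ^ n := by rw [h2]; ring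
              _ ≤ _ := by gcongr)
          exact ⟨L ++ 0 :: M, w', by
            rw [word_append, word_cons, ← h12, side_zero, inversion_inversion, h1], h13⟩
  have hz := z.im_pos
  obtain ⟨n, hn⟩ := pow_unbounded_of_one_lt (1 / z.im) (y := 1 + z.im ^ 2) (by nlinarith)
  exact key z.im hz n z le_rfl (by rwa [div_lt_iff₀ hz, mul_comm] at hn)

/-! ### The action of `PSL(2, ℝ)` -/

theorem coe_toPSL_smul' {A : SL(2, ℝ)} {a b c d : ℝ}
    (hA : (A : Matrix (Fin 2) (Fin 2) ℝ) = !![a, b; c, d]) (z : ℍ) :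
    ((toPSL A • z : ℍ) : ℂ) = ((a : ℂ) * z + b) / ((c : ℂ) * z + d) := by
  have h : ∀ i j, A i j = (!![a, b; c, d] : Matrix (Fin 2) (Fin 2) ℝ) i j := fun i j => by rw [← hA]
  rw [coe_toPSL_smul, h, h, h, h]
  simp

theorem toPSL_surjective : Function.Surjective toPSL := QuotientGroup.mk_surjective

theorem toPSL_mul (A B : SL(2, ℝ)) : toPSL (A * B) = toPSL A * toPSL B := rfl

theorem toPSL_inv (A : SL(2, ℝ)) : toPSL A⁻¹ = (toPSL A)⁻¹ := rfl

theorem toPSL_one : toPSL 1 = 1 := rfl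

theorem toPSL_neg (A : SL(2, ℝ)) : toPSL (-A) = toPSL A := by
  refine (QuotientGroup.eq).2 ?_
  rw [Matrix.SpecialLinearGroup.mem_center_iff]
  refine ⟨-1, by simp, ?_⟩
  ext i j
  have : (-A)⁻¹ * A = -1 := by rw [inv_mul_eq_iff_eq_mul]; simp
  rw [this]
  fin_cases i <;> fin_cases j <;> simp

theorem coe_denom_ne_zero (A : SL(2, ℝ)) (z : ℍ) : (A 1 0 : ℂ) * z + A 1 1 ≠ 0 :=
  UpperHalfPlane.denom_ne_zero (A : GL (Fin 2) ℝ) z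

instance : ContinuousConstSMul PSL(2, ℝ) ℍ where
  continuous_const_smul g := by
    obtain ⟨A, rfl⟩ := toPSL_surjective g
    exact continuous_const_smul (A : GL (Fin 2) ℝ)

instance (Γ : Subgroup PSL(2, ℝ)) : ContinuousConstSMul Γ ℍ :=
  ⟨fun g => continuous_const_smul (g : PSL(2, ℝ))⟩

/-- The orbit maps of `PSL(2, ℝ)` are continuous. -/
theorem continuous_smul_point (z : ℍ) : Continuous fun g : PSL(2, ℝ) => g • z := by
  have h : Continuous fun A : SL(2, ℝ) => toPSL A • z := by
    rw [UpperHalfPlane.isEmbedding_coe.continuous_iff]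
    have h1 : (UpperHalfPlane.coe ∘ fun A : SL(2, ℝ) => toPSL A • z) =
        fun A : SL(2, ℝ) => ((A 0 0 : ℂ) * z + A 0 1) / ((A 1 0 : ℂ) * z + A 1 1) :=
      funext fun A => coe_toPSL_smul A z
    rw [h1]
    have h2 : ∀ i j, Continuous fun A : SL(2, ℝ) => ((A i j : ℝ) : ℂ) := fun i j =>
      Complex.continuous_ofReal.comp
        ((continuous_apply j).comp ((continuous_apply i).comp continuous_subtype_val))
    refine Continuous.div (((h2 0 0).mul continuous_const).add (h2 0 1))
      (((h2 1 0).mul continuous_const).add (h2 1 1)) fun A => ?_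
    exact coe_denom_ne_zero A z
  exact (QuotientGroup.isQuotientMap_mk (N := Subgroup.center SL(2, ℝ))).continuous_iff.2 h

theorem eq_one_of_forall_smul {g : PSL(2, ℝ)} (h : ∀ z : ℍ, g • z = z) : g = 1 := by
  obtain ⟨A, rfl⟩ := toPSL_surjective g
  have h1 : ∀ z : ℍ, ((A 0 0 : ℂ) * z + A 0 1) = z * ((A 1 0 : ℂ) * z + A 1 1) := fun z => by
    have h2 := coe_toPSL_smul A z
    rw [h z, eq_div_iff (coe_denom_ne_zero A z)] at h2
    exact h2.symm
  -- Fixing the two points i and 2i already forces the matrix to be ±1.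
  have h2 := h1 UpperHalfPlane.I
  have h3 := h1 ⟨2 * Complex.I, by simp⟩
  have h4 : A 0 1 = - A 1 0 := by
    have := congrArg Complex.re h2
    simpa using this
  have h5 : A 0 0 = A 1 1 := by
    have := congrArg Complex.im h2
    simpa using this
  have h6 : A 0 1 = - 4 * A 1 0 := by
    have := congrArg Complex.re h3
    simp at this
    linarith
  have h7 : A 1 0 = 0 := by linarith
  have h8 : A 0 1 = 0 := by linarith
  have h9 := A.det_coe
  rw [Matrix.det_fin_two] at h9
  have h10 : A 1 1 = 1 ∨ A 1 1 = -1 := by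
    have : A 1 1 ^ 2 = 1 := by rw [h8, h5] at h9; linarith
    exact sq_eq_one_iff.1 this
  rcases h10 with h10 | h10
  · have : A = 1 := by
      ext i j
      fin_cases i <;> fin_cases j <;> simp [h7, h8, h5, h10]
    rw [this, toPSL_one]
  · have : A = -1 := by
      ext i j
      fin_cases i <;> fin_cases j <;> simp [h7, h8, h5, h10]
    rw [this, toPSL_neg, toPSL_one]

/-! ### The model group -/

theorem mem_triangle_of_forall_notMem {U V : ℝ} {z : ℍ} (h : ∀ i, z ∉ cap U V i) :
    z ∈ triangle U V := by
  have h2 := h 0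
  have h3 := h 1
  have h4 := h 2
  simp only [mem_cap_zero, mem_cap_one, mem_cap_two, not_le] at h2 h3 h4
  exact ⟨h4.le, h3.le, h2.le⟩

/-- The matrix of `z ↦ m - 1 / z`. -/
def pairing (m : ℝ) : SL(2, ℝ) := ⟨!![m, -1; 1, 0], by simp [Matrix.det_fin_two]⟩

/-- The group generated by `z ↦ U - 1 / z` and `z ↦ -V - 1 / z`. -/
def modelGroup (U V : ℝ) : Subgroup PSL(2, ℝ) :=
  Subgroup.closure {toPSL (pairing U), toPSL (pairing (-V))}

theorem pairing_smul (m : ℝ) (z : ℍ) : toPSL (pairing m) • z = refl m (inversion z) := by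
  apply UpperHalfPlane.ext
  rw [coe_toPSL_smul' (A := pairing m) rfl]
  have h1 := normSq_pos' z
  have h2 : (z : ℂ) ≠ 0 := z.ne_zero
  have h3 : (refl m (inversion z) : ℂ) = (m : ℂ) - 1 / z := by
    rw [one_div]
    apply Complex.ext
    · change m - z.re / (z.re ^ 2 + z.im ^ 2) = _
      simp [Complex.inv_re, Complex.normSq_apply, pow_two]
    · change z.im / (z.re ^ 2 + z.im ^ 2) = _
      simp [Complex.inv_im, Complex.normSq_apply, pow_two, neg_div]
  rw [h3]
  push_cast
  rw [one_mul, add_zero, sub_eq_add_neg, add_div, mul_div_cancel_right₀ _ h2, neg_div]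

section
variable {U V : ℝ}

/-- Each generator is a product of two reflections, so group elements act as words of even length;
with `exists_mem_of_word` they act exactly as those words. -/
theorem exists_word_of_mem {γ : PSL(2, ℝ)} (hγ : γ ∈ modelGroup U V) :
    ∃ L : List (Fin 3), Even L.length ∧ ∀ z : ℍ, γ • z = word U V L z := by
  induction hγ using Subgroup.closure_induction with
  | mem x hx =>
    rcases hx with rfl | rfl
    · exact ⟨[1, 0], by simp, fun z => by simp [pairing_smul]⟩
    · exact ⟨[2, 0], by simp, fun z => by simp [pairing_smul]⟩
  | one => exact ⟨[], by simp, fun z => by simp⟩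
  | mul x y _ _ hx hy =>
    obtain ⟨L, h1, h2⟩ := hx
    obtain ⟨M, h3, h4⟩ := hy
    exact ⟨L ++ M, by simpa using h1.add h3, fun z => by rw [mul_smul, h2, h4, word_append]⟩
  | inv x _ hx =>
    obtain ⟨L, h1, h2⟩ := hx
    exact ⟨L.reverse, by simpa using h1, fun z => by
      rw [inv_smul_eq_iff, h2, word_word_reverse]⟩

theorem exists_mem_of_word {L : List (Fin 3)} (hL : Even L.length) :
    ∃ γ ∈ modelGroup U V, ∀ z : ℍ, γ • z = word U V L z := by
  -- With a = (reflection i) ∘ inversion and b = (reflection j) ∘ inversion, the pair of letters i,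
  -- j acts as a b⁻¹.
  have h1 : ∀ i, ∃ γ ∈ modelGroup U V, ∀ z : ℍ, γ • z = side U V i (inversion z) := by
    intro i
    fin_cases i
    · exact ⟨1, one_mem _, fun z => by simp [inversion_inversion]⟩
    · exact ⟨toPSL (pairing U), Subgroup.subset_closure (by simp), fun z => by
        simp [pairing_smul]⟩
    · exact ⟨toPSL (pairing (-V)), Subgroup.subset_closure (by simp), fun z => by
        simp [pairing_smul]⟩
  have h2 : ∀ n (L : List (Fin 3)), L.length = 2 * n →
      ∃ γ ∈ modelGroup U V, ∀ z : ℍ, γ • z = word U V L z := by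
    intro n
    induction n with
    | zero =>
      intro L hL
      rw [mul_zero, List.length_eq_zero_iff] at hL
      subst hL
      exact ⟨1, one_mem _, fun z => by simp⟩
    | succ n ih =>
      intro L hL
      match L, hL with
      | i :: j :: L, hL =>
        obtain ⟨γ, hγ, h3⟩ := ih L (by simp at hL; omega)
        obtain ⟨a, ha, h4⟩ := h1 i
        obtain ⟨b, hb, h5⟩ := h1 j
        refine ⟨a * b⁻¹ * γ, mul_mem (mul_mem ha (inv_mem hb)) hγ, fun z => ?_⟩
        have h6 : b⁻¹ • γ • z = inversion (side U V j (γ • z)) := by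
          rw [inv_smul_eq_iff, h5, inversion_inversion, side_side]
        rw [mul_smul, mul_smul, h6, h4, inversion_inversion, h3, word_cons, word_cons]
  obtain ⟨n, hn⟩ := hL
  exact h2 n L (by omega)

/-! ### The quotient surface as the double of the triangle -/

theorem proj_eq_proj_iff {z w : ℍ} : proj (modelGroup U V) z = proj (modelGroup U V) w ↔
    ∃ L : List (Fin 3), Even L.length ∧ z = word U V L w := by
  rw [proj, proj, Quotient.eq, MulAction.orbitRel_apply, MulAction.mem_orbit_iff]
  constructor
  · rintro ⟨⟨γ, hγ⟩, rfl⟩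
    obtain ⟨L, h1, h2⟩ := exists_word_of_mem hγ
    exact ⟨L, h1, h2 w⟩
  · rintro ⟨L, h1, rfl⟩
    obtain ⟨γ, hγ, h2⟩ := exists_mem_of_word (U := U) (V := V) h1
    exact ⟨⟨γ, hγ⟩, h2 w⟩

theorem proj_side_side (i j : Fin 3) (z : ℍ) :
    proj (modelGroup U V) (side U V i (side U V j z)) = proj (modelGroup U V) z :=
  proj_eq_proj_iff.2 ⟨[i, j], by simp, rfl⟩

/-- Any two of the reflections differ by a group element, so all three induce the same involution of
the surface, the one exchanging the two copies of the triangle. -/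
theorem proj_side (i j : Fin 3) (z : ℍ) :
    proj (modelGroup U V) (side U V i z) = proj (modelGroup U V) (side U V j z) := by
  rw [← proj_side_side i j (side U V j z), side_side]

theorem proj_word_eq_or (L : List (Fin 3)) (z : ℍ) :
    proj (modelGroup U V) (word U V L z) = proj (modelGroup U V) z ∨
    proj (modelGroup U V) (word U V L z) = proj (modelGroup U V) (inversion z) := by
  rcases Nat.even_or_odd L.length with h | h
  · exact Or.inl (proj_eq_proj_iff.2 ⟨L, h, rfl⟩)
  · refine Or.inr (proj_eq_proj_iff.2 ⟨L ++ [0], ?_, ?_⟩)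
    · simpa using h.add_one
    · simp [word_append, inversion_inversion]

theorem isOpenQuotientMap_proj (Γ : Subgroup PSL(2, ℝ)) : IsOpenQuotientMap (proj Γ) :=
  ⟨Quotient.mk_surjective, continuous_quot_mk, isOpenMap_quotient_mk'_mul⟩

end

section
variable {U V : ℝ} (hU : 2 ≤ U) (hV : 2 ≤ V)
include hU hV

/-- Each point of the surface comes from the triangle or from its mirror image. -/
theorem exists_mem_triangle (p : Surface (modelGroup U V)) : ∃ z ∈ triangle U V,
    p = proj (modelGroup U V) z ∨ p = proj (modelGroup U V) (inversion z) := by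
  obtain ⟨w, rfl⟩ := (isOpenQuotientMap_proj (modelGroup U V)).surjective p
  obtain ⟨L, z, rfl, hz⟩ := exists_word_triangle hU hV w
  exact ⟨z, hz, proj_word_eq_or L z⟩

theorem eq_one_of_smul_mem_triangle {γ : PSL(2, ℝ)} (hγ : γ ∈ modelGroup U V) {z : ℍ}
    (hz : z ∈ triangle U V) (h : γ • z ∈ triangle U V) : γ = 1 := by
  obtain ⟨L, h1, h2⟩ := exists_word_of_mem hγ
  rw [h2] at h
  rcases (word_eq_of_mem_triangle hU hV hz h).2 with h3 | h3
  · exact eq_one_of_forall_smul fun w => by rw [h2, h3.2]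
  · exact absurd h1 h3.1

/-- A fixed point can be moved into the triangle by a word, and conjugation by that word keeps the
parity even. The odd alternative of `word_eq_of_mem_triangle` is thus excluded and the element acts
trivially. -/
theorem stabilizer_modelGroup (z : ℍ) : MulAction.stabilizer (modelGroup U V) z = ⊥ := by
  rw [eq_bot_iff]
  rintro ⟨γ, hγ⟩ h
  have h : γ • z = z := h
  obtain ⟨L, w, rfl, hw⟩ := exists_word_triangle hU hV z
  obtain ⟨M, h1, h2⟩ := exists_word_of_mem hγ
  have h3 : word U V (L.reverse ++ M ++ L) w = w := by
    rw [word_append, word_append, ← h2, h, word_reverse_word]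
  have h4 : Even (L.reverse ++ M ++ L).length := by
    simp only [List.length_append, List.length_reverse]
    rw [add_right_comm]
    exact (Even.add_self _).add h1
  rcases (word_eq_of_mem_triangle hU hV hw (h3.symm ▸ hw)).2 with h5 | h5
  · have h6 : ∀ w, word U V M w = w := fun w => by
      have h7 := h5.2 (word U V L.reverse w)
      rw [word_append, word_append, word_word_reverse] at h7
      have h8 := congrArg (word U V L) h7
      rwa [word_word_reverse, word_word_reverse] at h8
    have h7 : γ = 1 := eq_one_of_forall_smul fun w => by rw [h2, h6]
    subst h7
    exact Subgroup.mem_bot.2 rfl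
  · exact absurd h4 h5.1

/-- The complement of the caps is open, lies in the triangle and contains 2i. Its preimage under the
continuous orbit map of 2i is therefore {1}, which makes the identity isolated. -/
theorem isFuchsian_modelGroup : IsFuchsian (modelGroup U V) := by
  let z : ℍ := ⟨2 * Complex.I, by simp⟩
  have hre : z.re = 0 := by simp [z, UpperHalfPlane.re]
  have him : z.im = 2 := by simp [z, UpperHalfPlane.im]
  let O : Set ℍ := ⋂ i, (cap U V i)ᶜ
  have hO : IsOpen O := isOpen_iInter_of_finite fun i => (isClosed_cap U V i).isOpen_compl
  have hOt : O ⊆ triangle U V := by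
    intro w hw
    exact mem_triangle_of_forall_notMem (Set.mem_iInter.1 hw)
  have hzO : z ∈ O := by
    refine Set.mem_iInter.2 fun i => ?_
    fin_cases i <;> simp [hre, him] <;> linarith
  have h1 : IsOpen ((fun g : modelGroup U V => (g : PSL(2, ℝ)) • z) ⁻¹' O) :=
    hO.preimage ((continuous_smul_point z).comp continuous_subtype_val)
  have h2 : (fun g : modelGroup U V => (g : PSL(2, ℝ)) • z) ⁻¹' O = {1} := by
    ext ⟨g, hg⟩
    constructor
    · intro h
      have := eq_one_of_smul_mem_triangle hU hV hg (hOt hzO) (hOt h)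
      subst this
      rfl
    · intro h
      rw [Set.mem_singleton_iff] at h
      rw [h]
      simpa using hzO
  rw [h2] at h1
  exact discreteTopology_of_isOpen_singleton_one h1

/-! ### Functions equivariant under the reflection group -/

/-- A function on the triangle extends to an equivariant function. -/
theorem exists_equivariant {α : Type*} (h : ℍ → α) {c : α → α} (hc : Function.Involutive c)
    (hfix : ∀ z ∈ triangle U V, (∃ i, side U V i z = z) → c (h z) = h z) :
    ∃ f : ℍ → α, (∀ z ∈ triangle U V, f z = h z) ∧ ∀ i z, f (side U V i z) = c (f z) := by
  choose L r h1 h2 using exists_word_triangle hU hV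
  -- Independence of the chosen word: two words leading to the same point have equal parity unless
  -- the representative lies on a side, and there `hfix` absorbs the extra application of c.
  have key : ∀ (M : List (Fin 3)) (w : ℍ), w ∈ triangle U V →
      c^[(L (word U V M w)).length] (h (r (word U V M w))) = c^[M.length] (h w) := by
    intro M w hw
    have h3 : word U V ((L (word U V M w)).reverse ++ M) w = r (word U V M w) := by
      rw [word_append]
      nth_rw 2 [h1 (word U V M w)]
      rw [word_reverse_word]
    obtain ⟨h4, h5⟩ := word_eq_of_mem_triangle hU hV hw (h3.symm ▸ h2 (word U V M w))
    rw [← h3, h4]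
    have h6 : Even (L (word U V M w)).length ∨ ¬ Even (L (word U V M w)).length := em _
    have h7 : Even M.length ∨ ¬ Even M.length := em _
    simp only [List.length_append, List.length_reverse, Nat.even_add] at h5
    have h8 : ∀ {n}, Even n → c^[n] (h w) = h w := fun hn => by rw [hc.iterate_even hn]; rfl
    have h9 : ∀ {n}, ¬ Even n → c^[n] (h w) = c (h w) := fun hn => by
      rw [hc.iterate_odd (Nat.not_even_iff_odd.1 hn)]
    rcases h6 with h6 | h6 <;> rcases h7 with h7 | h7
    · rw [h8 h6, h8 h7]
    · rw [h8 h6, h9 h7, hfix w hw (by tauto)]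
    · rw [h9 h6, h8 h7, hfix w hw (by tauto)]
    · rw [h9 h6, h9 h7]
  refine ⟨fun z => c^[(L z).length] (h (r z)), fun z hz => key [] z hz, fun i z => ?_⟩
  have h3 := key (i :: L z) (r z) (h2 z)
  rw [word_cons, ← h1 z] at h3
  simp only [h3, List.length_cons, Function.iterate_succ_apply']

end

/-- Shows that near a point of the side i the triangle and its mirror image in that side cover the
cap. Either the reflected point avoids all caps, or z lies on the side and is fixed. -/
theorem side_mem_triangle {U V : ℝ} {i : Fin 3} {z : ℍ} (h : z ∈ cap U V i)
    (h' : ∀ j, j ≠ i → side U V i z ∉ cap U V j) : side U V i z ∈ triangle U V := by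
  by_cases h1 : side U V i z ∈ cap U V i
  · have h0 : side U V i z = z := by
      fin_cases i
      · have h2 := inversion_normSq z
        have h3 := normSq_pos' z
        simp only [Fin.zero_eta, side_zero, mem_cap_zero] at h h1 ⊢
        rw [h2, div_le_one h3] at h1
        have h4 : z.re ^ 2 + z.im ^ 2 = 1 := le_antisymm h h1
        apply UpperHalfPlane.ext_re_im <;> simp [h4]
      · simp only [Fin.mk_one, side_one, mem_cap_one, refl_re] at h h1 ⊢
        exact UpperHalfPlane.ext_re_im (by simp; linarith) rfl
      · simp only [Fin.reduceFinMk, side_two, mem_cap_two, refl_re] at h h1 ⊢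
        exact UpperHalfPlane.ext_re_im (by simp; linarith) rfl
    rw [h0] at h' ⊢
    have h2 := h' 0
    have h3 := h' 1
    have h4 := h' 2
    simp only [mem_cap_zero, mem_cap_one, mem_cap_two, not_le] at h2 h3 h4
    have h5 := mem_cap_of_side_eq_self h0
    fin_cases i
    · refine ⟨(h4 (by decide)).le, (h3 (by decide)).le, ?_⟩
      have h2 := inversion_normSq z
      simp only [Fin.zero_eta, side_zero] at h0
      rw [h0, eq_div_iff (normSq_pos' z).ne'] at h2
      nlinarith [normSq_pos' z]
    · have h6 := congrArg UpperHalfPlane.re h0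
      simp at h6
      exact ⟨(h4 (by decide)).le, by linarith, (h2 (by decide)).le⟩
    · have h6 := congrArg UpperHalfPlane.re h0
      simp at h6
      exact ⟨by linarith, (h3 (by decide)).le, (h2 (by decide)).le⟩
  · refine mem_triangle_of_forall_notMem fun j => ?_
    by_cases hj : j = i
    · rwa [hj]
    · exact h' j hj

section
variable {U V : ℝ} {α : Type*} {f : ℍ → α} {c : α → α}

theorem equivariant_word (hf : ∀ i z, f (side U V i z) = c (f z)) (L : List (Fin 3)) (z : ℍ) :
    f (word U V L z) = c^[L.length] (f z) := by
  induction L with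
  | nil => rfl
  | cons i L ih => rw [word_cons, hf, ih, List.length_cons, Function.iterate_succ_apply']

theorem equivariant_smul (hf : ∀ i z, f (side U V i z) = c (f z)) (hc : Function.Involutive c)
    (z w : ℍ) (h : proj (modelGroup U V) z = proj (modelGroup U V) w) : f z = f w := by
  obtain ⟨L, h1, rfl⟩ := proj_eq_proj_iff.1 h
  rw [equivariant_word hf, hc.iterate_even h1]
  rfl

/-- The sides being disjoint, a neighbourhood of a boundary point is covered by the triangle and a
single reflected copy. On that copy f is c ∘ f ∘ reflection, so continuity within the triangle
suffices; words carry it to all translates. -/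
theorem continuousAt_equivariant [TopologicalSpace α] (hU : 2 ≤ U) (hV : 2 ≤ V)
    (hf : ∀ i z, f (side U V i z) = c (f z)) (hc : Continuous c) {z : ℍ}
    (hz : z ∈ triangle U V) (h : ContinuousWithinAt f (triangle U V) z) (L : List (Fin 3)) :
    ContinuousAt f (word U V L z) := by
  have h0 : ContinuousAt f z := by
    by_cases hzi : ∃ i, z ∈ cap U V i
    · obtain ⟨i, hi⟩ := hzi
      have h1 := side_eq_self hi hz
      have h2 : ContinuousWithinAt f (side U V i ⁻¹' triangle U V) z := by
        have h3 : f = fun w => c (f (side U V i w)) := by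
          funext w
          rw [← hf, side_side]
        rw [h3]
        refine hc.continuousAt.comp_continuousWithinAt ?_
        refine ContinuousWithinAt.comp (t := triangle U V) ?_
          (continuous_side U V i).continuousWithinAt (Set.mapsTo_preimage _ _)
        rwa [h1]
      refine (h.union h2).continuousAt ?_
      have h3 : (⋃ j ∈ {j | j ≠ i}, cap U V j)ᶜ ∈ 𝓝 z := by
        refine IsClosed.compl_mem_nhds ?_ ?_
        · exact (Set.toFinite _).isClosed_biUnion fun j _ => isClosed_cap U V j
        · simp only [Set.mem_iUnion, not_exists]
          exact fun j hj hzj => Set.disjoint_left.1 (disjoint_cap hU hV hj) hzj hi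
      have h4 := (continuous_side U V i).continuousAt.preimage_mem_nhds (h1.symm ▸ h3)
      filter_upwards [h3, h4] with w hw1 hw2
      simp only [Set.mem_preimage, Set.mem_compl_iff, Set.mem_iUnion, not_exists] at hw1 hw2
      by_cases hwi : w ∈ cap U V i
      · exact Or.inr (side_mem_triangle hwi hw2)
      · refine Or.inl (mem_triangle_of_forall_notMem fun j => ?_)
        by_cases hj : j = i
        · rwa [hj]
        · exact hw1 j hj
    · refine h.continuousAt ?_
      have h3 : (⋃ j, cap U V j)ᶜ ∈ 𝓝 z :=
        (isClosed_iUnion_of_finite (isClosed_cap U V)).compl_mem_nhds (by simpa using hzi)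
      filter_upwards [h3] with w hw
      exact mem_triangle_of_forall_notMem (by simpa using hw)
  have h1 : f = fun w => c^[L.length] (f (word U V L.reverse w)) := by
    funext w
    rw [← equivariant_word hf, word_word_reverse]
  rw [h1]
  refine (hc.iterate _).continuousAt.comp ?_
  refine ContinuousAt.comp ?_ (continuous_word U V L.reverse).continuousAt
  rwa [word_reverse_word]

end

/-! ### Descending equivariant functions to the surface -/

section
variable {U V : ℝ} (hU : 2 ≤ U) (hV : 2 ≤ V)
include hU hV

/-- Here c prescribes the effect of exchanging the two copies of the triangle. It is the identity
for the Klein coordinates and complex conjugation for the coordinate on the punctured sphere. -/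
theorem exists_surface_function {α : Type*} [TopologicalSpace α] (h : ℍ → α) {c : α → α}
    (hc : Function.Involutive c) (hc' : Continuous c)
    (hfix : ∀ z ∈ triangle U V, (∃ i, side U V i z = z) → c (h z) = h z) :
    ∃ f : Surface (modelGroup U V) → α,
      (∀ z ∈ triangle U V, f (proj _ z) = h z) ∧
      (∀ i z, f (proj _ (side U V i z)) = c (f (proj _ z))) ∧
      ∀ z ∈ triangle U V, ContinuousWithinAt h (triangle U V) z →
        ContinuousAt f (proj _ z) ∧ ContinuousAt f (proj _ (inversion z)) := by
  obtain ⟨f, h1, h2⟩ := exists_equivariant hU hV h hc hfix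
  refine ⟨Quotient.lift f fun z w hzw => equivariant_smul h2 hc z w (Quotient.sound hzw), h1,
    h2, fun z hz hcont => ?_⟩
  have h3 : ContinuousWithinAt f (triangle U V) z :=
    hcont.congr (fun w hw => h1 w hw) (h1 z hz)
  rw [← (isOpenQuotientMap_proj (modelGroup U V)).continuousAt_comp_iff,
    ← (isOpenQuotientMap_proj (modelGroup U V)).continuousAt_comp_iff]
  exact ⟨continuousAt_equivariant hU hV h2 hc' hz h3 [],
    continuousAt_equivariant hU hV h2 hc' hz h3 [0]⟩

theorem exists_invariant_function {α : Type*} [TopologicalSpace α] {h : ℍ → α}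
    (hh : Continuous h) : ∃ f : Surface (modelGroup U V) → α, Continuous f ∧
      (∀ z ∈ triangle U V, f (proj _ z) = h z) ∧
      ∀ i z, f (proj _ (side U V i z)) = f (proj _ z) := by
  obtain ⟨f, h1, h2, h3⟩ := exists_surface_function hU hV h (c := id) (fun _ => rfl) continuous_id
    fun _ _ _ => rfl
  refine ⟨f, continuous_iff_continuousAt.2 fun p => ?_, h1, h2⟩
  obtain ⟨z, hz, rfl | rfl⟩ := exists_mem_triangle hU hV p
  · exact (h3 z hz hh.continuousWithinAt).1
  · exact (h3 z hz hh.continuousWithinAt).2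

end

/-! ### Klein coordinates -/

/-- The first Klein coordinate `Re z / (1 + |z|²)`. -/
noncomputable def kleinX (z : ℍ) : ℝ := z.re / (1 + z.re ^ 2 + z.im ^ 2)

/-- The second Klein coordinate `1 / (1 + |z|²)`. -/
noncomputable def kleinY (z : ℍ) : ℝ := 1 / (1 + z.re ^ 2 + z.im ^ 2)

/-- The point with given Klein coordinates. -/
noncomputable def ofKlein (a b : ℝ) : ℍ :=
  ofComplex ((a / b : ℝ) + (√(1 / b - 1 - (a / b) ^ 2) : ℝ) * Complex.I)

theorem klein_denom_pos (z : ℍ) : 0 < 1 + z.re ^ 2 + z.im ^ 2 := by positivity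

theorem kleinY_pos (z : ℍ) : 0 < kleinY z := one_div_pos.2 (klein_denom_pos z)

theorem continuous_kleinX : Continuous kleinX := by
  have h1 := UpperHalfPlane.continuous_re
  have h2 := UpperHalfPlane.continuous_im
  exact h1.div (by fun_prop) fun z => (klein_denom_pos z).ne'

theorem continuous_kleinY : Continuous kleinY := by
  have h1 := UpperHalfPlane.continuous_re
  have h2 := UpperHalfPlane.continuous_im
  exact continuous_const.div (by fun_prop) fun z => (klein_denom_pos z).ne'

theorem kleinX_div_kleinY (z : ℍ) : kleinX z / kleinY z = z.re := by
  have := klein_denom_pos z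
  rw [kleinX, kleinY]; field_simp

theorem kleinX_eq (z : ℍ) : kleinX z = z.re * kleinY z := by
  rw [kleinX, kleinY]; ring

/-- The image is the open disc of centre (0, 1/2) and radius 1/2; the defect in the inequality is (Y
· Im z)². -/
theorem klein_lt (z : ℍ) : kleinX z ^ 2 + kleinY z ^ 2 < kleinY z := by
  have h := klein_denom_pos z
  have h1 : kleinY z - (kleinX z ^ 2 + kleinY z ^ 2) = z.im ^ 2 * kleinY z ^ 2 := by
    rw [kleinX, kleinY]; field_simp; ring
  have h2 := kleinY_pos z
  have h3 := z.im_pos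
  have : 0 < z.im ^ 2 * kleinY z ^ 2 := by positivity
  linarith

section
variable {a b : ℝ} (h : a ^ 2 + b ^ 2 < b)
include h

theorem pos_of_klein : 0 < b := by nlinarith [sq_nonneg a, sq_nonneg b]

theorem klein_radicand_pos : 0 < 1 / b - 1 - (a / b) ^ 2 := by
  have hb := pos_of_klein h
  have : 1 / b - 1 - (a / b) ^ 2 = (b - (a ^ 2 + b ^ 2)) / b ^ 2 := by field_simp; ring
  rw [this]
  exact div_pos (by linarith) (by positivity)

/-- Inside the disc the argument of `ofComplex` is a genuine point of the upper half plane, so no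
default value intervenes. -/
theorem klein_im_pos :
    0 < (((a / b : ℝ) : ℂ) + (√(1 / b - 1 - (a / b) ^ 2) : ℝ) * Complex.I).im := by
  simpa using Real.sqrt_pos.2 (klein_radicand_pos h)

theorem ofKlein_re : (ofKlein a b).re = a / b := by
  rw [ofKlein, ofComplex_apply_of_im_pos (klein_im_pos h), UpperHalfPlane.mk_re]
  simp

theorem ofKlein_im : (ofKlein a b).im = √(1 / b - 1 - (a / b) ^ 2) := by
  rw [ofKlein, ofComplex_apply_of_im_pos (klein_im_pos h), UpperHalfPlane.mk_im]
  simp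

theorem ofKlein_denom : 1 + (ofKlein a b).re ^ 2 + (ofKlein a b).im ^ 2 = 1 / b := by
  rw [ofKlein_re h, ofKlein_im h, Real.sq_sqrt (klein_radicand_pos h).le]
  ring

theorem kleinX_ofKlein : kleinX (ofKlein a b) = a := by
  have hb := pos_of_klein h
  rw [kleinX, ofKlein_denom h, ofKlein_re h]; field_simp

theorem kleinY_ofKlein : kleinY (ofKlein a b) = b := by
  rw [kleinY, ofKlein_denom h, one_div_one_div]

theorem continuousAt_ofKlein : ContinuousAt (fun p : ℝ × ℝ => ofKlein p.1 p.2) (a, b) := by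
  have hb := pos_of_klein h
  refine ContinuousAt.comp (g := ofComplex) ?_ ?_
  · exact ofComplex.continuousAt (by
      have := klein_radicand_pos h
      simp only [one_div] at this
      simp [ofComplex]; linarith)
  · have h1 : ContinuousAt (fun p : ℝ × ℝ => p.1 / p.2) (a, b) :=
      continuousAt_fst.div continuousAt_snd hb.ne'
    have h2 : ContinuousAt (fun p : ℝ × ℝ => 1 / p.2) (a, b) :=
      continuousAt_const.div continuousAt_snd hb.ne'
    have h3 : ContinuousAt (fun p : ℝ × ℝ => √(1 / p.2 - 1 - (p.1 / p.2) ^ 2)) (a, b) :=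
      Real.continuous_sqrt.continuousAt.comp ((h2.sub continuousAt_const).sub (h1.pow 2))
    exact (Complex.continuous_ofReal.continuousAt.comp h1).add
      ((Complex.continuous_ofReal.continuousAt.comp h3).mul continuousAt_const)

/-- The three sides are chords of the disc, so membership becomes three linear inequalities. -/
theorem ofKlein_mem_triangle {U V : ℝ} (h1 : 2 * a ≤ U * b) (h2 : -(2 * a) ≤ V * b)
    (h3 : b ≤ 1 / 2) : ofKlein a b ∈ triangle U V := by
  have hb := pos_of_klein h
  have h4 := ofKlein_denom h
  have h5 : 2 ≤ 1 / b := by rw [le_div_iff₀ hb]; linarith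
  refine ⟨?_, ?_, by linarith⟩
  · rw [ofKlein_re h, le_div_iff₀ hb]; linarith
  · rw [ofKlein_re h, div_le_iff₀ hb]; linarith

end

theorem eq_of_klein_eq {z w : ℍ} (hx : kleinX z = kleinX w) (hy : kleinY z = kleinY w) :
    z = w := by
  have h1 : z.re = w.re := by rw [← kleinX_div_kleinY, hx, hy, kleinX_div_kleinY]
  refine UpperHalfPlane.ext_re_im h1 ?_
  rw [kleinY, kleinY, h1] at hy
  have h2 := one_div_one_div (1 + w.re ^ 2 + z.im ^ 2)
  rw [hy, one_div_one_div] at h2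
  have h3 : z.im ^ 2 = w.im ^ 2 := by linarith
  exact (pow_left_inj₀ z.im_pos.le w.im_pos.le two_ne_zero).1 h3

theorem ofKlein_klein (z : ℍ) : ofKlein (kleinX z) (kleinY z) = z :=
  eq_of_klein_eq (kleinX_ofKlein (klein_lt z)) (kleinY_ofKlein (klein_lt z))

section
variable {U V : ℝ} {z : ℍ} (hz : z ∈ triangle U V)
include hz

theorem kleinY_le : kleinY z ≤ 1 / 2 :=
  one_div_le_one_div_of_le two_pos (by linarith [hz.2.2])

theorem two_kleinX_le : 2 * kleinX z ≤ U * kleinY z := by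
  have := kleinY_pos z
  rw [kleinX_eq]
  nlinarith [hz.2.1]

theorem neg_two_kleinX_le : -(2 * kleinX z) ≤ V * kleinY z := by
  have := kleinY_pos z
  rw [kleinX_eq]
  nlinarith [hz.1]

end

theorem abs_kleinX_lt (z : ℍ) : |kleinX z| < 1 / 2 := by
  have := klein_lt z
  rw [abs_lt]
  constructor <;> nlinarith [sq_nonneg (kleinY z - 1 / 2)]

/-- A region of Klein coordinates contained in the hyperbolic plane. -/
theorem klein_lt_of_mem {U V a b : ℝ} (hU : 2 ≤ U) (hV : 2 ≤ V) (ha : -1 < V * a) (ha' : U * a < 1)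
    (h1 : 2 * a ≤ U * b) (h2 : -(2 * a) ≤ V * b) (h3 : b ≤ 1 / 2) (h4 : 0 < b) :
    a ^ 2 + b ^ 2 < b := by
  -- For a ≠ 0 the truncation and the side condition together give a² < b/2, while b ≤ 1/2 gives b²
  -- ≤ b/2.
  rcases lt_trichotomy a 0 with h | rfl | h
  · have : V * a ^ 2 < V * (b / 2) := by nlinarith
    have := lt_of_mul_lt_mul_left this (by linarith)
    nlinarith
  · nlinarith
  · have : U * a ^ 2 < U * (b / 2) := by nlinarith
    have := lt_of_mul_lt_mul_left this (by linarith)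
    nlinarith

/-! ### Klein coordinates on the surface -/

section
variable {U V : ℝ} (hU : 2 ≤ U) (hV : 2 ≤ V)

/-- The function on the surface induced by the first Klein coordinate on the triangle. -/
noncomputable def surfaceX : Surface (modelGroup U V) → ℝ :=
  (exists_invariant_function hU hV continuous_kleinX).choose

/-- The function on the surface induced by the second Klein coordinate on the triangle. -/
noncomputable def surfaceY : Surface (modelGroup U V) → ℝ :=
  (exists_invariant_function hU hV continuous_kleinY).choose

theorem continuous_surfaceX : Continuous (surfaceX hU hV) :=
  (exists_invariant_function hU hV continuous_kleinX).choose_spec.1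

theorem surfaceX_proj {z : ℍ} (hz : z ∈ triangle U V) : surfaceX hU hV (proj _ z) = kleinX z :=
  (exists_invariant_function hU hV continuous_kleinX).choose_spec.2.1 z hz

theorem surfaceX_side (i : Fin 3) (z : ℍ) :
    surfaceX hU hV (proj _ (side U V i z)) = surfaceX hU hV (proj _ z) :=
  (exists_invariant_function hU hV continuous_kleinX).choose_spec.2.2 i z

theorem surfaceY_proj {z : ℍ} (hz : z ∈ triangle U V) : surfaceY hU hV (proj _ z) = kleinY z :=
  (exists_invariant_function hU hV continuous_kleinY).choose_spec.2.1 z hz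

theorem surfaceY_side (i : Fin 3) (z : ℍ) :
    surfaceY hU hV (proj _ (side U V i z)) = surfaceY hU hV (proj _ z) :=
  (exists_invariant_function hU hV continuous_kleinY).choose_spec.2.2 i z

theorem surfaceX_inversion {z : ℍ} (hz : z ∈ triangle U V) :
    surfaceX hU hV (proj _ (inversion z)) = kleinX z := by
  rw [← surfaceX_proj hU hV hz, ← surfaceX_side hU hV 0 z, side_zero]

theorem surfaceY_inversion {z : ℍ} (hz : z ∈ triangle U V) :
    surfaceY hU hV (proj _ (inversion z)) = kleinY z := by
  rw [← surfaceY_proj hU hV hz, ← surfaceY_side hU hV 0 z, side_zero]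

/-- Each point of the surface is one of the two images of the point of the triangle with the same
Klein coordinates. -/
theorem exists_klein (p : Surface (modelGroup U V)) : ∃ z ∈ triangle U V,
    (p = proj _ z ∨ p = proj _ (inversion z)) ∧ surfaceX hU hV p = kleinX z ∧
      surfaceY hU hV p = kleinY z := by
  obtain ⟨z, hz, h⟩ := exists_mem_triangle hU hV p
  refine ⟨z, hz, h, ?_⟩
  rcases h with rfl | rfl
  · exact ⟨surfaceX_proj hU hV hz, surfaceY_proj hU hV hz⟩
  · exact ⟨surfaceX_inversion hU hV hz, surfaceY_inversion hU hV hz⟩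

/-- Through every point passes a local continuous section of X, drawn in Klein coordinates inside
the triangle and, if needed, moved to the other sheet. Openness lets interior and closure of the
Y-piece be computed on intervals. -/
theorem isOpenMap_surfaceX : IsOpenMap (surfaceX hU hV) := by
  refine IsOpenMap.of_nhds_le fun p => ?_
  obtain ⟨z, hz, hp, hpX, -⟩ := exists_klein hU hV p
  have hlt := klein_lt z
  -- The vertical sides have slopes 2/U and -2/V, of absolute value at most 1, so rising with slope
  -- 1 stays above them; the minimum keeps the path on or below the chord Y = 1/2.
  let τ : ℝ → ℝ := fun s => min (1 / 2) (kleinY z + |s - kleinX z|)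
  have hτ : Continuous τ := by fun_prop
  have hτ0 : τ (kleinX z) = kleinY z := by
    simpa [τ] using kleinY_le hz
  have hσ0 : ofKlein (kleinX z) (τ (kleinX z)) = z := by rw [hτ0, ofKlein_klein]
  have hσ : ContinuousAt (fun s => ofKlein s (τ s)) (kleinX z) := by
    have h1 : ContinuousAt (fun p : ℝ × ℝ => ofKlein p.1 p.2) (kleinX z, τ (kleinX z)) := by
      rw [hτ0]; exact continuousAt_ofKlein hlt
    exact h1.comp (f := fun s => (s, τ s)) (by fun_prop)
  have hdisc : ∀ᶠ s in 𝓝 (kleinX z), s ^ 2 + τ s ^ 2 < τ s := by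
    refine ContinuousAt.eventually_lt (by fun_prop) hτ.continuousAt ?_
    rw [hτ0]; exact hlt
  have habs : ∀ᶠ s in 𝓝 (kleinX z), |s| < 1 / 2 :=
    (continuous_abs.continuousAt).eventually_lt continuousAt_const (abs_kleinX_lt z)
  have htri : ∀ᶠ s in 𝓝 (kleinX z), ofKlein s (τ s) ∈ triangle U V ∧
      kleinX (ofKlein s (τ s)) = s := by
    filter_upwards [hdisc, habs] with s h1 h2
    rw [abs_lt] at h2
    refine ⟨ofKlein_mem_triangle h1 ?_ ?_ (min_le_left _ _), kleinX_ofKlein h1⟩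
    · have h3 := two_kleinX_le hz
      rcases min_choice (1 / 2) (kleinY z + |s - kleinX z|) with h4 | h4
      · simp only [τ, h4]; linarith
      · simp only [τ, h4]
        nlinarith [le_abs_self (s - kleinX z), abs_nonneg (s - kleinX z)]
    · have h3 := neg_two_kleinX_le hz
      rcases min_choice (1 / 2) (kleinY z + |s - kleinX z|) with h4 | h4
      · simp only [τ, h4]; linarith
      · simp only [τ, h4]
        nlinarith [neg_abs_le (s - kleinX z), abs_nonneg (s - kleinX z)]
  have key : ∀ g : ℝ → Surface (modelGroup U V), ContinuousAt g (kleinX z) → g (kleinX z) = p →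
      (∀ᶠ s in 𝓝 (kleinX z), surfaceX hU hV (g s) = s) →
      𝓝 (surfaceX hU hV p) ≤ map (surfaceX hU hV) (𝓝 p) := by
    intro g hg hg0 hgs
    have h1 : Tendsto g (𝓝 (kleinX z)) (𝓝 p) := hg0 ▸ hg
    calc 𝓝 (surfaceX hU hV p) = map id (𝓝 (kleinX z)) := by rw [hpX, map_id]
      _ = map (surfaceX hU hV ∘ g) (𝓝 (kleinX z)) := (map_congr hgs).symm
      _ = map (surfaceX hU hV) (map g (𝓝 (kleinX z))) := Filter.map_map.symm
      _ ≤ _ := map_mono h1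
  have hproj := (isOpenQuotientMap_proj (modelGroup U V)).continuous
  rcases hp with hp | hp
  · refine key (fun s => proj _ (ofKlein s (τ s))) (hproj.continuousAt.comp hσ)
      (by rw [hp, hσ0]) ?_
    filter_upwards [htri] with s hs
    rw [surfaceX_proj hU hV hs.1, hs.2]
  · refine key (fun s => proj _ (inversion (ofKlein s (τ s))))
      ((hproj.comp continuous_inversion).continuousAt.comp hσ) (by rw [hp, hσ0]) ?_
    filter_upwards [htri] with s hs
    rw [surfaceX_inversion hU hV hs.1, hs.2]

end

/-! ### The coordinate on the thrice punctured sphere -/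

/-- The smallest second Klein coordinate of the points of `triangle U V` with given first one. -/
noncomputable def lowKlein (U V a : ℝ) : ℝ := max (2 * a / U) (-(2 * a) / V)

/-- The position of `b` in the interval `[lowKlein U V a, 1 / 2]`, rescaled to `[-1, 1]`. -/
noncomputable def heightCos (U V a b : ℝ) : ℝ :=
  1 - 2 * ((b - lowKlein U V a) / (1 / 2 - lowKlein U V a))

/-- The map `(-1 / V, 1 / U) → (0, ∞)` giving the modulus of the coordinate. -/
noncomputable def modulus (U V a : ℝ) : ℝ := (1 + V * a) / (1 - U * a)

/-- The homeomorphism of the truncated triangle with the closed upper half plane without `0, 1`. -/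
noncomputable def halfCoord (U V : ℝ) (z : ℍ) : ℂ :=
  modulus U V (kleinX z) * (heightCos U V (kleinX z) (kleinY z) +
    √(1 - heightCos U V (kleinX z) (kleinY z) ^ 2) * Complex.I)

/-- The inverse of `halfCoord`, depending only on the real part and the modulus. -/
noncomputable def ofHalfCoord (U V : ℝ) (w : ℂ) : ℍ :=
  ofKlein ((‖w‖ - 1) / (V + U * ‖w‖))
    (lowKlein U V ((‖w‖ - 1) / (V + U * ‖w‖)) +
      (1 - w.re / ‖w‖) / 2 * (1 / 2 - lowKlein U V ((‖w‖ - 1) / (V + U * ‖w‖))))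

theorem halfCoord_re (U V : ℝ) (z : ℍ) : (halfCoord U V z).re =
    modulus U V (kleinX z) * heightCos U V (kleinX z) (kleinY z) := by
  simp [halfCoord]

theorem halfCoord_im (U V : ℝ) (z : ℍ) : (halfCoord U V z).im =
    modulus U V (kleinX z) * √(1 - heightCos U V (kleinX z) (kleinY z) ^ 2) := by
  simp [halfCoord]

section
variable {U V : ℝ} (hU : 2 ≤ U) (hV : 2 ≤ V)
include hU hV

theorem two_mul_le_low (a : ℝ) : 2 * a ≤ U * lowKlein U V a := by
  have h := le_max_left (2 * a / U) (-(2 * a) / V)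
  rwa [div_le_iff₀' (by linarith)] at h

theorem neg_two_mul_le_low (a : ℝ) : -(2 * a) ≤ V * lowKlein U V a := by
  have h := le_max_right (2 * a / U) (-(2 * a) / V)
  rwa [div_le_iff₀' (by linarith)] at h

theorem low_le {a b : ℝ} (h1 : 2 * a ≤ U * b) (h2 : -(2 * a) ≤ V * b) : lowKlein U V a ≤ b := by
  refine max_le ?_ ?_
  · rwa [div_le_iff₀' (by linarith)]
  · rwa [div_le_iff₀' (by linarith)]

theorem low_nonneg (a : ℝ) : 0 ≤ lowKlein U V a := by
  rcases le_total 0 a with h | h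
  · exact le_trans (by positivity) (le_max_left _ _)
  · exact le_trans (div_nonneg (by linarith) (by linarith)) (le_max_right _ _)

theorem low_pos {a : ℝ} (ha : a ≠ 0) : 0 < lowKlein U V a := by
  rcases lt_or_gt_of_ne ha with h | h
  · exact lt_of_lt_of_le (div_pos (by linarith) (by linarith)) (le_max_right _ _)
  · exact lt_of_lt_of_le (div_pos (by linarith) (by linarith)) (le_max_left _ _)

theorem low_lt {a : ℝ} (ha : -1 < V * a) (ha' : U * a < 1) : lowKlein U V a < 1 / 2 := by
  refine max_lt ?_ ?_
  · rw [div_lt_iff₀ (by linarith)]; nlinarith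
  · rw [div_lt_iff₀ (by linarith)]; nlinarith

theorem heightCos_mem {a b : ℝ} (ha : -1 < V * a) (ha' : U * a < 1) (h1 : 2 * a ≤ U * b)
    (h2 : -(2 * a) ≤ V * b) (h3 : b ≤ 1 / 2) :
    -1 ≤ heightCos U V a b ∧ heightCos U V a b ≤ 1 := by
  have h4 := low_lt hU hV ha ha'
  have h5 := low_le hU hV h1 h2
  have h6 : 0 ≤ (b - lowKlein U V a) / (1 / 2 - lowKlein U V a) :=
    div_nonneg (by linarith) (by linarith)
  have h7 : (b - lowKlein U V a) / (1 / 2 - lowKlein U V a) ≤ 1 := by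
    rw [div_le_one (by linarith)]; linarith
  rw [heightCos]
  constructor <;> linarith

theorem modulus_pos {a : ℝ} (ha : -1 < V * a) (ha' : U * a < 1) : 0 < modulus U V a :=
  div_pos (by linarith) (by linarith)

/-- Solving r = (1 + Va)/(1 - Ua) for a gives a = (r - 1)/(V + Ur), a Möbius bijection between (0,
∞) and (-1/V, 1/U). -/
theorem modulus_sub_one_div {a : ℝ} (ha' : U * a < 1) :
    (modulus U V a - 1) / (V + U * modulus U V a) = a := by
  have h1 : 1 - U * a ≠ 0 := by linarith
  have h2 : V + U * modulus U V a = (U + V) / (1 - U * a) := by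
    rw [modulus, eq_div_iff h1, add_mul, mul_assoc, div_mul_cancel₀ _ h1]; ring
  have h3 : modulus U V a - 1 = a * (U + V) / (1 - U * a) := by
    rw [modulus, eq_div_iff h1, sub_mul, div_mul_cancel₀ _ h1]; ring
  have h4 : U + V ≠ 0 := by linarith
  rw [h2, h3, div_div_div_cancel_right₀ h1, mul_div_cancel_right₀ _ h4]

theorem radius_bounds {r : ℝ} (hr : 0 < r) :
    -1 < V * ((r - 1) / (V + U * r)) ∧ U * ((r - 1) / (V + U * r)) < 1 := by
  have h1 : 0 < V + U * r := by positivity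
  constructor
  · rw [← mul_div_assoc, lt_div_iff₀ h1]; nlinarith
  · rw [← mul_div_assoc, div_lt_iff₀ h1]; nlinarith

theorem modulus_radius {r : ℝ} (hr : 0 < r) : modulus U V ((r - 1) / (V + U * r)) = r := by
  have h1 : 0 < V + U * r := by positivity
  have h2 : 1 + V * ((r - 1) / (V + U * r)) = r * (U + V) / (V + U * r) := by field_simp; ring
  have h3 : 1 - U * ((r - 1) / (V + U * r)) = (U + V) / (V + U * r) := by field_simp; ring
  have h4 : U + V ≠ 0 := by linarith
  rw [modulus, h2, h3]
  field_simp

/-- A point of the triangle fixed by a reflection has real coordinate. -/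
theorem halfCoord_im_of_fixed {z : ℍ} (hz : z ∈ triangle U V) {i : Fin 3}
    (hi : side U V i z = z) : (halfCoord U V z).im = 0 := by
  have h1 := mem_cap_of_side_eq_self hi
  have h2 := kleinY_pos z
  have h3 := two_kleinX_le hz
  have h4 := neg_two_kleinX_le hz
  have h5 := low_le hU hV h3 h4
  have h6 : kleinY z = 1 / 2 ∨ kleinY z = lowKlein U V (kleinX z) := by
    fin_cases i
    · left
      have h7 : z.re ^ 2 + z.im ^ 2 = 1 := le_antisymm h1 hz.2.2
      rw [kleinY, add_assoc, h7]; norm_num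
    · right
      refine le_antisymm (le_trans ?_ (le_max_left _ _)) h5
      have h7 : U / 2 ≤ z.re := h1
      rw [le_div_iff₀ (by linarith), kleinX_eq]
      nlinarith
    · right
      refine le_antisymm (le_trans ?_ (le_max_right _ _)) h5
      have h7 : z.re ≤ -(V / 2) := h1
      rw [le_div_iff₀ (by linarith), kleinX_eq]
      nlinarith
  have h7 : 1 - heightCos U V (kleinX z) (kleinY z) ^ 2 = 0 := by
    rw [heightCos]
    rcases h6 with h6 | h6
    -- No truncation is assumed, so the denominator may vanish; division by zero then makes
    -- `heightCos` equal to 1, which still gives a real value.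
    · rcases eq_or_ne (1 / 2 - lowKlein U V (kleinX z)) 0 with h8 | h8
      · rw [h8]; simp
      · rw [h6, div_self h8]; norm_num
    · rw [← h6]; simp
  rw [halfCoord_im, h7]
  simp

/-- A point of the triangle with real coordinate lies on one of the sides. -/
theorem exists_fixed_of_im_eq_zero {z : ℍ} (hz : z ∈ triangle U V) (ha : -1 < V * kleinX z)
    (ha' : U * kleinX z < 1) (h : (halfCoord U V z).im = 0) : ∃ i, side U V i z = z := by
  have h1 := two_kleinX_le hz
  have h2 := neg_two_kleinX_le hz
  have h0 := kleinY_pos z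
  obtain ⟨h3, h4⟩ := heightCos_mem hU hV ha ha' h1 h2 (kleinY_le hz)
  rw [halfCoord_im, mul_eq_zero, or_iff_right (modulus_pos hU hV ha ha').ne',
    Real.sqrt_eq_zero (by nlinarith)] at h
  have h5 := low_lt hU hV ha ha'
  have h6 : (heightCos U V (kleinX z) (kleinY z) - 1) *
    (heightCos U V (kleinX z) (kleinY z) + 1) = 0 := by linarith
  have h8 : 1 / 2 - lowKlein U V (kleinX z) ≠ 0 := by linarith
  rcases mul_eq_zero.1 h6 with h7 | h7
  · have h9 : (kleinY z - lowKlein U V (kleinX z)) / (1 / 2 - lowKlein U V (kleinX z)) = 0 := by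
      rw [heightCos] at h7; linarith
    rw [div_eq_zero_iff, or_iff_left h8, sub_eq_zero, lowKlein] at h9
    rcases max_choice (2 * kleinX z / U) (-(2 * kleinX z) / V) with h10 | h10
    · refine ⟨1, side_eq_self ?_ hz⟩
      rw [h10, eq_div_iff (by linarith), kleinX_eq] at h9
      rw [mem_cap_one]
      have : kleinY z * (U / 2) = kleinY z * z.re := by linarith
      exact (mul_left_cancel₀ h0.ne' this).le
    · refine ⟨2, side_eq_self ?_ hz⟩
      rw [h10, eq_div_iff (by linarith), kleinX_eq] at h9
      rw [mem_cap_two]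
      have : kleinY z * z.re = kleinY z * -(V / 2) := by linarith
      exact (mul_left_cancel₀ h0.ne' this).le
  · have h9 : (kleinY z - lowKlein U V (kleinX z)) / (1 / 2 - lowKlein U V (kleinX z)) = 1 := by
      rw [heightCos] at h7; linarith
    rw [div_eq_one_iff_eq h8, sub_left_inj, kleinY, div_eq_div_iff (klein_denom_pos z).ne'
      two_ne_zero] at h9
    exact ⟨0, side_eq_self (by rw [mem_cap_zero]; linarith) hz⟩

theorem norm_halfCoord {z : ℍ} (hz : z ∈ triangle U V) (ha : -1 < V * kleinX z)
    (ha' : U * kleinX z < 1) : ‖halfCoord U V z‖ = modulus U V (kleinX z) := by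
  obtain ⟨h3, h4⟩ := heightCos_mem hU hV ha ha' (two_kleinX_le hz) (neg_two_kleinX_le hz)
    (kleinY_le hz)
  have h5 := modulus_pos hU hV ha ha'
  refine (pow_left_inj₀ (norm_nonneg _) h5.le two_ne_zero).1 ?_
  rw [Complex.sq_norm, Complex.normSq_apply, halfCoord_re, halfCoord_im]
  have h6 := Real.mul_self_sqrt (x := 1 - heightCos U V (kleinX z) (kleinY z) ^ 2) (by nlinarith)
  linear_combination modulus U V (kleinX z) ^ 2 * h6

theorem halfCoord_im_nonneg {z : ℍ} (ha : -1 < V * kleinX z)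
    (ha' : U * kleinX z < 1) : 0 ≤ (halfCoord U V z).im := by
  rw [halfCoord_im]
  exact mul_nonneg (modulus_pos hU hV ha ha').le (Real.sqrt_nonneg _)

theorem ofHalfCoord_halfCoord {z : ℍ} (hz : z ∈ triangle U V) (ha : -1 < V * kleinX z)
    (ha' : U * kleinX z < 1) : ofHalfCoord U V (halfCoord U V z) = z := by
  have h5 := modulus_pos hU hV ha ha'
  have h6 := low_lt hU hV ha ha'
  rw [ofHalfCoord, norm_halfCoord hU hV hz ha ha', modulus_sub_one_div hU hV ha', halfCoord_re,
    mul_div_cancel_left₀ _ h5.ne']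
  have h8 : 1 / 2 - lowKlein U V (kleinX z) ≠ 0 := by linarith
  have h9 : lowKlein U V (kleinX z) + (1 - heightCos U V (kleinX z) (kleinY z)) / 2 *
      (1 / 2 - lowKlein U V (kleinX z)) = kleinY z := by
    rw [heightCos, sub_sub_cancel, mul_div_cancel_left₀ _ two_ne_zero, div_mul_cancel₀ _ h8]
    ring
  rw [h9, ofKlein_klein]

/-- The value 1 would require X = 0 and then Y = 0, which is the ideal vertex at infinity and not a
point of ℍ. -/
theorem halfCoord_ne_one {z : ℍ} (hz : z ∈ triangle U V) (ha : -1 < V * kleinX z)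
    (ha' : U * kleinX z < 1) : halfCoord U V z ≠ 1 := by
  intro h
  have h1 := ofHalfCoord_halfCoord hU hV hz ha ha'
  have h2 := norm_halfCoord hU hV hz ha ha'
  rw [h, norm_one] at h2
  have h3 := modulus_sub_one_div hU hV ha'
  rw [← h2, sub_self, zero_div] at h3
  have h4 := halfCoord_re U V z
  rw [h, ← h2, ← h3, one_mul, Complex.one_re, heightCos, lowKlein] at h4
  simp at h4
  linarith [kleinY_pos z]

section
variable {w : ℂ} (hw : w ≠ 0) (hw1 : w ≠ 1)
include hw

theorem re_div_norm_mem : -1 ≤ w.re / ‖w‖ ∧ w.re / ‖w‖ ≤ 1 := by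
  have h := norm_pos_iff.2 hw
  have h1 := abs_le.1 (Complex.abs_re_le_norm w)
  constructor
  · rw [le_div_iff₀ h]; linarith
  · rw [div_le_one h]; linarith

include hw1

/-- By `klein_lt_of_mem` the only danger is b = 0. This needs a = 0 and argument zero, that is w =
1. -/
theorem ofHalfCoord_klein :
    let a := (‖w‖ - 1) / (V + U * ‖w‖)
    let b := lowKlein U V a + (1 - w.re / ‖w‖) / 2 * (1 / 2 - lowKlein U V a)
    2 * a ≤ U * b ∧ -(2 * a) ≤ V * b ∧ b ≤ 1 / 2 ∧ a ^ 2 + b ^ 2 < b := by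
  intro a b
  have hr := norm_pos_iff.2 hw
  obtain ⟨ha, ha'⟩ := radius_bounds hU hV hr
  obtain ⟨hk, hk'⟩ := re_div_norm_mem hU hV hw
  have h1 : lowKlein U V a < 1 / 2 := low_lt hU hV ha ha'
  have hb : b = lowKlein U V a + (1 - w.re / ‖w‖) / 2 * (1 / 2 - lowKlein U V a) := rfl
  have h2 : lowKlein U V a ≤ b := by
    have : 0 ≤ (1 - w.re / ‖w‖) / 2 * (1 / 2 - lowKlein U V a) :=
      mul_nonneg (by linarith) (by linarith)
    linarith
  have h3 : b ≤ 1 / 2 := by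
    have : (1 - w.re / ‖w‖) / 2 * (1 / 2 - lowKlein U V a) ≤ 1 * (1 / 2 - lowKlein U V a) :=
      mul_le_mul_of_nonneg_right (by linarith) (by linarith)
    linarith
  have h4 := two_mul_le_low hU hV a
  have h5 := neg_two_mul_le_low hU hV a
  have h6 : 2 * a ≤ U * b := h4.trans (by gcongr)
  have h7 : -(2 * a) ≤ V * b := h5.trans (by gcongr)
  refine ⟨h6, h7, h3, klein_lt_of_mem hU hV ha ha' h6 h7 h3 ?_⟩
  rcases eq_or_ne a 0 with h8 | h8
  · have h9 : ‖w‖ = 1 := by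
      have h10 : 0 < V + U * ‖w‖ := by positivity
      have := (div_eq_zero_iff.1 h8).resolve_right h10.ne'
      linarith
    have h10 : w.re < 1 := by
      refine lt_of_le_of_ne (by rw [← h9]; exact Complex.re_le_norm w) fun h => hw1 ?_
      have h11 : w.im = 0 := by
        have h12 := Complex.sq_norm w
        rw [h9, Complex.normSq_apply, h] at h12
        nlinarith
      exact Complex.ext h h11
    have h11 := low_nonneg hU hV a
    have : 0 < (1 - w.re / ‖w‖) / 2 * (1 / 2 - lowKlein U V a) := by
      rw [h9, div_one]
      exact mul_pos (by linarith) (by linarith)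
    linarith
  · exact lt_of_lt_of_le (low_pos hU hV h8) h2

theorem ofHalfCoord_mem : ofHalfCoord U V w ∈ triangle U V := by
  obtain ⟨h1, h2, h3, h4⟩ := ofHalfCoord_klein hU hV hw hw1
  exact ofKlein_mem_triangle h4 h1 h2 h3

theorem kleinX_ofHalfCoord : kleinX (ofHalfCoord U V w) = (‖w‖ - 1) / (V + U * ‖w‖) :=
  kleinX_ofKlein (ofHalfCoord_klein hU hV hw hw1).2.2.2

/-- Modulus and real part determine a complex number up to conjugation, and `halfCoord` chooses the
conjugate in the closed upper half plane. -/
theorem halfCoord_ofHalfCoord : halfCoord U V (ofHalfCoord U V w) = ⟨w.re, |w.im|⟩ := by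
  have hr := norm_pos_iff.2 hw
  obtain ⟨ha, ha'⟩ := radius_bounds hU hV hr
  have h1 := low_lt hU hV ha ha'
  have h2 := kleinX_ofHalfCoord hU hV hw hw1
  have h3 : kleinY (ofHalfCoord U V w) = _ :=
    kleinY_ofKlein (ofHalfCoord_klein hU hV hw hw1).2.2.2
  have h4 : heightCos U V (kleinX (ofHalfCoord U V w)) (kleinY (ofHalfCoord U V w)) =
      w.re / ‖w‖ := by
    rw [heightCos, h3, h2, add_sub_cancel_left, mul_div_cancel_right₀ _ (by linarith)]
    ring
  have h5 : modulus U V (kleinX (ofHalfCoord U V w)) = ‖w‖ := by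
    rw [h2, modulus_radius hU hV hr]
  apply Complex.ext
  · rw [halfCoord_re, h4, h5]; field_simp
  · rw [halfCoord_im, h4, h5]
    change _ = |w.im|
    have h6 : 1 - (w.re / ‖w‖) ^ 2 = (w.im / ‖w‖) ^ 2 := by
      have h7 := Complex.sq_norm w
      rw [Complex.normSq_apply] at h7
      field_simp
      linarith
    rw [h6, Real.sqrt_sq_eq_abs, abs_div, abs_of_pos hr]
    field_simp

theorem continuousAt_ofHalfCoord : ContinuousAt (ofHalfCoord U V) w := by
  have hr := norm_pos_iff.2 hw
  have h1 : ContinuousAt (fun w : ℂ => (‖w‖ - 1) / (V + U * ‖w‖)) w :=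
    ContinuousAt.div (by fun_prop) (by fun_prop) (by positivity)
  have h2 : Continuous (lowKlein U V) := by unfold lowKlein; fun_prop
  have h3 : ContinuousAt (fun w : ℂ => w.re / ‖w‖) w :=
    ContinuousAt.div (by fun_prop) (by fun_prop) hr.ne'
  have h4 := h2.continuousAt.comp h1
  have h5 := h4.add (((continuousAt_const (y := (1 : ℝ))).sub h3).div_const 2 |>.mul
    ((continuousAt_const (y := (1 / 2 : ℝ))).sub h4))
  exact ContinuousAt.comp_of_eq (g := fun p : ℝ × ℝ => ofKlein p.1 p.2)
    (continuousAt_ofKlein (ofHalfCoord_klein hU hV hw hw1).2.2.2) (h1.prodMk h5) rfl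

end

theorem continuousAt_halfCoord {z : ℍ} (ha : -1 < V * kleinX z) (ha' : U * kleinX z < 1) :
    ContinuousAt (halfCoord U V) z := by
  have h1 : ContinuousAt kleinX z := continuous_kleinX.continuousAt
  have h2 : ContinuousAt kleinY z := continuous_kleinY.continuousAt
  have h3 : Continuous (lowKlein U V) := by unfold lowKlein; fun_prop
  have h4 : ContinuousAt (fun z => lowKlein U V (kleinX z)) z := h3.continuousAt.comp h1
  have h5 := low_lt hU hV ha ha'
  have h6 : ContinuousAt (fun z => heightCos U V (kleinX z) (kleinY z)) z := by
    unfold heightCos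
    refine continuousAt_const.sub (continuousAt_const.mul ((h2.sub h4).div
      (continuousAt_const.sub h4) ?_))
    linarith
  have h7 : ContinuousAt (fun z => modulus U V (kleinX z)) z := by
    unfold modulus
    refine ContinuousAt.div (by fun_prop) (by fun_prop) ?_
    linarith
  have h8 : ContinuousAt (fun z => √(1 - heightCos U V (kleinX z) (kleinY z) ^ 2)) z :=
    Real.continuous_sqrt.continuousAt.comp (continuousAt_const.sub (h6.pow 2))
  have hc := Complex.continuous_ofReal
  exact (hc.continuousAt.comp h7).mul ((hc.continuousAt.comp h6).add
    ((hc.continuousAt.comp h8).mul continuousAt_const))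

end

/-! ### The truncated surface is a thrice punctured sphere -/

section
variable {U V : ℝ} (hU : 2 ≤ U) (hV : 2 ≤ V)

/-- The interior of the Y-piece. -/
def pants : Set (Surface (modelGroup U V)) :=
  {p | -1 < V * surfaceX hU hV p ∧ U * surfaceX hU hV p < 1}

/-- The Y-piece. -/
def closedPants : Set (Surface (modelGroup U V)) :=
  {p | -1 ≤ V * surfaceX hU hV p ∧ U * surfaceX hU hV p ≤ 1}

theorem pants_eq : pants hU hV = surfaceX hU hV ⁻¹' Set.Ioo (-1 / V) (1 / U) := by
  ext p
  simp only [pants, Set.mem_ofPred_eq, Set.mem_preimage, Set.mem_Ioo]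
  rw [div_lt_iff₀' (by linarith), lt_div_iff₀' (by linarith)]

theorem closedPants_eq : closedPants hU hV = surfaceX hU hV ⁻¹' Set.Icc (-1 / V) (1 / U) := by
  ext p
  simp only [closedPants, Set.mem_ofPred_eq, Set.mem_preimage, Set.mem_Icc]
  rw [div_le_iff₀' (by linarith), le_div_iff₀' (by linarith)]

include hU hV in
theorem neg_one_div_lt : -1 / V < 1 / U := by
  have h1 : -1 / V < 0 := div_neg_of_neg_of_pos (by norm_num) (by linarith)
  have h2 : 0 < 1 / U := div_pos (by norm_num) (by linarith)
  linarith

/-- A continuous open map commutes with preimages of interiors, which reduces the claim to an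
interval. -/
theorem interior_closedPants : interior (closedPants hU hV) = pants hU hV := by
  rw [closedPants_eq, pants_eq, ← (isOpenMap_surfaceX hU hV).preimage_interior_eq_interior_preimage
    (continuous_surfaceX hU hV), interior_Icc]

theorem isClosed_closedPants : IsClosed (closedPants hU hV) := by
  rw [closedPants_eq]
  exact isClosed_Icc.preimage (continuous_surfaceX hU hV)

theorem closure_pants : closure (pants hU hV) = closedPants hU hV := by
  rw [closedPants_eq, pants_eq, ← (isOpenMap_surfaceX hU hV).preimage_closure_eq_closure_preimage
    (continuous_surfaceX hU hV), closure_Ioo (neg_one_div_lt hU hV).ne]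

theorem frontier_closedPants : frontier (closedPants hU hV) =
    {p | U * surfaceX hU hV p = 1} ∪ {p | -V * surfaceX hU hV p = 1} := by
  rw [frontier, (isClosed_closedPants hU hV).closure_eq, interior_closedPants]
  ext p
  simp only [closedPants, pants, Set.mem_sdiff, Set.mem_ofPred_eq, Set.mem_union]
  constructor
  · rintro ⟨⟨h1, h2⟩, h3⟩
    by_contra h4
    push Not at h4
    exact h3 ⟨lt_of_le_of_ne h1 fun h => h4.2 (by linarith), lt_of_le_of_ne h2 h4.1⟩
  · rintro (h | h)
    · refine ⟨⟨?_, h.le⟩, fun h' => by linarith⟩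
      have : 0 < surfaceX hU hV p := pos_of_mul_pos_right (by linarith) (by linarith : 0 ≤ U)
      nlinarith
    · refine ⟨⟨by linarith, ?_⟩, fun h' => by linarith⟩
      have : 0 < -surfaceX hU hV p :=
        pos_of_mul_pos_right (a := V) (by linarith) (by linarith : 0 ≤ V)
      nlinarith

/-- Sides have real coordinate, hence are fixed by conjugation, so the half coordinates of the two
sheets glue along the real axis. -/
theorem exists_surfaceCoord : ∃ f : Surface (modelGroup U V) → ℂ,
    (∀ z ∈ triangle U V, f (proj _ z) = halfCoord U V z) ∧
    (∀ z ∈ triangle U V, f (proj _ (inversion z)) = (starRingEnd ℂ) (halfCoord U V z)) ∧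
    ∀ p ∈ pants hU hV, ContinuousAt f p := by
  obtain ⟨f, h1, h2, h3⟩ := exists_surface_function hU hV (halfCoord U V) (c := starRingEnd ℂ)
    Complex.conj_conj Complex.continuous_conj fun z hz ⟨i, hi⟩ =>
      Complex.conj_eq_iff_im.2 (halfCoord_im_of_fixed hU hV hz hi)
  refine ⟨f, h1, fun z hz => by rw [← h1 z hz]; exact h2 0 z, fun p hp => ?_⟩
  obtain ⟨z, hz, h4, h5, -⟩ := exists_klein hU hV p
  obtain ⟨h6, h7⟩ := hp
  rw [h5] at h6 h7
  have h8 := h3 z hz (continuousAt_halfCoord hU hV h6 h7).continuousWithinAt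
  rcases h4 with rfl | rfl
  exacts [h8.1, h8.2]

/-- The coordinate identifying `pants` with the plane without `0` and `1`. -/
noncomputable def surfaceCoord : Surface (modelGroup U V) → ℂ :=
  (exists_surfaceCoord hU hV).choose

theorem surfaceCoord_proj {z : ℍ} (hz : z ∈ triangle U V) :
    surfaceCoord hU hV (proj _ z) = halfCoord U V z :=
  (exists_surfaceCoord hU hV).choose_spec.1 z hz

theorem surfaceCoord_inversion {z : ℍ} (hz : z ∈ triangle U V) :
    surfaceCoord hU hV (proj _ (inversion z)) = (starRingEnd ℂ) (halfCoord U V z) :=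
  (exists_surfaceCoord hU hV).choose_spec.2.1 z hz

theorem continuousAt_surfaceCoord {p : Surface (modelGroup U V)} (hp : p ∈ pants hU hV) :
    ContinuousAt (surfaceCoord hU hV) p :=
  (exists_surfaceCoord hU hV).choose_spec.2.2 p hp

theorem norm_surfaceCoord {p : Surface (modelGroup U V)} (hp : p ∈ pants hU hV) :
    ‖surfaceCoord hU hV p‖ = modulus U V (surfaceX hU hV p) := by
  obtain ⟨z, hz, h4, h5, -⟩ := exists_klein hU hV p
  obtain ⟨h6, h7⟩ := hp
  rw [h5] at h6 h7 ⊢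
  rcases h4 with rfl | rfl
  · rw [surfaceCoord_proj hU hV hz, norm_halfCoord hU hV hz h6 h7]
  · rw [surfaceCoord_inversion hU hV hz, RCLike.norm_conj, norm_halfCoord hU hV hz h6 h7]

theorem surfaceCoord_re {p : Surface (modelGroup U V)} :
    (surfaceCoord hU hV p).re = modulus U V (surfaceX hU hV p) *
      heightCos U V (surfaceX hU hV p) (surfaceY hU hV p) := by
  obtain ⟨z, hz, h4, h5, h6⟩ := exists_klein hU hV p
  rw [h5, h6, ← halfCoord_re]
  rcases h4 with rfl | rfl
  · rw [surfaceCoord_proj hU hV hz]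
  · rw [surfaceCoord_inversion hU hV hz, Complex.conj_re]

theorem surfaceCoord_ne_zero {p : Surface (modelGroup U V)} (hp : p ∈ pants hU hV) :
    surfaceCoord hU hV p ≠ 0 := by
  rw [← norm_pos_iff, norm_surfaceCoord hU hV hp]
  exact modulus_pos hU hV hp.1 hp.2

theorem surfaceCoord_ne_one {p : Surface (modelGroup U V)} (hp : p ∈ pants hU hV) :
    surfaceCoord hU hV p ≠ 1 := by
  obtain ⟨z, hz, h4, h5, -⟩ := exists_klein hU hV p
  obtain ⟨h6, h7⟩ := hp
  rw [h5] at h6 h7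
  have h8 := halfCoord_ne_one hU hV hz h6 h7
  rcases h4 with rfl | rfl
  · rwa [surfaceCoord_proj hU hV hz]
  · rw [surfaceCoord_inversion hU hV hz]
    intro h
    rw [map_eq_one_iff _ (RingHom.injective _)] at h
    exact h8 h

/-- The inverse of `surfaceCoord` on `pants`. -/
noncomputable def ofSurfaceCoord (U V : ℝ) (w : ℂ) : Surface (modelGroup U V) :=
  if 0 ≤ w.im then proj _ (ofHalfCoord U V w) else proj _ (inversion (ofHalfCoord U V w))

include hU hV in
-- A real coordinate means that the point is on a side, where the two sheets coincide.
theorem proj_inversion_of_im_eq_zero {z : ℍ} (hz : z ∈ triangle U V) (ha : -1 < V * kleinX z)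
    (ha' : U * kleinX z < 1) (h : (halfCoord U V z).im = 0) :
    proj (modelGroup U V) (inversion z) = proj (modelGroup U V) z := by
  obtain ⟨i, hi⟩ := exists_fixed_of_im_eq_zero hU hV hz ha ha' h
  conv_rhs => rw [← hi]
  exact proj_side (V := V) (U := U) 0 i z

theorem ofHalfCoord_conj (w : ℂ) : ofHalfCoord U V ((starRingEnd ℂ) w) = ofHalfCoord U V w := by
  rw [ofHalfCoord, ofHalfCoord, RCLike.norm_conj, Complex.conj_re]

theorem ofSurfaceCoord_surfaceCoord {p : Surface (modelGroup U V)} (hp : p ∈ pants hU hV) :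
    ofSurfaceCoord U V (surfaceCoord hU hV p) = p := by
  obtain ⟨z, hz, h4, h5, -⟩ := exists_klein hU hV p
  obtain ⟨h6, h7⟩ := hp
  rw [h5] at h6 h7
  have h8 := ofHalfCoord_halfCoord hU hV hz h6 h7
  have h9 := halfCoord_im_nonneg hU hV h6 h7
  rcases h4 with rfl | rfl
  · rw [surfaceCoord_proj hU hV hz, ofSurfaceCoord, if_pos h9, h8]
  · rw [surfaceCoord_inversion hU hV hz, ofSurfaceCoord, ofHalfCoord_conj, h8, Complex.conj_im]
    split_ifs with h
    · exact (proj_inversion_of_im_eq_zero hU hV hz h6 h7 (by linarith)).symm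
    · rfl

section
variable {w : ℂ} (hw : w ≠ 0) (hw1 : w ≠ 1)
include hw hw1

include hU hV in
theorem kleinX_ofHalfCoord_mem : -1 < V * kleinX (ofHalfCoord U V w) ∧
    U * kleinX (ofHalfCoord U V w) < 1 := by
  rw [kleinX_ofHalfCoord hU hV hw hw1]
  exact radius_bounds hU hV (norm_pos_iff.2 hw)

theorem ofSurfaceCoord_mem : ofSurfaceCoord U V w ∈ pants hU hV := by
  have h1 := ofHalfCoord_mem hU hV hw hw1
  have h2 := kleinX_ofHalfCoord_mem hU hV hw hw1
  rw [ofSurfaceCoord]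
  split_ifs
  · rwa [pants, Set.mem_ofPred_eq, surfaceX_proj hU hV h1]
  · rwa [pants, Set.mem_ofPred_eq, surfaceX_inversion hU hV h1]

theorem surfaceCoord_ofSurfaceCoord : surfaceCoord hU hV (ofSurfaceCoord U V w) = w := by
  have h1 := ofHalfCoord_mem hU hV hw hw1
  rw [ofSurfaceCoord]
  split_ifs with h
  · rw [surfaceCoord_proj hU hV h1, halfCoord_ofHalfCoord hU hV hw hw1, abs_of_nonneg h]
  · rw [surfaceCoord_inversion hU hV h1, halfCoord_ofHalfCoord hU hV hw hw1,
      abs_of_neg (not_le.1 h)]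
    apply Complex.ext <;> simp

end

include hU hV in
theorem continuous_ofSurfaceCoord :
    Continuous fun w : {w : ℂ // w ≠ 0 ∧ w ≠ 1} => ofSurfaceCoord U V w := by
  have h1 : Continuous fun w : {w : ℂ // w ≠ 0 ∧ w ≠ 1} => ofHalfCoord U V w :=
    continuous_iff_continuousAt.2 fun w => ContinuousAt.comp (g := ofHalfCoord U V)
      (continuousAt_ofHalfCoord hU hV w.2.1 w.2.2) continuous_subtype_val.continuousAt
  have h2 := (isOpenQuotientMap_proj (modelGroup U V)).continuous
  refine Continuous.if_le (h2.comp h1) (h2.comp (continuous_inversion.comp h1)) continuous_const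
    (Complex.continuous_im.comp continuous_subtype_val) fun w hw => ?_
  have h3 := kleinX_ofHalfCoord_mem hU hV w.2.1 w.2.2
  refine (proj_inversion_of_im_eq_zero hU hV (ofHalfCoord_mem hU hV w.2.1 w.2.2) h3.1 h3.2 ?_).symm
  rw [halfCoord_ofHalfCoord hU hV w.2.1 w.2.2]
  exact abs_eq_zero.2 hw.symm

/-- The pair of pants as a plane without `0` and `1`. -/
noncomputable def pantsHomeo : pants hU hV ≃ₜ {w : ℂ // w ≠ 0 ∧ w ≠ 1} where
  toFun p := ⟨surfaceCoord hU hV p, surfaceCoord_ne_zero hU hV p.2, surfaceCoord_ne_one hU hV p.2⟩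
  invFun w := ⟨ofSurfaceCoord U V w, ofSurfaceCoord_mem hU hV w.2.1 w.2.2⟩
  left_inv p := Subtype.ext (ofSurfaceCoord_surfaceCoord hU hV p.2)
  right_inv w := Subtype.ext (surfaceCoord_ofSurfaceCoord hU hV w.2.1 w.2.2)
  continuous_toFun := Continuous.subtype_mk (continuous_iff_continuousAt.2 fun p =>
    ContinuousAt.comp (g := surfaceCoord hU hV) (continuousAt_surfaceCoord hU hV p.2)
      continuous_subtype_val.continuousAt) _
  continuous_invFun := Continuous.subtype_mk (continuous_ofSurfaceCoord hU hV) _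

end

/-- The three punctures of the Riemann sphere. -/
noncomputable def puncture : Fin 3 → OnePoint ℂ := ![OnePoint.infty, ((0 : ℂ) : OnePoint ℂ), ((1 : ℂ) : OnePoint ℂ)]

theorem puncture_injective : Function.Injective puncture := by
  intro i j h
  fin_cases i <;> fin_cases j <;> simp_all [puncture]

theorem coe_notMem_range_puncture {w : ℂ} :
    (w : OnePoint ℂ) ∉ Set.range puncture ↔ w ≠ 0 ∧ w ≠ 1 := by
  simp [puncture, eq_comm, and_comm]

/-- The plane without `0` and `1` as a thrice punctured sphere. -/
noncomputable def sphereHomeo :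
    {w : ℂ // w ≠ 0 ∧ w ≠ 1} ≃ₜ {x : OnePoint ℂ // x ∉ Set.range puncture} :=
  Equiv.toHomeomorphOfIsInducing
    (Equiv.ofBijective
      (fun w => ⟨((w : ℂ) : OnePoint ℂ), coe_notMem_range_puncture.2 w.2⟩) (by
        constructor
        · intro a b h
          exact Subtype.ext (OnePoint.coe_injective (congrArg Subtype.val h))
        · rintro ⟨x, hx⟩
          induction x using OnePoint.rec with
          | infty => exact absurd ⟨0, rfl⟩ hx
          | coe w => exact ⟨⟨w, coe_notMem_range_puncture.1 hx⟩, rfl⟩))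
    (IsInducing.of_comp_iff IsInducing.subtypeVal |>.1
      (OnePoint.isOpenEmbedding_coe.isInducing.comp IsInducing.subtypeVal))

/-- The interior of the Y-piece as a thrice punctured sphere. -/
theorem exists_homeo {U V : ℝ} (hU : 2 ≤ U) (hV : 2 ≤ V) {S : Set (Surface (modelGroup U V))}
    (hS : S = pants hU hV) : ∃ φ : S ≃ₜ {x : OnePoint ℂ // x ∉ Set.range puncture},
      ∀ p : S, (φ p : OnePoint ℂ) = (surfaceCoord hU hV p : OnePoint ℂ) := by
  subst hS
  exact ⟨(pantsHomeo hU hV).trans sphereHomeo, fun p => rfl⟩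

/-! ### The ends of the pair of pants -/

theorem map_coe_comap_coe {α : Type*} {S : Set α} {β : Type*} (f : α → β) (F : Filter β) :
    map (fun y : S => (y : α)) (comap (fun y : S => f y) F) = comap f F ⊓ 𝓟 S := by
  change map ((↑) : S → α) (comap (f ∘ ((↑) : S → α)) F) = _
  rw [← comap_comap, Filter.subtype_coe_map_comap]

/-- Two functions define the same end as soon as convergence of either one forces convergence of the
other. It serves to express the three punctures through X and Y. -/
theorem comap_inf_eq_comap_inf {α β γ : Type*} {f : α → β} {g : α → γ} {F : Filter β}
    {G : Filter γ} {S : Set α} (h1 : Tendsto g (comap f F ⊓ 𝓟 S) G)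
    (h2 : Tendsto f (comap g G ⊓ 𝓟 S) F) : comap f F ⊓ 𝓟 S = comap g G ⊓ 𝓟 S :=
  le_antisymm (le_inf (tendsto_iff_comap.1 h1) inf_le_right)
    (le_inf (tendsto_iff_comap.1 h2) inf_le_right)

section
variable {U V : ℝ} (hU : 2 ≤ U) (hV : 2 ≤ V) {S : Set (Surface (modelGroup U V))}
  (hS : S = pants hU hV) {φ : S → OnePoint ℂ}
  (hφ : ∀ p : S, φ p = (surfaceCoord hU hV p : OnePoint ℂ))
include hS hφ

theorem map_end_eq (i : Fin 3) : map (fun y : S => (y : Surface (modelGroup U V)))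
    (comap φ (𝓝 (puncture i))) =
      comap (surfaceCoord hU hV) (comap (↑) (𝓝 (puncture i))) ⊓ 𝓟 S := by
  rw [← map_coe_comap_coe, comap_comap]
  congr 2
  exact funext hφ

theorem end_zero : map (fun y : S => (y : Surface (modelGroup U V)))
    (comap φ (𝓝 (puncture 0))) = comap (fun p => U * surfaceX hU hV p) (𝓝 1) ⊓ 𝓟 S := by
  rw [map_end_eq hU hV hS hφ]
  have h1 : comap ((↑) : ℂ → OnePoint ℂ) (𝓝 (puncture 0)) = comap norm atTop := by
    rw [comap_norm_atTop, Metric.cobounded_eq_cocompact, ← Filter.coclosedCompact_eq_cocompact]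
    exact OnePoint.comap_coe_nhds_infty
  rw [h1, comap_comap]
  have hmem : ∀ᶠ p in 𝓟 S, p ∈ pants hU hV := by rw [← hS]; exact mem_principal_self S
  have hU0 : 0 < U := by linarith
  have hV0 : 0 < V := by linarith
  apply comap_inf_eq_comap_inf
  -- With X = (r - 1)/(V + Ur) one has UX = 1 - (U + V)/(V + Ur).
  · have h2 : Tendsto (fun r : ℝ => 1 - (U + V) / (V + U * r)) atTop (𝓝 (1 - 0)) :=
      tendsto_const_nhds.sub (Tendsto.div_atTop tendsto_const_nhds
        (tendsto_atTop_add_const_left _ _ (tendsto_id.const_mul_atTop hU0)))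
    rw [sub_zero] at h2
    refine (h2.comp (tendsto_comap.mono_left inf_le_left)).congr' ?_
    filter_upwards [hmem.filter_mono inf_le_right] with p hp
    have h3 := modulus_sub_one_div hU hV hp.2
    have h4 := modulus_pos hU hV hp.1 hp.2
    simp only [Function.comp_apply]
    rw [norm_surfaceCoord hU hV hp]
    nth_rw 2 [← h3]
    have : V + U * modulus U V (surfaceX hU hV p) ≠ 0 := by positivity
    field_simp
    ring
  · have h2 : Tendsto (fun p => U * surfaceX hU hV p)
        (comap (fun p => U * surfaceX hU hV p) (𝓝 1) ⊓ 𝓟 S) (𝓝 1) :=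
      tendsto_comap.mono_left inf_le_left
    have h3 : Tendsto (fun p => 1 - U * surfaceX hU hV p)
        (comap (fun p => U * surfaceX hU hV p) (𝓝 1) ⊓ 𝓟 S) (𝓝[>] 0) := by
      refine tendsto_nhdsWithin_iff.2 ⟨by simpa using tendsto_const_nhds (x := (1 : ℝ)).sub h2, ?_⟩
      filter_upwards [hmem.filter_mono inf_le_right] with p hp
      have := hp.2
      rw [Set.mem_Ioi]; linarith
    have h4 : Tendsto (fun p => 1 + V / U * (U * surfaceX hU hV p))
        (comap (fun p => U * surfaceX hU hV p) (𝓝 1) ⊓ 𝓟 S) (𝓝 (1 + V / U * 1)) :=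
      tendsto_const_nhds.add (tendsto_const_nhds.mul h2)
    refine (h4.pos_mul_atTop (by positivity) (tendsto_inv_nhdsGT_zero.comp h3)).congr' ?_
    filter_upwards [hmem.filter_mono inf_le_right] with p hp
    simp only [Function.comp_apply]
    rw [norm_surfaceCoord hU hV hp, modulus, div_eq_mul_inv]
    congr 2
    field_simp

theorem end_one : map (fun y : S => (y : Surface (modelGroup U V)))
    (comap φ (𝓝 (puncture 1))) = comap (fun p => -V * surfaceX hU hV p) (𝓝 1) ⊓ 𝓟 S := by
  rw [map_end_eq hU hV hS hφ]
  have h1 : comap ((↑) : ℂ → OnePoint ℂ) (𝓝 (puncture 1)) = comap norm (𝓝 0) := by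
    rw [comap_norm_nhds_zero]
    exact (OnePoint.isOpenEmbedding_coe.isInducing.nhds_eq_comap 0).symm
  rw [h1, comap_comap]
  have hmem : ∀ᶠ p in 𝓟 S, p ∈ pants hU hV := by rw [← hS]; exact mem_principal_self S
  have hU0 : 0 < U := by linarith
  have hV0 : 0 < V := by linarith
  apply comap_inf_eq_comap_inf
  · have h2 : ContinuousAt (fun r : ℝ => -V * ((r - 1) / (V + U * r))) 0 :=
      continuousAt_const.mul (ContinuousAt.div (by fun_prop) (by fun_prop) (by simp; linarith))
    have h2' : Tendsto (fun r : ℝ => -V * ((r - 1) / (V + U * r))) (𝓝 0) (𝓝 1) := by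
      convert h2.tendsto using 2
      field_simp; simp
    refine (h2'.comp (tendsto_comap.mono_left inf_le_left)).congr' ?_
    filter_upwards [hmem.filter_mono inf_le_right] with p hp
    simp only [Function.comp_apply]
    rw [norm_surfaceCoord hU hV hp, modulus_sub_one_div hU hV hp.2]
  -- This is the modulus (1 + VX)/(1 - UX) written in terms of t = -VX.
  · have h2 : ContinuousAt (fun t : ℝ => (1 - t) / (1 + U / V * t)) 1 :=
      ContinuousAt.div (by fun_prop) (by fun_prop) (by positivity)
    have h2' : Tendsto (fun t : ℝ => (1 - t) / (1 + U / V * t)) (𝓝 1) (𝓝 0) := by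
      convert h2.tendsto using 2
      simp
    refine (h2'.comp (tendsto_comap.mono_left inf_le_left)).congr' ?_
    filter_upwards [hmem.filter_mono inf_le_right] with p hp
    simp only [Function.comp_apply]
    rw [norm_surfaceCoord hU hV hp, modulus]
    congr 1
    · ring
    · field_simp; ring

theorem end_two : map (fun y : S => (y : Surface (modelGroup U V)))
    (comap φ (𝓝 (puncture 2))) = comap (surfaceY hU hV) (𝓝 0) ⊓ 𝓟 S := by
  rw [map_end_eq hU hV hS hφ]
  have h1 : comap ((↑) : ℂ → OnePoint ℂ) (𝓝 (puncture 2)) = 𝓝 1 :=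
    (OnePoint.isOpenEmbedding_coe.isInducing.nhds_eq_comap 1).symm
  rw [h1]
  have hmem : ∀ᶠ p in 𝓟 S, p ∈ pants hU hV := by rw [← hS]; exact mem_principal_self S
  have hU0 : 0 < U := by linarith
  have hV0 : 0 < V := by linarith
  have hlow : Continuous (lowKlein U V) := by unfold lowKlein; fun_prop
  have hlow0 : lowKlein U V 0 = 0 := by simp [lowKlein]
  apply comap_inf_eq_comap_inf
  · have h2 : ContinuousAt (fun w : ℂ => lowKlein U V ((‖w‖ - 1) / (V + U * ‖w‖)) +
      (1 - w.re / ‖w‖) / 2 * (1 / 2 - lowKlein U V ((‖w‖ - 1) / (V + U * ‖w‖)))) 1 := by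
      have h3 : ContinuousAt (fun w : ℂ => (‖w‖ - 1) / (V + U * ‖w‖)) 1 :=
        ContinuousAt.div (by fun_prop) (by fun_prop) (by positivity)
      have h4 : ContinuousAt (fun w : ℂ => w.re / ‖w‖) 1 :=
        ContinuousAt.div (by fun_prop) (by fun_prop) (by simp)
      have h5 : ContinuousAt (fun w : ℂ => lowKlein U V ((‖w‖ - 1) / (V + U * ‖w‖))) 1 :=
        hlow.continuousAt.comp h3
      fun_prop
    have h2' := h2.tendsto
    simp only [norm_one, sub_self, zero_div, hlow0, Complex.one_re, div_one, zero_mul,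
      add_zero] at h2'
    refine (h2'.comp (tendsto_comap.mono_left inf_le_left)).congr' ?_
    filter_upwards [hmem.filter_mono inf_le_right] with p hp
    simp only [Function.comp_apply]
    have h6 := low_lt hU hV hp.1 hp.2
    have h7 : 1 / 2 - lowKlein U V (surfaceX hU hV p) ≠ 0 := by linarith
    rw [norm_surfaceCoord hU hV hp, modulus_sub_one_div hU hV hp.2, surfaceCoord_re,
      mul_div_cancel_left₀ _ (modulus_pos hU hV hp.1 hp.2).ne', heightCos, sub_sub_cancel,
      mul_div_cancel_left₀ _ two_ne_zero, div_mul_cancel₀ _ h7]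
    ring
  · have hY : Tendsto (surfaceY hU hV) (comap (surfaceY hU hV) (𝓝 0) ⊓ 𝓟 S) (𝓝 0) :=
      tendsto_comap.mono_left inf_le_left
    -- On the triangle the vertical sides bound |X| by a multiple of Y, so Y → 0 drives X to 0 as
    -- well.
    have hX : Tendsto (surfaceX hU hV) (comap (surfaceY hU hV) (𝓝 0) ⊓ 𝓟 S) (𝓝 0) := by
      refine squeeze_zero_norm (a := fun p => (U + V) * surfaceY hU hV p) (fun p => ?_)
        (by simpa using hY.const_mul (U + V))
      obtain ⟨z, hz, -, h5, h6⟩ := exists_klein hU hV p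
      rw [h5, h6, Real.norm_eq_abs, abs_le]
      have h7 := two_kleinX_le hz
      have h8 := neg_two_kleinX_le hz
      have h9 := kleinY_pos z
      constructor <;> nlinarith
    have hL : Tendsto (fun p => lowKlein U V (surfaceX hU hV p))
        (comap (surfaceY hU hV) (𝓝 0) ⊓ 𝓟 S) (𝓝 0) := by
      have := hlow.continuousAt.tendsto.comp hX
      rwa [hlow0] at this
    have hM : Tendsto (fun p => modulus U V (surfaceX hU hV p))
        (comap (surfaceY hU hV) (𝓝 0) ⊓ 𝓟 S) (𝓝 1) := by
      have h3 : ContinuousAt (modulus U V) 0 :=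
        ContinuousAt.div (by fun_prop) (by fun_prop) (by simp)
      have := h3.tendsto.comp hX
      have h4 : modulus U V 0 = 1 := by simp [modulus]
      rwa [h4] at this
    have hK : Tendsto (fun p => heightCos U V (surfaceX hU hV p) (surfaceY hU hV p))
        (comap (surfaceY hU hV) (𝓝 0) ⊓ 𝓟 S) (𝓝 1) := by
      have := (tendsto_const_nhds (x := (1 : ℝ))).sub (((hY.sub hL).div
        ((tendsto_const_nhds (x := (1 / 2 : ℝ))).sub hL) (by norm_num)).const_mul 2)
      simpa [heightCos] using this
    rw [tendsto_iff_norm_sub_tendsto_zero]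
    -- By |w - 1|² = |w|² - 2 Re w + 1 the distance to 1 depends only on X and Y, so the sheet does
    -- not matter.
    have h3 : Tendsto (fun p => √(modulus U V (surfaceX hU hV p) ^ 2 -
        2 * (modulus U V (surfaceX hU hV p) *
          heightCos U V (surfaceX hU hV p) (surfaceY hU hV p)) + 1))
        (comap (surfaceY hU hV) (𝓝 0) ⊓ 𝓟 S) (𝓝 0) := by
      have := (((hM.pow 2).sub ((hM.mul hK).const_mul 2)).add_const 1)
      have := (Real.continuous_sqrt.tendsto _).comp this
      norm_num at this
      exact this
    refine h3.congr' ?_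
    filter_upwards [hmem.filter_mono inf_le_right] with p hp
    rw [← surfaceCoord_re, ← norm_surfaceCoord hU hV hp, 
      ← Real.sqrt_sq (norm_nonneg (surfaceCoord hU hV p - 1)),
            Complex.sq_norm, Complex.sq_norm, Complex.normSq_sub]
    simp
    ring_nf

end

/-! ### Cusps -/

/-- Criterion for a cusp: θ tends to 0 high in the horoballs, and conversely small |θ| is attained
only in a prescribed horoball. -/
theorem comap_eq_map_atImInfty {Γ : Subgroup PSL(2, ℝ)} {g : PSL(2, ℝ)} {θ : Surface Γ → ℝ}
    (h1 : Tendsto (fun z => θ (proj Γ (g • z))) atImInfty (𝓝 0))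
    (h2 : ∀ t : ℝ, ∃ δ > 0, ∀ p, |θ p| < δ → ∃ z : ℍ, t ≤ z.im ∧ proj Γ (g • z) = p) :
    comap θ (𝓝 0) = map (fun z : ℍ => proj Γ (g • z)) atImInfty := by
  refine le_antisymm ?_ (tendsto_iff_comap.1 h1 |> fun h => by
    rw [← map_le_iff_le_comap] at h
    exact map_le_iff_le_comap.1 (by rwa [Filter.map_map]))
  intro A hA
  rw [mem_map, atImInfty_mem] at hA
  obtain ⟨t, ht⟩ := hA
  obtain ⟨δ, hδ, h3⟩ := h2 t
  refine mem_comap.2 ⟨Metric.ball 0 δ, Metric.ball_mem_nhds 0 hδ, fun p hp => ?_⟩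
  obtain ⟨z, h4, rfl⟩ := h3 p (by simpa using hp)
  exact ht z h4

theorem tendsto_inv_im_sq : Tendsto (fun z : ℍ => 1 / z.im ^ 2) atImInfty (𝓝 0) := by
  have h : Tendsto UpperHalfPlane.im atImInfty atTop := tendsto_comap
  exact tendsto_const_nhds.div_atTop ((tendsto_pow_atTop two_ne_zero).comp h)

section
variable {U V : ℝ} (hU : 2 ≤ U) (hV : 2 ≤ V)
include hU hV

theorem surfaceY_word (L : List (Fin 3)) {z : ℍ} (hz : z ∈ triangle U V) :
    surfaceY hU hV (proj _ (word U V L z)) = kleinY z := by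
  rcases proj_word_eq_or (U := U) (V := V) L z with h | h
  · rw [h, surfaceY_proj hU hV hz]
  · rw [h, surfaceY_inversion hU hV hz]

/-- The side conditions give UX ≤ U²Y/2 and -VX ≤ V²Y/2, both below 1 once Y < 2/(U + V)². So near
this cusp the Y-piece is the whole surface. -/
theorem comap_surfaceY_le : comap (surfaceY hU hV) (𝓝 0) ≤ 𝓟 (pants hU hV) := by
  rw [le_principal_iff]
  have h0 : 0 < 2 / (U + V) ^ 2 := by positivity
  refine mem_comap.2 ⟨Set.Iio (2 / (U + V) ^ 2), Iio_mem_nhds h0, fun p hp => ?_⟩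
  obtain ⟨z, hz, -, h5, h6⟩ := exists_klein hU hV p
  rw [Set.mem_preimage, h6, Set.mem_Iio, lt_div_iff₀ (by positivity)] at hp
  have h7 := two_kleinX_le hz
  have h8 := neg_two_kleinX_le hz
  have h9 := kleinY_pos z
  rw [pants, Set.mem_ofPred_eq, h5]
  have h10 : 0 < U * kleinY z := by positivity
  have h11 : 0 < V * kleinY z := by positivity
  have h12 : kleinY z * (U + V) ^ 2 =
    U * (U * kleinY z) + 2 * U * (V * kleinY z) + V * (V * kleinY z) := by ring
  constructor <;> nlinarith

/-- The matrix of the dilation by `t`. -/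
noncomputable def dilation (t : ℝ) (ht : 0 < t) : SL(2, ℝ) :=
  ⟨!![√t, 0; 0, 1 / √t], by
    have := (Real.sqrt_pos.2 ht).ne'
    simp [Matrix.det_fin_two, this]⟩

omit hU hV in
theorem coe_dilation_smul (t : ℝ) (ht : 0 < t) (z : ℍ) :
    ((toPSL (dilation t ht) • z : ℍ) : ℂ) = t * z := by
  rw [coe_toPSL_smul' (A := dilation t ht) rfl]
  have h1 : ((√t : ℝ) : ℂ) ≠ 0 := by exact_mod_cast (Real.sqrt_pos.2 ht).ne'
  have h2 : ((√t : ℝ) : ℂ) * (√t : ℝ) = t := by exact_mod_cast Real.mul_self_sqrt ht.le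
  rw [← h2]
  push_cast
  field_simp
  ring

omit hU hV in
theorem dilation_smul_im (t : ℝ) (ht : 0 < t) (z : ℍ) :
    (toPSL (dilation t ht) • z).im = t * z.im := by
  have := congrArg Complex.im (coe_dilation_smul t ht z)
  simpa using this

omit hU hV in
theorem unitTranslation_smul (z : ℍ) : ((unitTranslation • z : ℍ) : ℂ) = z + 1 := by
  rw [unitTranslation, coe_toPSL_smul' (A := translationMatrix) rfl]
  simp

omit hU hV in
theorem eq_of_forall_smul {g h : PSL(2, ℝ)} (H : ∀ z : ℍ, g • z = h • z) : g = h := by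
  have : h⁻¹ * g = 1 := eq_one_of_forall_smul fun z => by rw [mul_smul, H, inv_smul_smul]
  exact (inv_mul_eq_one.1 this).symm

/-- The cusp at infinity. -/
theorem isCuspFilter_infty : IsCuspFilter (modelGroup U V)
    (comap (surfaceY hU hV) (𝓝 0) ⊓ 𝓟 (pants hU hV)) := by
  have hT : 0 < U + V := by linarith
  refine ⟨toPSL (dilation (U + V) hT), ?_, ?_⟩
  -- The two vertical reflections compose to z ↦ z + U + V, which the dilation by U + V conjugates
  -- to the unit translation.
  · obtain ⟨γ, hγ, h⟩ := exists_mem_of_word (U := U) (V := V) (L := [1, 2]) (by simp)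
    have h1 : toPSL (dilation (U + V) hT) * unitTranslation * (toPSL (dilation (U + V) hT))⁻¹ =
        γ := by
      rw [mul_inv_eq_iff_eq_mul]
      refine eq_of_forall_smul fun z => ?_
      rw [mul_smul, mul_smul, h]
      apply UpperHalfPlane.ext
      rw [coe_dilation_smul, unitTranslation_smul]
      apply Complex.ext
      · have h2 := congrArg Complex.re (coe_dilation_smul (U + V) hT z)
        simp at h2 ⊢
        rw [h2]
        ring
      · have h2 := congrArg Complex.im (coe_dilation_smul (U + V) hT z)
        simp at h2 ⊢
        rw [h2]
    rwa [h1]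
  · rw [inf_eq_left.2 (comap_surfaceY_le hU hV)]
    refine comap_eq_map_atImInfty ?_ ?_
    · refine squeeze_zero' (Eventually.of_forall fun z => ?_) ?_ tendsto_inv_im_sq
      · obtain ⟨w, -, -, -, h6⟩ := exists_klein hU hV (proj _ (toPSL (dilation (U + V) hT) • z))
        rw [h6]
        exact (kleinY_pos w).le
      · rw [Filter.Eventually, atImInfty_mem]
        refine ⟨1, fun z hz => ?_⟩
        obtain ⟨L, w, h1, h2, h3, h4⟩ := exists_word_strip hT (toPSL (dilation (U + V) hT) • z)
        rw [dilation_smul_im] at h2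
        have h5 : z.im ≤ w.im := by rw [h2]; nlinarith
        have hw : w ∈ triangle U V := ⟨h3, h4, by nlinarith⟩
        rw [Set.mem_ofPred_eq, h1, surfaceY_word hU hV L hw, kleinY]
        exact one_div_le_one_div_of_le (by positivity) (by nlinarith)
    · intro t
      -- On the triangle (Re z)² ≤ (U + V)², so a Y below this threshold forces Im z > (U + V)t.
      refine ⟨1 / (1 + (U + V) ^ 2 + ((U + V) * t) ^ 2), by positivity, fun p hp => ?_⟩
      obtain ⟨z, hz, h4, -, h6⟩ := exists_klein hU hV p
      rw [h6, abs_of_pos (kleinY_pos z), kleinY, one_div_lt_one_div (klein_denom_pos z)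
        (by positivity)] at hp
      have h7 : z.re ^ 2 ≤ (U + V) ^ 2 := by
        obtain ⟨h8, h9, -⟩ := hz
        nlinarith
      have h8 : (U + V) * t ≤ z.im := by
        by_contra h
        push Not at h
        nlinarith [z.im_pos]
      have key : ∀ w : ℍ, w.im = z.im → p = proj _ w →
          ∃ w : ℍ, t ≤ w.im ∧ proj (modelGroup U V) (toPSL (dilation (U + V) hT) • w) = p := by
        intro w hw hpw
        refine ⟨(toPSL (dilation (U + V) hT))⁻¹ • w, ?_, by rw [smul_inv_smul, hpw]⟩
        have h9 := dilation_smul_im (U + V) hT ((toPSL (dilation (U + V) hT))⁻¹ • w)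
        rw [smul_inv_smul, hw] at h9
        rw [h9] at h8
        exact le_of_mul_le_mul_left h8 hT
      rcases h4 with h4 | h4
      · exact key z rfl h4
      -- On the other sheet the point is represented by a vertical reflection, which keeps the
      -- height, rather than by the inversion.
      · refine key (refl U z) rfl (h4.trans ?_)
        exact proj_side (U := U) (V := V) 0 1 z

end

/-! ### Vertical sides -/

section
variable {U V : ℝ} (hU : 2 ≤ U) (hV : 2 ≤ V) {m : ℝ} (hm : m = U ∨ m = -V)
include hU hV hm

/-- Multiplying by m absorbs the sign, so that the sides Re z = U/2 and Re z = -V/2 are handled by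
one argument. -/
theorem mul_re_le_of_mem {z : ℍ} (hz : z ∈ triangle U V) : m * z.re ≤ m ^ 2 / 2 := by
  obtain ⟨h1, h2, -⟩ := hz
  rcases hm with rfl | rfl <;> nlinarith

theorem mem_triangle_of_mul_re {z : ℍ} (h0 : 0 ≤ m * z.re) (h1 : m * z.re ≤ m ^ 2 / 2)
    (h2 : 1 ≤ z.re ^ 2 + z.im ^ 2) : z ∈ triangle U V := by
  rcases hm with rfl | rfl
  · have h3 : 0 ≤ z.re := nonneg_of_mul_nonneg_right h0 (by linarith)
    refine ⟨by linarith, ?_, h2⟩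
    have : m * z.re ≤ m * (m / 2) := by linarith
    exact le_of_mul_le_mul_left this (by linarith)
  · have h3 : 0 ≤ -z.re := nonneg_of_mul_nonneg_right (a := V) (by linarith) (by linarith)
    refine ⟨?_, by linarith, h2⟩
    have : V * -z.re ≤ V * (V / 2) := by linarith
    have := le_of_mul_le_mul_left this (by linarith)
    linarith

theorem exists_side_eq_refl : ∃ i, i ≠ 0 ∧ side U V i = refl m := by
  rcases hm with rfl | rfl
  exacts [⟨1, by decide, rfl⟩, ⟨2, by decide, rfl⟩]

theorem proj_refl (z : ℍ) : proj (modelGroup U V) (refl m z) = proj _ (inversion z) := by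
  obtain ⟨i, -, hi⟩ := exists_side_eq_refl hU hV hm
  rw [← hi, ← side_zero U V]
  exact proj_side i 0 z

theorem surfaceX_refl (z : ℍ) :
    surfaceX hU hV (proj _ (refl m z)) = surfaceX hU hV (proj _ z) := by
  obtain ⟨i, -, hi⟩ := exists_side_eq_refl hU hV hm
  rw [← hi, surfaceX_side]

theorem mem_pants_of_mul_surfaceX {p : Surface (modelGroup U V)} (h0 : 0 < m * surfaceX hU hV p)
    (h1 : m * surfaceX hU hV p < 1) : p ∈ pants hU hV := by
  rcases hm with rfl | rfl
  · have : 0 < surfaceX hU hV p := pos_of_mul_pos_right h0 (by linarith)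
    exact ⟨by nlinarith, h1⟩
  · have : 0 < -surfaceX hU hV p := pos_of_mul_pos_right (a := V) (by linarith) (by linarith)
    exact ⟨by linarith, by nlinarith⟩

theorem mul_surfaceX_le_of_mem {p : Surface (modelGroup U V)} (h : p ∈ pants hU hV) :
    m * surfaceX hU hV p < 1 := by
  rcases hm with rfl | rfl
  exacts [h.2, by linarith [h.1]]

end

section
variable {U V : ℝ} (hU : 2 ≤ U) (hV : 2 ≤ V) {σ : ℝ} (hσ : σ = 1 ∨ σ = -1)
  (hm : 2 * σ = U ∨ 2 * σ = -V)
include hU hV hσ hm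

/-- If `2 σ = U` or `2 σ = -V`, there is a cusp at `σ`. -/
theorem isCuspFilter_side : IsCuspFilter (modelGroup U V)
    (comap (fun p => 2 * σ * surfaceX hU hV p) (𝓝 1) ⊓ 𝓟 (pants hU hV)) := by
  have hσ2 : σ ^ 2 = 1 := by rcases hσ with rfl | rfl <;> norm_num
  have hre : ∀ w : ℍ, (toPSL (pairing σ) • w).re = σ - w.re / (w.re ^ 2 + w.im ^ 2) := fun w => by
    rw [pairing_smul]; rfl
  have him : ∀ w : ℍ, (toPSL (pairing σ) • w).im = w.im / (w.re ^ 2 + w.im ^ 2) := fun w => by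
    rw [pairing_smul]; rfl
  have hnorm : ∀ w : ℍ, (toPSL (pairing σ) • w).re ^ 2 + (toPSL (pairing σ) • w).im ^ 2 =
      1 + (1 - 2 * σ * w.re) / (w.re ^ 2 + w.im ^ 2) := fun w => by
    rw [hre, him]
    have := (normSq_pos' w).ne'
    field_simp
    linear_combination (w.re ^ 2 + w.im ^ 2) ^ 2 * hσ2
  -- The map z ↦ σ - 1/z sends ∞ to σ, the line Re w = 0 to Re z = σ and the line Re w = σ/2 to the
  -- unit circle. Near the cusp the triangle becomes a vertical strip between these two lines.
  have hrefl : ∀ w : ℍ, toPSL (pairing σ) • (refl 0 w) = refl (2 * σ) (toPSL (pairing σ) • w) := by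
    intro w
    apply UpperHalfPlane.ext_re_im
    · rw [hre, refl_re, refl_re, refl_im, hre]; ring
    · rw [him, refl_re, refl_im, refl_im, him]; ring
  have hinv : ∀ w : ℍ, toPSL (pairing σ) • (refl σ w) = inversion (toPSL (pairing σ) • w) := by
    intro w
    have h1 := normSq_pos' w
    have h2 := normSq_pos' (refl σ w)
    rw [refl_re, refl_im] at h2
    have h3 : (toPSL (pairing σ) • w).re ^ 2 + (toPSL (pairing σ) • w).im ^ 2 =
        ((σ - w.re) ^ 2 + w.im ^ 2) / (w.re ^ 2 + w.im ^ 2) := by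
      rw [hnorm]
      field_simp
      linear_combination -hσ2
    apply UpperHalfPlane.ext_re_im
    · rw [hre, inversion_re, h3, refl_re, refl_im, hre]
      field_simp
      linear_combination (σ - 2 * w.re) * hσ2
    · rw [him, inversion_im, h3, refl_re, refl_im, him]
      field_simp
  -- The denominator is of order 2 (Im w)² in that strip, so 1 - 2σX measures the height in the
  -- cusp.
  have hθ : ∀ w : ℍ, 1 - 2 * σ * kleinX (toPSL (pairing σ) • w) =
      1 / (2 * w.im ^ 2 + w.re ^ 2 + (w.re - σ) ^ 2) := by
    intro w
    have h1 := normSq_pos' w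
    have h2 : (0 : ℝ) < 2 * w.im ^ 2 + w.re ^ 2 + (w.re - σ) ^ 2 := by positivity
    have h3 : 1 + (toPSL (pairing σ) • w).re ^ 2 + (toPSL (pairing σ) • w).im ^ 2 =
        (2 * w.im ^ 2 + w.re ^ 2 + (w.re - σ) ^ 2) / (w.re ^ 2 + w.im ^ 2) := by
      rw [add_assoc, hnorm]
      field_simp
      linear_combination -hσ2
    rw [kleinX, h3, hre]
    field_simp
    linear_combination (-2 * w.im ^ 2 - 2 * w.re ^ 2 + 1) * hσ2
  have hmem : ∀ w : ℍ, toPSL (pairing σ) • w ∈ triangle U V → 0 ≤ σ * w.re ∧ σ * w.re ≤ 1 / 2 := by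
    intro w hw
    have h1 := mul_re_le_of_mem hU hV hm hw
    have h2 := hw.2.2
    have h3 := normSq_pos' w
    rw [hnorm, le_add_iff_nonneg_right, le_div_iff₀ h3] at h2
    rw [hre, mul_pow, hσ2] at h1
    have h4 : 0 ≤ σ * w.re / (w.re ^ 2 + w.im ^ 2) := by
      have : 2 * σ * (σ - w.re / (w.re ^ 2 + w.im ^ 2)) =
        2 * σ ^ 2 - 2 * (σ * w.re / (w.re ^ 2 + w.im ^ 2)) := by ring
      rw [this, hσ2] at h1
      linarith
    rw [le_div_iff₀ h3] at h4
    constructor <;> linarith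
  have hmem' : ∀ w : ℍ, 1 ≤ w.im → 0 ≤ σ * w.re → σ * w.re ≤ 1 / 2 →
      toPSL (pairing σ) • w ∈ triangle U V := by
    intro w hw h1 h2
    have h3 := normSq_pos' w
    have h4 : 0 ≤ σ * w.re / (w.re ^ 2 + w.im ^ 2) := by positivity
    have h5 : σ * w.re / (w.re ^ 2 + w.im ^ 2) ≤ 1 := by
      rw [div_le_one h3]; nlinarith
    have h6 : 2 * σ * (toPSL (pairing σ) • w).re =
        2 - 2 * (σ * w.re / (w.re ^ 2 + w.im ^ 2)) := by
      rw [hre]; linear_combination 2 * hσ2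
    refine mem_triangle_of_mul_re hU hV hm (by linarith) ?_ ?_
    · rw [h6, mul_pow, hσ2]; linarith
    · rw [hnorm, le_add_iff_nonneg_right]
      exact div_nonneg (by linarith) h3.le
  have hX : ∀ p, |surfaceX hU hV p| < 1 / 2 := by
    intro p
    obtain ⟨z, -, -, h5, -⟩ := exists_klein hU hV p
    rw [h5]
    exact abs_kleinX_lt z
  have hlt : ∀ p, 2 * σ * surfaceX hU hV p < 1 := by
    intro p
    have := abs_lt.1 (hX p)
    rcases hσ with rfl | rfl <;> linarith
  have hcomap : comap (fun p => 2 * σ * surfaceX hU hV p) (𝓝 1) =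
      comap (fun p => 1 - 2 * σ * surfaceX hU hV p) (𝓝 0) := by
    have h1 : comap (fun x : ℝ => 1 - x) (𝓝 0) = 𝓝 1 := by
      have := (Homeomorph.subLeft (1 : ℝ)).comap_nhds_eq 0
      simpa using this
    rw [← h1, comap_comap]
    rfl
  have hle : comap (fun p => 2 * σ * surfaceX hU hV p) (𝓝 1) ≤ 𝓟 (pants hU hV) := by
    rw [le_principal_iff]
    exact mem_comap.2 ⟨Set.Ioi 0, Ioi_mem_nhds one_pos, fun p hp =>
      mem_pants_of_mul_surfaceX hU hV hm hp (hlt p)⟩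
  refine ⟨toPSL (pairing σ), ?_, ?_⟩
  · have h1 : toPSL (pairing σ) * unitTranslation * (toPSL (pairing σ))⁻¹ =
        toPSL (pairing σ * translationMatrix * (pairing σ)⁻¹) := rfl
    rw [h1]
    rcases hσ with rfl | rfl
    · have h2 : pairing 1 * translationMatrix * (pairing 1)⁻¹ = (pairing 2)⁻¹ := by
        rw [mul_inv_eq_iff_eq_mul, eq_inv_mul_iff_mul_eq]
        apply Subtype.ext
        change !![2, -1; 1, 0] * (!![1, -1; 1, 0] * !![1, 1; 0, 1]) =
          (!![1, -1; 1, 0] : Matrix (Fin 2) (Fin 2) ℝ)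
        norm_num [Matrix.mul_fin_two]
      rw [h2, toPSL_inv]
      refine inv_mem (Subgroup.subset_closure ?_)
      rcases hm with h | h
      · left; rw [← h]; norm_num
      · linarith
    · have h2 : pairing (-1) * translationMatrix * (pairing (-1))⁻¹ = -(pairing (-2)) := by
        rw [mul_inv_eq_iff_eq_mul]
        apply Subtype.ext
        change !![-1, -1; 1, 0] * !![1, 1; 0, 1] =
          (-!![-2, -1; 1, 0] * !![-1, -1; 1, 0] : Matrix (Fin 2) (Fin 2) ℝ)
        rw [neg_mul, Matrix.mul_fin_two, Matrix.mul_fin_two, Matrix.neg_of]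
        norm_num
      rw [h2, toPSL_neg]
      refine Subgroup.subset_closure ?_
      rcases hm with h | h
      · linarith
      · right; rw [← h]; norm_num
  · rw [inf_eq_left.2 hle, hcomap]
    refine comap_eq_map_atImInfty ?_ ?_
    · refine squeeze_zero' (Eventually.of_forall fun w => ?_) ?_ tendsto_inv_im_sq
      · linarith [hlt (proj _ (toPSL (pairing σ) • w))]
      · rw [Filter.Eventually, atImInfty_mem]
        refine ⟨1, fun w hw => ?_⟩
        -- The estimate is explicit in the half strip 0 ≤ σ Re w ≤ 1/2; both boundary reflections
        -- preserve X and the height, so dihedral induction reaches every real part.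
        have key : ∀ x : ℝ, ∀ w : ℍ, w.re = x → 1 ≤ w.im →
            1 - 2 * σ * surfaceX hU hV (proj _ (toPSL (pairing σ) • w)) ≤ 1 / w.im ^ 2 := by
          have hA : ∀ x : ℝ, (∀ w : ℍ, w.re = x → 1 ≤ w.im →
              1 - 2 * σ * surfaceX hU hV (proj _ (toPSL (pairing σ) • w)) ≤ 1 / w.im ^ 2) →
              ∀ w : ℍ, w.re = 0 - x → 1 ≤ w.im →
              1 - 2 * σ * surfaceX hU hV (proj _ (toPSL (pairing σ) • w)) ≤ 1 / w.im ^ 2 := by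
            intro x hx w hw h1
            have h2 := hx (refl 0 w) (by rw [refl_re, hw]; ring) h1
            rwa [hrefl, surfaceX_refl hU hV hm] at h2
          have hB : ∀ x : ℝ, (∀ w : ℍ, w.re = x → 1 ≤ w.im →
              1 - 2 * σ * surfaceX hU hV (proj _ (toPSL (pairing σ) • w)) ≤ 1 / w.im ^ 2) →
              ∀ w : ℍ, w.re = σ - x → 1 ≤ w.im →
              1 - 2 * σ * surfaceX hU hV (proj _ (toPSL (pairing σ) • w)) ≤ 1 / w.im ^ 2 := by
            intro x hx w hw h1
            have h2 := hx (refl σ w) (by rw [refl_re, hw]; ring) h1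
            rw [hinv, ← side_zero U V, surfaceX_side] at h2
            exact h2
          have hC : ∀ x : ℝ, 0 ≤ σ * x → σ * x ≤ 1 / 2 → ∀ w : ℍ, w.re = x → 1 ≤ w.im →
              1 - 2 * σ * surfaceX hU hV (proj _ (toPSL (pairing σ) • w)) ≤ 1 / w.im ^ 2 := by
            rintro x h1 h2 w rfl h3
            rw [surfaceX_proj hU hV (hmem' w h3 h1 h2), hθ]
            exact one_div_le_one_div_of_le (by positivity) (by nlinarith)
          rcases hσ with rfl | rfl
          · exact dihedral_induction zero_lt_one hA hB fun x h1 h2 =>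
              hC x (by linarith) (by linarith)
          · exact dihedral_induction (by norm_num) hB hA fun x h1 h2 =>
              hC x (by linarith) (by linarith)
        exact key w.re w rfl hw
    · intro t
      -- In the strip (Re w)² + (Re w - σ)² < 3, so a denominator above 2t² + 3 forces Im w ≥ t.
      refine ⟨1 / (2 * t ^ 2 + 3), by positivity, fun p hp => ?_⟩
      obtain ⟨z, hz, h4, h5, -⟩ := exists_klein hU hV p
      rw [abs_of_pos (by linarith [hlt p]), h5] at hp
      obtain ⟨w, rfl⟩ : ∃ w, toPSL (pairing σ) • w = z := ⟨(toPSL (pairing σ))⁻¹ • z, smul_inv_smul _ _⟩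
      obtain ⟨h6, h7⟩ := hmem w hz
      have hw := w.im_pos
      rw [hθ, one_div_lt_one_div (by positivity) (by positivity)] at hp
      have h8 : t ≤ w.im := by
        by_contra h
        push Not at h
        have h9 : (σ * w.re) ^ 2 = w.re ^ 2 := by rw [mul_pow, hσ2, one_mul]
        nlinarith
      rcases h4 with h4 | h4
      · exact ⟨w, h8, h4.symm⟩
      · refine ⟨refl 0 w, h8, ?_⟩
        rw [hrefl, proj_refl hU hV hm, h4]

end

/-! ### Boundary geodesics -/

/-- The axis of `pairing (2 * σ * cosh (ℓ / 2))`, parametrized by arc length. -/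
noncomputable def axis (σ ℓ : ℝ) (hℓ : 0 < ℓ) (s : ℝ) : ℍ :=
  ⟨⟨σ * (Real.cosh (ℓ / 2) + Real.sinh (ℓ / 2) * (Real.sinh s / Real.cosh s)),
    Real.sinh (ℓ / 2) / Real.cosh s⟩,
    div_pos (Real.sinh_pos_iff.2 (half_pos hℓ)) (Real.cosh_pos s)⟩

section
variable {σ ℓ : ℝ} (hσ : σ = 1 ∨ σ = -1) (hℓ : 0 < ℓ)

theorem axis_re (s : ℝ) : (axis σ ℓ hℓ s).re =
    σ * (Real.cosh (ℓ / 2) + Real.sinh (ℓ / 2) * (Real.sinh s / Real.cosh s)) := rfl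

theorem axis_im (s : ℝ) : (axis σ ℓ hℓ s).im = Real.sinh (ℓ / 2) / Real.cosh s := rfl

theorem refl_axis (s : ℝ) :
    refl (2 * σ * Real.cosh (ℓ / 2)) (axis σ ℓ hℓ s) = axis σ ℓ hℓ (-s) := by
  apply UpperHalfPlane.ext_re_im
  · rw [refl_re, axis_re, axis_re, Real.sinh_neg, Real.cosh_neg]; ring
  · rw [refl_im, axis_im, axis_im, Real.cosh_neg]

include hσ

theorem sigma_sq : σ ^ 2 = 1 := by rcases hσ with rfl | rfl <;> norm_num

theorem isometry_axis : Isometry (axis σ ℓ hℓ) := by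
  refine Isometry.of_dist_eq fun s t => ?_
  have hR : 0 < Real.sinh (ℓ / 2) := Real.sinh_pos_iff.2 (half_pos hℓ)
  have hσ2 := sigma_sq hσ
  refine Real.cosh_strictMonoOn.injOn (Set.mem_Ici.2 dist_nonneg) (Set.mem_Ici.2 dist_nonneg) ?_
  rw [cosh_dist', Real.dist_eq, Real.cosh_abs, Real.cosh_sub, axis_re, axis_re, axis_im, axis_im]
  have h1 := Real.cosh_pos s
  have h2 := Real.cosh_pos t
  have h3 := Real.cosh_sq s
  have h4 := Real.cosh_sq t
  set R := Real.sinh (ℓ / 2)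
  set cs := Real.cosh s
  set ct := Real.cosh t
  have h5 : (σ * (Real.cosh (ℓ / 2) + R * (Real.sinh s / cs)) -
      σ * (Real.cosh (ℓ / 2) + R * (Real.sinh t / ct))) ^ 2 =
      R ^ 2 * (Real.sinh s / cs - Real.sinh t / ct) ^ 2 := by
    linear_combination (R * (Real.sinh s / cs - Real.sinh t / ct)) ^ 2 * hσ2
  rw [h5]
  field_simp
  have h6 : Real.sinh s ^ 2 = cs ^ 2 - 1 := by linarith
  have h7 : Real.sinh t ^ 2 = ct ^ 2 - 1 := by linarith
  linear_combination ct ^ 2 * h6 + cs ^ 2 * h7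

/-- The axis lies on the circle |z|² + 1 = m Re z with m = 2σ cosh(ℓ/2), the common perpendicular of
the unit circle and Re z = m/2. In Klein coordinates it is the chord mX = 1. -/
theorem axis_normSq (s : ℝ) : (axis σ ℓ hℓ s).re ^ 2 + (axis σ ℓ hℓ s).im ^ 2 =
    2 * σ * Real.cosh (ℓ / 2) * (axis σ ℓ hℓ s).re - 1 := by
  have hσ2 := sigma_sq hσ
  have h1 := Real.cosh_pos s
  have h3 := Real.cosh_sq s
  have h4 := Real.cosh_sq (ℓ / 2)
  rw [axis_re, axis_im]
  have h5 : (Real.sinh s / Real.cosh s) ^ 2 + (1 / Real.cosh s) ^ 2 = 1 := by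
    field_simp; linarith
  have h6 : Real.sinh (ℓ / 2) / Real.cosh s = Real.sinh (ℓ / 2) * (1 / Real.cosh s) := by ring
  rw [h6]
  set T := Real.sinh s / Real.cosh s
  set R := Real.sinh (ℓ / 2)
  set C := Real.cosh (ℓ / 2)
  linear_combination ((C + R * T) ^ 2 - 2 * C * (C + R * T)) * hσ2 + R ^ 2 * h5 - h4

theorem axis_normSq' (s : ℝ) : (axis σ ℓ hℓ s).re ^ 2 + (axis σ ℓ hℓ s).im ^ 2 =
    Real.cosh (ℓ + s) / Real.cosh s := by
  have hσ2 := sigma_sq hσ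
  have h1 := Real.cosh_pos s
  rw [axis_normSq hσ, axis_re, Real.cosh_add]
  have h4 := Real.cosh_sq (ℓ / 2)
  have h5 : Real.cosh ℓ = Real.cosh (ℓ / 2) ^ 2 + Real.sinh (ℓ / 2) ^ 2 := by
    rw [← Real.cosh_two_mul]; congr 1; ring
  have h6 : Real.sinh ℓ = 2 * Real.sinh (ℓ / 2) * Real.cosh (ℓ / 2) := by
    rw [← Real.sinh_two_mul]; congr 1; ring
  rw [h5, h6]
  field_simp
  linear_combination (2 * Real.cosh (ℓ / 2) * (Real.cosh (ℓ / 2) * Real.cosh s +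
    Real.sinh (ℓ / 2) * Real.sinh s)) * hσ2 + Real.cosh s * h4

/-- The inversion flips the axis about the parameter -ℓ/2, and `refl_axis` flips it about 0;
together they translate by ℓ. -/
theorem inversion_axis (s : ℝ) : inversion (axis σ ℓ hℓ s) = axis σ ℓ hℓ (-ℓ - s) := by
  have h1 := Real.cosh_pos s
  have h2 := Real.cosh_pos (ℓ + s)
  have h3 : -ℓ - s = -(ℓ + s) := by ring
  apply UpperHalfPlane.ext_re_im
  · rw [inversion_re, axis_normSq' hσ, axis_re, axis_re, h3, Real.sinh_neg, Real.cosh_neg]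
    have h4 : Real.cosh (ℓ / 2) * Real.cosh s + Real.sinh (ℓ / 2) * Real.sinh s =
        Real.cosh (ℓ / 2) * Real.cosh (ℓ + s) - Real.sinh (ℓ / 2) * Real.sinh (ℓ + s) := by
      rw [← Real.cosh_add, ← Real.cosh_sub, ← Real.cosh_neg (ℓ / 2 - (ℓ + s))]
      congr 1; ring
    field_simp
    linear_combination σ * h4
  · rw [inversion_im, axis_normSq' hσ, axis_im, axis_im, h3, Real.cosh_neg]
    field_simp

theorem mul_kleinX_axis (s : ℝ) :
    2 * σ * Real.cosh (ℓ / 2) * kleinX (axis σ ℓ hℓ s) = 1 := by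
  have h := axis_normSq hσ hℓ s
  have h1 := normSq_pos' (axis σ ℓ hℓ s)
  have h2 : 1 + (axis σ ℓ hℓ s).re ^ 2 + (axis σ ℓ hℓ s).im ^ 2 =
    2 * σ * Real.cosh (ℓ / 2) * (axis σ ℓ hℓ s).re := by linarith
  rw [kleinX, h2, ← mul_div_assoc, div_self]
  linarith

theorem exists_axis_eq {z : ℍ} (hz : 2 * σ * Real.cosh (ℓ / 2) * kleinX z = 1) :
    ∃ s, axis σ ℓ hℓ s = z := by
  have hσ2 := sigma_sq hσ
  have hR : 0 < Real.sinh (ℓ / 2) := Real.sinh_pos_iff.2 (half_pos hℓ)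
  have h4 := Real.cosh_sq (ℓ / 2)
  rw [kleinX, ← mul_div_assoc, div_eq_one_iff_eq (klein_denom_pos z).ne'] at hz
  have him := z.im_pos
  have h1 : (σ * z.re - Real.cosh (ℓ / 2)) ^ 2 + z.im ^ 2 = Real.sinh (ℓ / 2) ^ 2 := by
    linear_combination z.re ^ 2 * hσ2 - hz + h4
  -- The parametrization gives sinh s = (σ Re z - cosh(ℓ/2)) / Im z.
  refine ⟨Real.arsinh ((σ * z.re - Real.cosh (ℓ / 2)) / z.im), ?_⟩
  have h2 : Real.cosh (Real.arsinh ((σ * z.re - Real.cosh (ℓ / 2)) / z.im)) =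
      Real.sinh (ℓ / 2) / z.im := by
    rw [Real.cosh_arsinh, ← Real.sqrt_sq (div_pos hR him).le]
    congr 1
    field_simp
    linarith
  apply UpperHalfPlane.ext_re_im
  · rw [axis_re, h2, Real.sinh_arsinh]
    field_simp
    linear_combination z.re * hσ2
  · rw [axis_im, h2]
    field_simp

end

section
variable {U V : ℝ} (hU : 2 ≤ U) (hV : 2 ≤ V)
include hU hV

theorem eq_of_proj_eq {z w : ℍ} (hz : z ∈ triangle U V) (hw : w ∈ triangle U V)
    (h : proj (modelGroup U V) z = proj _ w) : z = w := by
  obtain ⟨L, -, rfl⟩ := proj_eq_proj_iff.1 h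
  exact (word_eq_of_mem_triangle hU hV hw hz).1

/-- An identification across the two sheets is an odd word, so it fixes a point only on a side. -/
theorem eq_of_proj_eq_side {i : Fin 3} {z w : ℍ} (hz : z ∈ triangle U V) (hw : w ∈ triangle U V)
    (h : proj (modelGroup U V) z = proj _ (side U V i w)) : z = w ∧ ∃ j, z ∈ cap U V j := by
  obtain ⟨L, h1, h2⟩ := proj_eq_proj_iff.1 h
  have h3 : word U V (L ++ [i]) w = z := by rw [word_append, h2]; rfl
  obtain ⟨h4, h5⟩ := word_eq_of_mem_triangle hU hV hw (h3 ▸ hz)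
  have h6 : ¬ Even (L ++ [i]).length := by simpa [Nat.even_add_one] using h1
  have h7 : z = w := h3.symm.trans h4
  obtain ⟨j, hj⟩ := (h5.resolve_left fun h => h6 h.1).2
  exact ⟨h7, j, h7 ▸ mem_cap_of_side_eq_self hj⟩

theorem eq_of_proj_side_eq_side {i : Fin 3} {z w : ℍ} (hz : z ∈ triangle U V)
    (hw : w ∈ triangle U V)
    (h : proj (modelGroup U V) (side U V i z) = proj _ (side U V i w)) : z = w := by
  obtain ⟨L, h1, h2⟩ := proj_eq_proj_iff.1 h
  refine eq_of_proj_eq hU hV hz hw (proj_eq_proj_iff.2 ⟨i :: (L ++ [i]), ?_, ?_⟩)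
  · simpa [Nat.even_add_one] using h1
  · rw [word_cons, word_append, word_cons, word_nil, ← h2, side_side]

end

section
variable {U V : ℝ} (hU : 2 ≤ U) (hV : 2 ≤ V) {σ ℓ : ℝ} (hσ : σ = 1 ∨ σ = -1) (hℓ : 0 < ℓ)
  (hm : 2 * σ * Real.cosh (ℓ / 2) = U ∨ 2 * σ * Real.cosh (ℓ / 2) = -V)
include hU hV hσ hℓ hm

theorem axis_mem_triangle {s : ℝ} (h1 : -ℓ / 2 ≤ s) (h2 : s ≤ 0) :
    axis σ ℓ hℓ s ∈ triangle U V := by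
  have hσ2 := sigma_sq hσ
  have hR : 0 < Real.sinh (ℓ / 2) := Real.sinh_pos_iff.2 (half_pos hℓ)
  have hn := axis_normSq hσ hℓ s
  have hp := normSq_pos' (axis σ ℓ hℓ s)
  refine mem_triangle_of_mul_re hU hV hm (by linarith) ?_ ?_
  · rw [axis_re]
    have h3 : Real.sinh s / Real.cosh s ≤ 0 :=
      div_nonpos_of_nonpos_of_nonneg (Real.sinh_nonpos_iff.2 h2) (Real.cosh_pos s).le
    have h4 : Real.cosh (ℓ / 2) * (Real.sinh (ℓ / 2) * (Real.sinh s / Real.cosh s)) ≤ 0 :=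
      mul_nonpos_of_nonneg_of_nonpos (Real.cosh_pos _).le
        (mul_nonpos_of_nonneg_of_nonpos hR.le h3)
    have h5 : 2 * σ * Real.cosh (ℓ / 2) * (σ * (Real.cosh (ℓ / 2) + Real.sinh (ℓ / 2) *
      (Real.sinh s / Real.cosh s))) = σ ^ 2 * (2 * Real.cosh (ℓ / 2) ^ 2 +
        2 * (Real.cosh (ℓ / 2) * (Real.sinh (ℓ / 2) * (Real.sinh s / Real.cosh s)))) := by ring
    rw [h5, mul_pow, mul_pow, hσ2]
    linarith
  · rw [axis_normSq' hσ, le_div_iff₀ (Real.cosh_pos s), one_mul, Real.cosh_le_cosh,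
      abs_of_nonpos h2, abs_of_nonneg (by linarith)]
    linarith

theorem periodic_proj_axis :
    Function.Periodic (fun s => proj (modelGroup U V) (axis σ ℓ hℓ s)) ℓ := by
  intro s
  have h1 := refl_axis (σ := σ) hℓ (s + ℓ)
  have h2 := inversion_axis hσ hℓ (-(s + ℓ))
  have h3 : -ℓ - -(s + ℓ) = s := by ring
  rw [← h1, h3] at h2
  change proj _ _ = proj _ _
  rw [← h2, ← proj_refl hU hV hm, refl_refl]

/-- The parameters in [-ℓ/2, 0] run in the triangle and those in (0, ℓ/2) in its mirror image. A
coincidence between the halves must lie on a side: the circle is met only at -ℓ/2, the near vertical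
line only at 0, and the far one is excluded by the sign of the real part. -/
theorem proj_axis_inj {s t : ℝ} (hs : -ℓ / 2 ≤ s) (hs' : s < ℓ / 2) (ht : -ℓ / 2 ≤ t)
    (ht' : t < ℓ / 2)
    (h : proj (modelGroup U V) (axis σ ℓ hℓ s) = proj _ (axis σ ℓ hℓ t)) : s = t := by
  have hinj := (isometry_axis hσ hℓ).injective
  obtain ⟨i, hi0, hi⟩ := exists_side_eq_refl hU hV hm
  have hrefl : ∀ x, axis σ ℓ hℓ x = side U V i (axis σ ℓ hℓ (-x)) := fun x => by
    rw [hi, refl_axis, neg_neg]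
  have hmixed : ∀ x y : ℝ, -ℓ / 2 ≤ x → x ≤ 0 → 0 < y → y < ℓ / 2 →
      proj (modelGroup U V) (axis σ ℓ hℓ x) ≠ proj _ (axis σ ℓ hℓ y) := by
    intro x y hx hx' hy hy' hxy
    rw [hrefl y] at hxy
    have hxt := axis_mem_triangle hU hV hσ hℓ hm hx hx'
    obtain ⟨h1, j, hj⟩ := eq_of_proj_eq_side hU hV hxt
      (axis_mem_triangle hU hV hσ hℓ hm (s := -y) (by linarith) (by linarith)) hxy
    have h2 := hinj h1
    have h3 := side_eq_self hj hxt
    by_cases hj0 : j = 0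
    · subst hj0
      rw [side_zero, inversion_axis hσ] at h3
      have := hinj h3
      linarith
    · have hji : j = i := by
        by_contra hji
        have hn := axis_normSq hσ hℓ x
        have hp := normSq_pos' (axis σ ℓ hℓ x)
        have h4 : 0 < 2 * σ * Real.cosh (ℓ / 2) * (axis σ ℓ hℓ x).re := by linarith
        rcases hm with hm | hm
        · rw [hm] at h4 hi
          have h5 : 0 < (axis σ ℓ hℓ x).re := pos_of_mul_pos_right h4 (by linarith)
          have hi1 : i = 1 := by
            fin_cases i
            · exact absurd rfl hi0
            · rfl
            · have := congrArg UpperHalfPlane.re (congrFun hi (axis σ ℓ hℓ x))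
              simp at this
              linarith
          have hj2 : j = 2 := by omega
          subst hj2
          rw [mem_cap_two] at hj
          linarith
        · rw [hm] at h4 hi
          have h5 : 0 < -(axis σ ℓ hℓ x).re :=
            pos_of_mul_pos_right (a := V) (by linarith) (by linarith)
          have hi1 : i = 2 := by
            fin_cases i
            · exact absurd rfl hi0
            · have := congrArg UpperHalfPlane.re (congrFun hi (axis σ ℓ hℓ x))
              simp at this
              linarith
            · rfl
          have hj2 : j = 1 := by omega
          subst hj2
          rw [mem_cap_one] at hj
          linarith
      rw [hji, hi, refl_axis] at h3
      have := hinj h3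
      linarith
  rcases le_or_gt s 0 with h1 | h1 <;> rcases le_or_gt t 0 with h2 | h2
  · exact hinj (eq_of_proj_eq hU hV (axis_mem_triangle hU hV hσ hℓ hm hs h1)
      (axis_mem_triangle hU hV hσ hℓ hm ht h2) h)
  · exact absurd h (hmixed s t hs h1 h2 ht')
  · exact absurd h.symm (hmixed t s ht h2 h1 hs')
  · rw [hrefl s, hrefl t] at h
    exact neg_injective (hinj (eq_of_proj_side_eq_side hU hV
      (axis_mem_triangle hU hV hσ hℓ hm (s := -s) (by linarith) (by linarith))
      (axis_mem_triangle hU hV hσ hℓ hm (s := -t) (by linarith) (by linarith)) h))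

/-- The identity holds on the segment inside the triangle, and the flips about -ℓ/2 and 0 are
reflections, which leave X invariant on the surface. -/
theorem surfaceX_axis (s : ℝ) :
    2 * σ * Real.cosh (ℓ / 2) * surfaceX hU hV (proj _ (axis σ ℓ hℓ s)) = 1 := by
  refine dihedral_induction (a := -ℓ) (b := 0) (P := fun s =>
    2 * σ * Real.cosh (ℓ / 2) * surfaceX hU hV (proj _ (axis σ ℓ hℓ s)) = 1) (by linarith)
    ?_ ?_ ?_ s
  · intro x hx
    rwa [← inversion_axis hσ, ← side_zero U V, surfaceX_side]
  · intro x hx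
    rwa [zero_sub, ← refl_axis, surfaceX_refl hU hV hm]
  · intro x h1 h2
    rw [surfaceX_proj hU hV (axis_mem_triangle hU hV hσ hℓ hm h1 (by linarith)),
      mul_kleinX_axis hσ]

theorem isSimpleClosedGeodesic_axis : IsSimpleClosedGeodesic (modelGroup U V) ℓ
    {p | 2 * σ * Real.cosh (ℓ / 2) * surfaceX hU hV p = 1} := by
  have hper := periodic_proj_axis hU hV hσ hℓ hm
  refine ⟨hℓ, axis σ ℓ hℓ, isometry_axis hσ hℓ, fun s t => ⟨fun h => ?_, ?_⟩, ?_⟩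
  · have h1 : ∀ x, proj (modelGroup U V) (axis σ ℓ hℓ (toIcoMod hℓ (-ℓ / 2) x)) =
        proj _ (axis σ ℓ hℓ x) := fun x => by
      have := hper.sub_zsmul_eq (x := x) (toIcoDiv hℓ (-ℓ / 2) x)
      rwa [self_sub_toIcoDiv_zsmul] at this
    have h2 : ∀ x, toIcoMod hℓ (-ℓ / 2) x < ℓ / 2 := fun x => by
      have := toIcoMod_lt_right hℓ (-ℓ / 2) x
      linarith
    have h3 := proj_axis_inj hU hV hσ hℓ hm (left_le_toIcoMod hℓ (-ℓ / 2) s) (h2 s)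
      (left_le_toIcoMod hℓ (-ℓ / 2) t) (h2 t) (by rw [h1, h1, h])
    refine ⟨toIcoDiv hℓ (-ℓ / 2) s - toIcoDiv hℓ (-ℓ / 2) t, ?_⟩
    have h4 := toIcoMod_add_toIcoDiv_zsmul hℓ (-ℓ / 2) s
    have h5 := toIcoMod_add_toIcoDiv_zsmul hℓ (-ℓ / 2) t
    rw [zsmul_eq_mul] at h4 h5
    push_cast
    linear_combination h3 - h4 + h5
  · rintro ⟨n, hn⟩
    have h1 := hper.int_mul n t
    rw [← hn, add_sub_cancel] at h1
    exact h1
  · ext p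
    constructor
    · intro hp
      obtain ⟨z, hz, h1, h2, -⟩ := exists_klein hU hV p
      rw [Set.mem_ofPred_eq, h2] at hp
      obtain ⟨s, rfl⟩ := exists_axis_eq hσ hℓ hp
      rcases h1 with rfl | rfl
      · exact ⟨s, rfl⟩
      · refine ⟨-s, ?_⟩
        change proj _ _ = _
        rw [← refl_axis, proj_refl hU hV hm]
    · rintro ⟨s, rfl⟩
      exact surfaceX_axis hU hV hσ hℓ hm s

end

/-! ### Neighbourhoods of a boundary geodesic -/

section
variable {U V : ℝ} (hU : 2 ≤ U) (hV : 2 ≤ V) {m : ℝ} (hm : m = U ∨ m = -V) (hm2 : 4 < m ^ 2)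
include hU hV hm hm2

/-- In each sheet the collar is a compact region of the Klein plane. Its corner at mX = 1, Y = 1/2
is inside the open disc precisely because m² > 4; for m² = 4 it would be an ideal point. -/
theorem isCompact_collar : IsCompact {p | m * surfaceX hU hV p ∈ Set.Icc (1 / 2) 1} := by
  let Q : Set (ℝ × ℝ) := {q | 1 / 2 ≤ m * q.1 ∧ m * q.1 ≤ 1 ∧ 2 * (m * q.1) ≤ m ^ 2 * q.2 ∧
    q.2 ≤ 1 / 2}
  have hQ : IsCompact Q := by
    have h1 : IsClosed Q :=
      (isClosed_le (f := fun _ => 1 / 2) (g := fun q : ℝ × ℝ => m * q.1) (by fun_prop) (by fun_prop)).inter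
      ((isClosed_le (f := fun q : ℝ × ℝ => m * q.1) (g := fun _ => 1) (by fun_prop) (by fun_prop)).inter
      ((isClosed_le (f := fun q : ℝ × ℝ => 2 * (m * q.1)) (g := fun q : ℝ × ℝ => m ^ 2 * q.2) (by fun_prop) (by fun_prop)).inter
      (isClosed_le (f := fun q : ℝ × ℝ => q.2) (g := fun _ => 1 / 2) (by fun_prop) (by fun_prop))))
    refine (isCompact_Icc.prod isCompact_Icc : IsCompact (Set.Icc (-1 : ℝ) 1 ×ˢ
      Set.Icc (0 : ℝ) 1)).of_isClosed_subset h1 ?_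
    rintro ⟨a, b⟩ ⟨h2, h3, h4, h5⟩
    simp only at h2 h3 h4 h5
    have h6 : 0 < m ^ 2 * b := by linarith
    have h7 : 0 < b := pos_of_mul_pos_right h6 (by positivity)
    have h8 : a ^ 2 ≤ 1 := by
      have : (m * a) ^ 2 ≤ 1 := by nlinarith
      nlinarith [sq_nonneg a]
    have h9 := abs_le.1 ((sq_le_one_iff_abs_le_one a).1 h8)
    exact ⟨⟨h9.1, h9.2⟩, ⟨h7.le, by linarith⟩⟩
  have hdisc : ∀ q ∈ Q, q.1 ^ 2 + q.2 ^ 2 < q.2 := by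
    rintro ⟨a, b⟩ ⟨h2, h3, h4, h5⟩
    simp only at h2 h3 h4 h5 ⊢
    have h6 : (m * a) ^ 2 ≤ m * a := by nlinarith
    have hb : 0 < b := pos_of_mul_pos_right (by linarith : 0 < m ^ 2 * b) (by positivity)
    have h7 : a ^ 2 ≤ b / 2 := by
      have : m ^ 2 * a ^ 2 ≤ m ^ 2 * (b / 2) := by nlinarith
      exact le_of_mul_le_mul_left this (by linarith)
    rcases eq_or_lt_of_le h5 with h8 | h8
    · subst h8
      have : m ^ 2 * a ^ 2 < m ^ 2 * (1 / 4) := by nlinarith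
      have := lt_of_mul_lt_mul_left this (by positivity)
      linarith
    · nlinarith
  have hcont : ContinuousOn (fun q : ℝ × ℝ => ofKlein q.1 q.2) Q := fun q hq =>
    (continuousAt_ofKlein (hdisc q hq)).continuousWithinAt
  have hK := hQ.image_of_continuousOn hcont
  have hproj := (isOpenQuotientMap_proj (modelGroup U V)).continuous
  refine ((hK.image hproj).union (hK.image (hproj.comp continuous_inversion))).of_isClosed_subset
    (isClosed_Icc.preimage (continuous_const.mul (continuous_surfaceX hU hV))) ?_
  intro p hp
  obtain ⟨z, hz, h1, h2, -⟩ := exists_klein hU hV p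
  rw [Set.mem_ofPred_eq, h2] at hp
  have hmem : z ∈ (fun q : ℝ × ℝ => ofKlein q.1 q.2) '' Q := by
    refine ⟨(kleinX z, kleinY z), ⟨hp.1, hp.2, ?_, kleinY_le hz⟩, ofKlein_klein z⟩
    have h3 := mul_re_le_of_mem hU hV hm hz
    have h4 := kleinY_pos z
    change 2 * (m * kleinX z) ≤ m ^ 2 * kleinY z
    rw [kleinX_eq]
    nlinarith
  rcases h1 with rfl | rfl
  · exact Or.inl ⟨z, hmem, rfl⟩
  · exact Or.inr ⟨z, hmem, rfl⟩

/-- Outside an open neighbourhood of the level set, mX stays away from 1 on the compact collar, so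
closeness of mX to 1 forces a point of the Y-piece into that neighbourhood. -/
theorem comap_surfaceX_eq_nhdsSet :
    comap (fun p => m * surfaceX hU hV p) (𝓝 1) ⊓ 𝓟 (pants hU hV) =
      𝓝ˢ {p | m * surfaceX hU hV p = 1} ⊓ 𝓟 (pants hU hV) := by
  have hf : Continuous fun p => m * surfaceX hU hV p :=
    continuous_const.mul (continuous_surfaceX hU hV)
  refine le_antisymm (le_inf ?_ inf_le_right) (inf_le_inf_right _ ?_)
  · intro A hA
    obtain ⟨O, hO, hβ, hOA⟩ := mem_nhdsSet_iff_exists.1 hA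
    have h1 : IsCompact ((fun p => m * surfaceX hU hV p) ''
        ({p | m * surfaceX hU hV p ∈ Set.Icc (1 / 2) 1} \ O)) :=
      ((isCompact_collar hU hV hm hm2).diff hO).image hf
    have h2 : (1 : ℝ) ∉ (fun p => m * surfaceX hU hV p) ''
        ({p | m * surfaceX hU hV p ∈ Set.Icc (1 / 2) 1} \ O) := by
      rintro ⟨p, ⟨-, hp⟩, hp1⟩
      exact hp (hβ hp1)
    have h3 := inter_mem (h1.isClosed.compl_mem_nhds h2)
      (Ioi_mem_nhds (show (1 / 2 : ℝ) < 1 by norm_num))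
    filter_upwards [mem_inf_of_left (preimage_mem_comap h3),
      mem_inf_of_right (mem_principal_self _)] with p hp hp2
    apply hOA
    by_contra hpO
    exact hp.1 ⟨p, ⟨⟨le_of_lt hp.2, (mul_surfaceX_le_of_mem hU hV hm hp2).le⟩, hpO⟩, rfl⟩
  · rw [← map_le_iff_le_comap, ← nhdsSet_singleton]
    exact hf.tendsto_nhdsSet fun p hp => hp

end

/-! ### The Y-piece in the model surface -/

theorem two_le_lengthTrace (a : ℝ) : 2 ≤ lengthTrace a := by
  have := Real.one_le_cosh (a / 2)
  rw [lengthTrace]; linarith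

/-- The cases σ = 1 and σ = -1 are the ends of u and v. At ℓ = 0 the level set is empty since |X| <
1/2 in the disc, and the cusp alternative takes over. -/
theorem boundary_model {U V : ℝ} (hU : 2 ≤ U) (hV : 2 ≤ V) {σ ℓ : ℝ} (hσ : σ = 1 ∨ σ = -1)
    (hℓ : 0 ≤ ℓ) (hm : σ * lengthTrace ℓ = U ∨ σ * lengthTrace ℓ = -V) :
    (0 < ℓ ∧ IsSimpleClosedGeodesic (modelGroup U V) ℓ
        {p | σ * lengthTrace ℓ * surfaceX hU hV p = 1} ∧
      comap (fun p => σ * lengthTrace ℓ * surfaceX hU hV p) (𝓝 1) ⊓ 𝓟 (pants hU hV) =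
        𝓝ˢ {p | σ * lengthTrace ℓ * surfaceX hU hV p = 1} ⊓ 𝓟 (pants hU hV)) ∨
    (ℓ = 0 ∧ {p | σ * lengthTrace ℓ * surfaceX hU hV p = 1} = ∅ ∧
      IsCuspFilter (modelGroup U V)
        (comap (fun p => σ * lengthTrace ℓ * surfaceX hU hV p) (𝓝 1) ⊓ 𝓟 (pants hU hV))) := by
  have hσ2 : σ ^ 2 = 1 := by rcases hσ with rfl | rfl <;> norm_num
  rcases hℓ.eq_or_lt with rfl | hℓ
  · right
    have h0 : σ * lengthTrace 0 = 2 * σ := by simp [lengthTrace, mul_comm]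
    rw [h0] at hm ⊢
    refine ⟨rfl, ?_, isCuspFilter_side hU hV hσ hm⟩
    refine Set.eq_empty_iff_forall_notMem.2 fun p hp => ?_
    obtain ⟨z, -, -, h5, -⟩ := exists_klein hU hV p
    rw [Set.mem_ofPred_eq, h5] at hp
    have := abs_lt.1 (abs_kleinX_lt z)
    rcases hσ with rfl | rfl <;> linarith
  · left
    have h0 : σ * lengthTrace ℓ = 2 * σ * Real.cosh (ℓ / 2) := by rw [lengthTrace]; ring
    refine ⟨hℓ, ?_, ?_⟩
    · rw [h0] at hm ⊢
      exact isSimpleClosedGeodesic_axis hU hV hσ hℓ hm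
    · refine comap_surfaceX_eq_nhdsSet hU hV hm ?_
      have h1 : 1 < Real.cosh (ℓ / 2) := Real.one_lt_cosh.2 (by positivity)
      rw [mul_pow, hσ2, lengthTrace]
      nlinarith

theorem isYPiece_model {u v : ℝ} (hu : 0 ≤ u) (hv : 0 ≤ v) :
    IsYPiece (modelGroup (lengthTrace u) (lengthTrace v)) ![u, v, 0]
      (closedPants (two_le_lengthTrace u) (two_le_lengthTrace v)) := by
  have hU := two_le_lengthTrace u
  have hV := two_le_lengthTrace v
  have hint := interior_closedPants hU hV
  refine ⟨fun z _ => stabilizer_modelGroup hU hV z, ?_, ?_⟩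
  · rw [hint, closure_pants]
  obtain ⟨φ, hφ⟩ := exists_homeo hU hV hint
  have h0 := boundary_model hU hV (σ := 1) (Or.inl rfl) hu (Or.inl (one_mul _))
  have h1 := boundary_model hU hV (σ := -1) (Or.inr rfl) hv (Or.inr (neg_one_mul _))
  rw [one_mul] at h0
  rw [neg_one_mul] at h1
  refine ⟨puncture, ![{p | lengthTrace u * surfaceX hU hV p = 1},
    {p | -lengthTrace v * surfaceX hU hV p = 1}, ∅], φ, puncture_injective, ?_, ?_, ?_⟩
  · rw [frontier_closedPants]
    ext p
    simp [Fin.exists_fin_succ]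
  · have hd : Disjoint {p | lengthTrace u * surfaceX hU hV p = 1}
        {p | -lengthTrace v * surfaceX hU hV p = 1} := by
      refine Set.disjoint_left.2 fun p h2 h3 => ?_
      rw [Set.mem_ofPred_eq] at h2 h3
      have h4 : 0 < surfaceX hU hV p := by
        by_contra h5
        nlinarith
      nlinarith
    intro i j hij
    fin_cases i <;> fin_cases j <;> first
      | exact absurd rfl hij
      | exact hd
      | exact hd.symm
      | exact Set.disjoint_empty _
      | exact Set.empty_disjoint _
  · intro i F
    fin_cases i
    · have hF : F = _ := end_zero hU hV hint hφ
      rw [hF]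
      rw [hint]
      exact h0
    · have hF : F = _ := end_one hU hV hint hφ
      rw [hF]
      rw [hint]
      exact h1
    · have hF : F = _ := end_two hU hV hint hφ
      rw [hF]
      right
      refine ⟨rfl, rfl, ?_⟩
      rw [hint]
      exact isCuspFilter_infty hU hV

/-! ### Conjugation -/

theorem isometry_smul_PSL (g : PSL(2, ℝ)) : Isometry fun z : ℍ => g • z := by
  obtain ⟨A, rfl⟩ := toPSL_surjective g
  exact isometry_smul ℍ A

section
variable {Γ Δ : Subgroup PSL(2, ℝ)} {h : PSL(2, ℝ)} (hΔ : ∀ γ, γ ∈ Δ ↔ h * γ * h⁻¹ ∈ Γ)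

theorem proj_eq_proj {z w : ℍ} : proj Γ z = proj Γ w ↔ ∃ γ ∈ Γ, γ • w = z := by
  rw [proj, proj, Quotient.eq, MulAction.orbitRel_apply, MulAction.mem_orbit_iff]
  exact ⟨fun ⟨γ, hγ⟩ => ⟨γ, γ.2, hγ⟩, fun ⟨γ, hγ, h⟩ => ⟨⟨γ, hγ⟩, h⟩⟩

include hΔ

theorem proj_smul_eq_iff {z w : ℍ} :
    proj Γ (h • z) = proj Γ (h • w) ↔ proj Δ z = proj Δ w := by
  rw [proj_eq_proj, proj_eq_proj]
  constructor
  · rintro ⟨γ, hγ, h1⟩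
    refine ⟨h⁻¹ * γ * h, (hΔ _).2 (by simpa [mul_assoc] using hγ), ?_⟩
    rw [mul_smul, mul_smul, h1, inv_smul_smul]
  · rintro ⟨γ, hγ, rfl⟩
    exact ⟨_, (hΔ γ).1 hγ, by simp [mul_smul]⟩

/-- Conjugate groups have homeomorphic quotients. -/
theorem exists_surface_homeo : ∃ e : Surface Δ ≃ₜ Surface Γ, ∀ z, e (proj Δ z) = proj Γ (h • z) := by
  have hc : Continuous fun z : ℍ => proj Γ (h • z) :=
    (isOpenQuotientMap_proj Γ).continuous.comp (continuous_const_smul h)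
  have hc' : Continuous fun z : ℍ => proj Δ (h⁻¹ • z) :=
    (isOpenQuotientMap_proj Δ).continuous.comp (continuous_const_smul h⁻¹)
  let f : Surface Δ → Surface Γ := Quotient.lift (fun z : ℍ => proj Γ (h • z)) fun z w hzw =>
    (proj_smul_eq_iff hΔ).2 (Quotient.sound hzw)
  let f' : Surface Γ → Surface Δ := Quotient.lift (fun z : ℍ => proj Δ (h⁻¹ • z)) fun z w hzw =>
    (proj_smul_eq_iff hΔ).1 (by rw [smul_inv_smul, smul_inv_smul]; exact Quotient.sound hzw)
  refine ⟨⟨⟨f, f', ?_, ?_⟩, hc.quotient_lift _, hc'.quotient_lift _⟩, fun z => rfl⟩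
  · intro p
    obtain ⟨z, rfl⟩ := (isOpenQuotientMap_proj Δ).surjective p
    change proj Δ (h⁻¹ • h • z) = _
    rw [inv_smul_smul]
  · intro p
    obtain ⟨z, rfl⟩ := (isOpenQuotientMap_proj Γ).surjective p
    change proj Γ (h • h⁻¹ • z) = _
    rw [smul_inv_smul]

theorem IsFuchsian.conj (hF : IsFuchsian Γ) : IsFuchsian Δ := by
  have : DiscreteTopology Γ := hF
  let f : Δ → Γ := fun γ => ⟨h * γ * h⁻¹, (hΔ γ).1 γ.2⟩
  have hf : Continuous f := by
    refine Continuous.subtype_mk ?_ _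
    exact (continuous_const.mul continuous_subtype_val).mul continuous_const
  exact DiscreteTopology.of_continuous_injective hf fun a b hab => by
    have := congrArg Subtype.val hab
    simpa [f] using this

theorem IsSimpleClosedGeodesic.conj {e : Surface Δ ≃ₜ Surface Γ}
    (he : ∀ z, e (proj Δ z) = proj Γ (h • z)) {ℓ : ℝ} {β : Set (Surface Δ)}
    (H : IsSimpleClosedGeodesic Δ ℓ β) : IsSimpleClosedGeodesic Γ ℓ (e '' β) := by
  obtain ⟨hℓ, γ, h1, h2, rfl⟩ := H
  refine ⟨hℓ, fun t => h • γ t, (isometry_smul_PSL h).comp h1, fun s t => ?_, ?_⟩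
  · rw [← h2, proj_smul_eq_iff hΔ]
  · rw [← Set.range_comp]
    congr 1
    funext t
    exact he _

theorem IsCuspFilter.conj {e : Surface Δ ≃ₜ Surface Γ}
    (he : ∀ z, e (proj Δ z) = proj Γ (h • z)) {F : Filter (Surface Δ)}
    (H : IsCuspFilter Δ F) : IsCuspFilter Γ (map e F) := by
  obtain ⟨g, h1, rfl⟩ := H
  refine ⟨h * g, ?_, ?_⟩
  · have := (hΔ _).1 h1
    simpa [mul_assoc] using this
  · rw [Filter.map_map]
    congr 1
    funext z
    rw [Function.comp_apply, he, mul_smul]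

omit hΔ in
theorem map_nhdsSet_homeomorph {X Y : Type*} [TopologicalSpace X] [TopologicalSpace Y]
    (e : X ≃ₜ Y) (s : Set X) : map e (𝓝ˢ s) = 𝓝ˢ (e '' s) := by
  refine le_antisymm (e.continuous.tendsto_nhdsSet (Set.mapsTo_image e s)) ?_
  have h1 : Tendsto e.symm (𝓝ˢ (e '' s)) (𝓝ˢ s) := e.symm.continuous.tendsto_nhdsSet (by
    rintro _ ⟨x, hx, rfl⟩
    simpa using hx)
  have h2 := Filter.map_mono (m := e) h1
  rw [Filter.map_map] at h2
  simpa using h2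

theorem IsYPiece.conj {e : Surface Δ ≃ₜ Surface Γ}
    (he : ∀ z, e (proj Δ z) = proj Γ (h • z)) {ℓ : Fin 3 → ℝ} {Y : Set (Surface Δ)}
    (H : IsYPiece Δ ℓ Y) : IsYPiece Γ ℓ (e '' Y) := by
  obtain ⟨H1, H2, p, β, φ, H3, H4, H5, H6⟩ := H
  have hint : interior (e '' Y) = e '' interior Y := (e.image_interior Y).symm
  refine ⟨fun z hz => ?_, ?_, ?_⟩
  · have h1 : proj Δ (h⁻¹ • z) ∈ Y := by
      obtain ⟨y, hy, h2⟩ := hz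
      have h3 := he (h⁻¹ • z)
      rw [smul_inv_smul, ← h2] at h3
      rwa [e.injective h3]
    have h2 := H1 _ h1
    rw [eq_bot_iff] at h2 ⊢
    rintro ⟨γ, hγ⟩ h3
    have h3 : γ • z = z := h3
    have h4 : h⁻¹ * γ * h ∈ Δ := (hΔ _).2 (by simpa [mul_assoc] using hγ)
    have h5 := h2 (show (⟨_, h4⟩ : Δ) ∈ MulAction.stabilizer Δ (h⁻¹ • z) by
      change (h⁻¹ * γ * h) • h⁻¹ • z = h⁻¹ • z
      rw [mul_smul, mul_smul, smul_inv_smul, h3])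
    rw [Subgroup.mem_bot] at h5 ⊢
    have h6 : h⁻¹ * γ * h = 1 := congrArg Subtype.val h5
    have h7 : γ = 1 := by
      have : γ = h * (h⁻¹ * γ * h) * h⁻¹ := by group
      rw [this, h6]; group
    exact Subtype.ext h7
  · rw [hint, ← e.image_closure, H2]
  · let ψ : interior Y ≃ₜ interior (e '' Y) := (e.image (interior Y)).trans (Homeomorph.setCongr hint.symm)
    have hψ : ∀ y, (ψ y : Surface Γ) = e y := fun y => rfl
    refine ⟨p, fun i => e '' β i, ψ.symm.trans φ, H3, ?_, ?_, fun i => ?_⟩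
    · rw [← e.image_frontier, H4, Set.image_iUnion]
    · exact fun i j hij => (Set.disjoint_image_iff e.injective).2 (H5 hij)
    · intro F
      have hF : F = map e (map (fun y : interior Y => (y : Surface Δ))
          (comap (fun y : interior Y => ((φ y : _) : OnePoint ℂ)) (𝓝 (p i)))) := by
        have h1 : comap (fun y : interior (e '' Y) => ((ψ.symm.trans φ y : _) : OnePoint ℂ))
            (𝓝 (p i)) =
            map ψ (comap (fun y : interior Y => ((φ y : _) : OnePoint ℂ)) (𝓝 (p i))) := by
          rw [Filter.map_eq_comap_of_inverse (n := ψ.symm) (funext ψ.apply_symm_apply)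
            (funext ψ.symm_apply_apply), Filter.comap_comap]
          rfl
        change map _ _ = _
        rw [h1, Filter.map_map, Filter.map_map]
        rfl
      rw [hF]
      rcases H6 i with ⟨h1, h2, h3⟩ | ⟨h1, h2, h3⟩
      · refine Or.inl ⟨h1, h2.conj hΔ he, ?_⟩
        rw [h3, Filter.map_inf e.injective, map_nhdsSet_homeomorph, Filter.map_principal, hint]
      · exact Or.inr ⟨h1, by change e '' β i = ∅; rw [h2, Set.image_empty], h3.conj hΔ he⟩

end

/-- A generator may be replaced by its inverse because both generate the same cyclic group. -/
theorem mem_closure_conj_iff {G : Type*} [Group G] {a b A B h : G}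
    (ha : h * a * h⁻¹ = A ∨ h * a * h⁻¹ = A⁻¹) (hb : h * b * h⁻¹ = B ∨ h * b * h⁻¹ = B⁻¹) (γ : G) :
    γ ∈ Subgroup.closure ({a, b} : Set G) ↔ h * γ * h⁻¹ ∈ Subgroup.closure ({A, B} : Set G) := by
  have hc (x y : G) (hx : h * x * h⁻¹ = y ∨ h * x * h⁻¹ = y⁻¹) : Subgroup.zpowers y =
      (Subgroup.zpowers x).map (MulAut.conj h).toMonoidHom := by
    rw [MonoidHom.map_zpowers]
    change _ = Subgroup.zpowers (h * x * h⁻¹)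
    rcases hx with hx | hx <;> rw [hx]
    rw [Subgroup.zpowers_inv]
  have h1 : Subgroup.closure ({A, B} : Set G) =
      (Subgroup.closure ({a, b} : Set G)).map (MulAut.conj h).toMonoidHom := by
    rw [Set.insert_eq, Set.insert_eq, Subgroup.closure_union, Subgroup.closure_union,
      Subgroup.map_sup, ← Subgroup.zpowers_eq_closure, ← Subgroup.zpowers_eq_closure,
      ← Subgroup.zpowers_eq_closure, ← Subgroup.zpowers_eq_closure, hc a A ha, hc b B hb]
  rw [h1]
  exact (Subgroup.mem_map_iff_mem (f := (MulAut.conj h).toMonoidHom) (MulAut.conj h).injective).symm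

/-- A group conjugate to the model group is Fuchsian, and its surface contains a Y-piece. -/
theorem exists_isYPiece_of_conj {u v : ℝ} (hu : 0 ≤ u) (hv : 0 ≤ v) {a b h : PSL(2, ℝ)}
    (ha : h * a * h⁻¹ = toPSL (pairing (lengthTrace u)) ∨
      h * a * h⁻¹ = (toPSL (pairing (lengthTrace u)))⁻¹)
    (hb : h * b * h⁻¹ = toPSL (pairing (-lengthTrace v)) ∨
      h * b * h⁻¹ = (toPSL (pairing (-lengthTrace v)))⁻¹) :
    IsFuchsian (Subgroup.closure {a, b}) ∧
      ∃ Y : Set (Surface (Subgroup.closure {a, b})),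
        IsYPiece (Subgroup.closure {a, b}) ![u, v, 0] Y := by
  have hU := two_le_lengthTrace u
  have hV := two_le_lengthTrace v
  have h1 : ∀ γ, γ ∈ Subgroup.closure {a, b} ↔
      h * γ * h⁻¹ ∈ modelGroup (lengthTrace u) (lengthTrace v) := mem_closure_conj_iff ha hb
  have h2 : ∀ γ, γ ∈ modelGroup (lengthTrace u) (lengthTrace v) ↔
      h⁻¹ * γ * h⁻¹⁻¹ ∈ Subgroup.closure {a, b} := fun γ => by
    rw [h1]; simp [mul_assoc]
  obtain ⟨e, he⟩ := exists_surface_homeo h2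
  exact ⟨(isFuchsian_modelGroup hU hV).conj h1, _, (isYPiece_model hu hv).conj h2 he⟩

/-! ### Reduction of the given matrices to the model group -/

/-- The matrix of `z ↦ c z + d`. -/
noncomputable def affineMatrix (c d : ℝ) (hc : 0 < c) : SL(2, ℝ) :=
  ⟨!![√c, d / √c; 0, 1 / √c], by
    have := (Real.sqrt_pos.2 hc).ne'
    simp [Matrix.det_fin_two, this]⟩

/-- With w = cz + d and determinant 1, c · T(z) + d = (a + d) - 1/w. The same affine map thus
normalizes both matrices, as they share the second row. -/
theorem affineMatrix_conj {a b c d m : ℝ} (hc : 0 < c) {T : SL(2, ℝ)}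
    (hT : (T : Matrix (Fin 2) (Fin 2) ℝ) = !![a, b; c, d]) (hm : a + d = m) :
    toPSL (affineMatrix c d hc) * toPSL T * (toPSL (affineMatrix c d hc))⁻¹ =
      toPSL (pairing m) := by
  rw [mul_inv_eq_iff_eq_mul, ← toPSL_mul, ← toPSL_mul]
  congr 1
  apply Subtype.ext
  have hdet := T.det_coe
  rw [hT, Matrix.det_fin_two_of] at hdet
  have h1 := Real.sqrt_pos.2 hc
  have h2 := Real.mul_self_sqrt hc.le
  change !![√c, d / √c; 0, 1 / √c] * (T : Matrix (Fin 2) (Fin 2) ℝ) =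
    !![m, -1; 1, 0] * !![√c, d / √c; 0, 1 / √c]
  rw [hT, Matrix.mul_fin_two, Matrix.mul_fin_two, ← hm]
  ext i j
  fin_cases i <;> fin_cases j
  · simp; field_simp; linear_combination (-d) * h2
  · simp; field_simp; linear_combination b * h2 - hdet
  · simp; field_simp; linear_combination -h2
  · simp [div_eq_inv_mul]

/-- Conjugation by z ↦ -1/z turns z ↦ m - 1/z into z ↦ -1/(z + m), the inverse of z ↦ -m - 1/z. It
handles ε = -1, where the normalized traces are -U and V. -/
theorem pairing_zero_conj (m : ℝ) :
    toPSL (pairing 0) * toPSL (pairing m) * (toPSL (pairing 0))⁻¹ =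
      (toPSL (pairing (-m)))⁻¹ := by
  have h : pairing (-m) * (pairing 0 * pairing m) = -pairing 0 := by
    apply Subtype.ext
    change !![-m, -1; 1, 0] * (!![0, -1; 1, 0] * !![m, -1; 1, 0]) =
      (-!![0, -1; 1, 0] : Matrix (Fin 2) (Fin 2) ℝ)
    ext i j
    fin_cases i <;> fin_cases j <;> simp
  rw [mul_inv_eq_iff_eq_mul, eq_inv_mul_iff_mul_eq, ← toPSL_mul, ← toPSL_mul, h, toPSL_neg]

theorem exists_isYPiece_of_pos {u v : ℝ} (hu : 0 ≤ u) (hv : 0 ≤ v) {a₁ b₁ a₂ b₂ c d ε : ℝ}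
    {Tu Tv : SL(2, ℝ)} (hTu : (Tu : Matrix (Fin 2) (Fin 2) ℝ) = !![a₁, b₁; c, d])
    (hTv : (Tv : Matrix (Fin 2) (Fin 2) ℝ) = !![a₂, b₂; c, d]) (hc : 0 < c)
    (hε : ε = 1 ∨ ε = -1) (hu_tr : a₁ + d = ε * lengthTrace u)
    (hv_tr : a₂ + d = -ε * lengthTrace v) :
    IsFuchsian (Subgroup.closure {toPSL Tu, toPSL Tv}) ∧
      ∃ Y : Set (Surface (Subgroup.closure {toPSL Tu, toPSL Tv})),
        IsYPiece (Subgroup.closure {toPSL Tu, toPSL Tv}) ![u, v, 0] Y := by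
  have h1 := affineMatrix_conj hc hTu hu_tr
  have h2 := affineMatrix_conj hc hTv hv_tr
  rcases hε with rfl | rfl
  · rw [one_mul] at h1
    rw [neg_one_mul] at h2
    exact exists_isYPiece_of_conj hu hv (Or.inl h1) (Or.inl h2)
  · rw [neg_one_mul] at h1
    rw [neg_neg, one_mul] at h2
    have key : ∀ x g : PSL(2, ℝ), toPSL (pairing 0) * g * x * (toPSL (pairing 0) * g)⁻¹ =
        toPSL (pairing 0) * (g * x * g⁻¹) * (toPSL (pairing 0))⁻¹ := fun x g => by group
    refine exists_isYPiece_of_conj (h := toPSL (pairing 0) * toPSL (affineMatrix c d hc)) hu hv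
      (Or.inr ?_) (Or.inr ?_)
    · rw [key, h1, pairing_zero_conj, neg_neg]
    · rw [key, h2, pairing_zero_conj]

end YPieces

theorem proposition3p3 (u v : ℝ) (hu : 0 ≤ u) (hv : 0 ≤ v)
    (a₁ b₁ a₂ b₂ c d ε : ℝ) (Tu Tv : SL(2, ℝ))
    (hTu : (Tu : Matrix (Fin 2) (Fin 2) ℝ) = !![a₁, b₁; c, d])
    (hTv : (Tv : Matrix (Fin 2) (Fin 2) ℝ) = !![a₂, b₂; c, d])
    (hc : c ≠ 0) (hε : ε = 1 ∨ ε = -1)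
    (hu_tr : a₁ + d = ε * YPieces.lengthTrace u)
    (hv_tr : a₂ + d = -ε * YPieces.lengthTrace v) :
    YPieces.IsFuchsian (Subgroup.closure {YPieces.toPSL Tu, YPieces.toPSL Tv}) ∧
      ∃ Y : Set (YPieces.Surface (Subgroup.closure {YPieces.toPSL Tu, YPieces.toPSL Tv})),
        YPieces.IsYPiece (Subgroup.closure {YPieces.toPSL Tu, YPieces.toPSL Tv}) ![u, v, 0] Y := by
  rcases hc.lt_or_gt with hc | hc
  -- Negating both matrices leaves their classes unchanged while reversing the signs of c and ε, so
  -- c may be taken positive.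
  · have h1 : ∀ {a b : ℝ} {T : SL(2, ℝ)},
        (T : Matrix (Fin 2) (Fin 2) ℝ) = !![a, b; c, d] →
        ((-T : SL(2, ℝ)) : Matrix (Fin 2) (Fin 2) ℝ) = !![-a, -b; -c, -d] := by
      intro a b T hT
      rw [Matrix.SpecialLinearGroup.coe_neg, hT]
      simp
    have h2 := YPieces.exists_isYPiece_of_pos hu hv (h1 hTu) (h1 hTv) (neg_pos.2 hc) (ε := -ε)
      (by rcases hε with rfl | rfl <;> simp) (by linarith) (by linarith)
    rwa [YPieces.toPSL_neg, YPieces.toPSL_neg] at h2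
  · exact YPieces.exists_isYPiece_of_pos hu hv hTu hTv hc hε hu_tr hv_tr
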